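/- **Setting.** All C*-algebras and morphisms are unital; morphisms are unital $*$-homomorphisms, $\otimes$ is the minimal (spatial) tensor product of C*-algebras, and $[X]$ denotes the closed linear span of $X$. A $\mathbb{T}$-C*-algebra is a C*-algebra $A$ with a point-norm continuous action $\rho$ of the circle group $\mathbb{T}$ by $*$-automorphisms; $a\in A$ is homogeneous of degree $n\in\mathbb{Z}$ if $\rho_z(a)=z^na$ for all $z\in\mathbb{T}$; $\mathrm{Mor}_{\mathbb{T}}(A,B)$ is the set of $\mathbb{T}$-equivariant morphisms. Let $\zeta\in\mathbb{T}$ and let $C(\mathbb{T}^2_\zeta)$ be the universal C*-algebra generated by two unitaries $u,v$ with $uv=\zeta vu$. For $\mathbb{T}$-C*-algebras $A,B$ let $\jmath_1:A\to C(\mathbb{T}^2_\zeta)\otimes A\otimes B$ and $\jmath_2:B\to C(\mathbb{T}^2_\zeta)\otimes A\otimes B$ be the morphisms with $\jmath_1(a)=u^n\otimes a\otimes 1$ and $\jmath_2(b)=v^n\otimes 1\otimes b$ for $a$, $b$ homogeneous of degree $n$. The braided tensor product is $A\boxtimes_\zeta B=[\jmath_1(A)\jmath_2(B)]$, with the action of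 $\mathbb{T}$ for which $\jmath_1,\jmath_2$ are equivariant. For equivariant morphisms $\Phi:A\to A'$, $\Psi:B\to B'$ the equivariant morphism $\Phi\boxtimes_\zeta\Psi:A\boxtimes_\zeta B\to A'\boxtimes_\zeta B'$ is determined by $\jmath_1(a)\jmath_2(b)\mapsto\jmath_1(\Phi(a))\jmath_2(\Psi(b))$. Let $q\in\mathbb{C}$ with $0<|q|<1$ and $\zeta=q/\overline{q}$. Let $C(\mathrm{SU}_q(2))$ be the universal unital C*-algebra generated by $\alpha,\gamma$ with $$\alpha^*\alpha+\gamma^*\gamma=1,\qquad \alpha\alpha^*+|q|^2\gamma^*\gamma=1,\qquad \alpha\gamma=\overline{q}\,\gamma\alpha,\qquad \gamma\gamma^*=\gamma^*\gamma,$$ with the $\mathbb{T}$-action $\rho_z(\alpha)=\alpha$, $\rho_z(\gamma)=z\gamma$. Let $\Delta\in\mathrm{Mor}_{\mathbb{T}}\bigl(C(\mathrm{SU}_q(2)),C(\mathrm{SU}_q(2))\boxtimes_\zeta C(\mathrm{SU}_q(2))\bigr)$ be given by $$\Delta(\alpha)=\jmath_1(\alpha)\jmath_2(\alpha)-q\,\jmath_1(\gamma^*)\jmath_2(\gamma),\qquad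 \Delta(\gamma)=\jmath_1(\gamma)\jmath_2(\alpha)+\jmath_1(\alpha^*)\jmath_2(\gamma).$$ Let $\pi:C(\mathrm{SU}_q(2))\to C(\mathbb{T})$ be the morphism that sends $\alpha$ to the identity function of $\mathbb{T}$ and $\gamma$ to $0$; it is equivariant for the trivial action on $C(\mathbb{T})$. The quotient sphere $\mathbb{S}^2_q=\mathrm{SU}_q(2)/\mathbb{T}$ is given by the $\mathbb{T}$-invariant C*-subalgebra $$C(\mathbb{S}^2_q)=\{a\in C(\mathrm{SU}_q(2)) : (\mathrm{id}\boxtimes_\zeta\pi)(\Delta(a))=\jmath_1(a)\},$$ with inclusion $\iota:C(\mathbb{S}^2_q)\to C(\mathrm{SU}_q(2))$. **Theorem.** The morphism $\mathrm{id}\boxtimes_\zeta\iota$ from $C(\mathrm{SU}_q(2))\boxtimes_\zeta C(\mathbb{S}^2_q)$ to $C(\mathrm{SU}_q(2))\boxtimes_\zeta C(\mathrm{SU}_q(2))$ is injective, and, with its domain thus regarded as a subalgebra of its target, $\Gamma=\Delta|_{C(\mathbb{S}^2_q)}$ belongs to $\mathrm{Mor}_{\mathbb{T}}\bigl(C(\mathbb{S}^2_q),C(\mathrm{SU}_q(2))\boxtimes_\zeta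 C(\mathbb{S}^2_q)\bigr)$; that is, there is $\Gamma$ in this set with $(\mathrm{id}\boxtimes_\zeta\iota)\circ\Gamma=\Delta\circ\iota$. Moreover: 1. $(\mathrm{id}\boxtimes_\zeta\Gamma)\circ\Gamma=(\Delta\boxtimes_\zeta\mathrm{id})\circ\Gamma$, where the two codomains are identified by the canonical isomorphism $$\bigl(C(\mathrm{SU}_q(2))\boxtimes_\zeta C(\mathrm{SU}_q(2))\bigr)\boxtimes_\zeta C(\mathbb{S}^2_q)\;\cong\;C(\mathrm{SU}_q(2))\boxtimes_\zeta\bigl(C(\mathrm{SU}_q(2))\boxtimes_\zeta C(\mathbb{S}^2_q)\bigr)$$ that matches the embeddings of the three factors (and exists); 2. $\bigl[\jmath_1(C(\mathrm{SU}_q(2)))\,\Gamma(C(\mathbb{S}^2_q))\bigr]=C(\mathrm{SU}_q(2))\boxtimes_\zeta C(\mathbb{S}^2_q)$; 3. for $x\in C(\mathbb{S}^2_q)$ one has $\Gamma(x)=\jmath_2(x)$ if and only if $x\in\mathbb{C}1$. -/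

import Mathlib

open scoped TensorProduct ComplexConjugate CStarAlgebra

noncomputable section

namespace BraidedSphere

/-! ### Enveloping C⋆-algebras -/

/-- A family of unital `*`-homomorphisms from a complex `*`-algebra `P` to C⋆-algebras that is
pointwise bounded in norm. -/
structure RepFamily (P : Type) [Ring P] [StarRing P] [Algebra ℂ P] where
  /-- the homomorphisms that belong to the family -/
  Rep : ∀ (D : Type) [CStarAlgebra D], (P →⋆ₐ[ℂ] D) → Prop
  bdd : ∀ x : P, ∃ C : ℝ, ∀ (D : Type) [CStarAlgebra D] (f : P →⋆ₐ[ℂ] D), Rep D f → ‖f x‖ ≤ C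

namespace RepFamily

section Seminorm

variable {P : Type} [Ring P] [StarRing P] [Algebra ℂ P] (F : RepFamily P)

/-- The seminorm `x ↦ sup ‖f x‖`, the supremum being over the family. -/
def seminorm (x : P) : ℝ :=
  sSup {r : ℝ | ∃ (D : Type) (_ : CStarAlgebra D) (f : P →⋆ₐ[ℂ] D), F.Rep D f ∧ r = ‖f x‖}

lemma le_seminorm {D : Type} [CStarAlgebra D] {f : P →⋆ₐ[ℂ] D} (hf : F.Rep D f) (x : P) :
    ‖f x‖ ≤ F.seminorm x := by
  obtain ⟨C, hC⟩ := F.bdd x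
  refine le_csSup ⟨C, ?_⟩ ⟨D, _, f, hf, rfl⟩
  rintro r ⟨D, _, f, hf, rfl⟩
  exact hC D f hf

lemma seminorm_le {x : P} {C : ℝ} (hC : 0 ≤ C)
    (h : ∀ (D : Type) [CStarAlgebra D] (f : P →⋆ₐ[ℂ] D), F.Rep D f → ‖f x‖ ≤ C) :
    F.seminorm x ≤ C := by
  refine Real.sSup_le ?_ hC
  rintro r ⟨D, _, f, hf, rfl⟩
  exact h D f hf

lemma seminorm_nonneg (x : P) : 0 ≤ F.seminorm x := by
  refine Real.sSup_nonneg ?_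
  rintro r ⟨D, _, f, hf, rfl⟩
  exact norm_nonneg _

lemma seminorm_smul_le (c : ℂ) (x : P) : F.seminorm (c • x) ≤ ‖c‖ * F.seminorm x := by
  refine F.seminorm_le (mul_nonneg (norm_nonneg _) (F.seminorm_nonneg _)) fun D _ f hf => ?_
  rw [map_smul, norm_smul]
  exact mul_le_mul_of_nonneg_left (F.le_seminorm hf x) (norm_nonneg _)

lemma seminorm_smul (c : ℂ) (x : P) : F.seminorm (c • x) = ‖c‖ * F.seminorm x := by
  refine le_antisymm (F.seminorm_smul_le c x) ?_
  rcases eq_or_ne c 0 with rfl | hc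
  · simpa using F.seminorm_nonneg _
  · have := F.seminorm_smul_le c⁻¹ (c • x)
    rw [smul_smul, inv_mul_cancel₀ hc, one_smul, norm_inv] at this
    have hc' : 0 < ‖c‖ := norm_pos_iff.2 hc
    calc ‖c‖ * F.seminorm x ≤ ‖c‖ * (‖c‖⁻¹ * F.seminorm (c • x)) :=
          mul_le_mul_of_nonneg_left this hc'.le
      _ = _ := by field_simp

lemma seminorm_add_le (x y : P) : F.seminorm (x + y) ≤ F.seminorm x + F.seminorm y := by
  refine F.seminorm_le (add_nonneg (F.seminorm_nonneg _) (F.seminorm_nonneg _)) fun D _ f hf => ?_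
  rw [map_add]
  exact (norm_add_le _ _).trans (add_le_add (F.le_seminorm hf x) (F.le_seminorm hf y))

lemma seminorm_mul_le (x y : P) : F.seminorm (x * y) ≤ F.seminorm x * F.seminorm y := by
  refine F.seminorm_le (mul_nonneg (F.seminorm_nonneg _) (F.seminorm_nonneg _)) fun D _ f hf => ?_
  rw [map_mul]
  exact (norm_mul_le _ _).trans (mul_le_mul (F.le_seminorm hf x) (F.le_seminorm hf y)
    (norm_nonneg _) (F.seminorm_nonneg _))

lemma seminorm_star_le (x : P) : F.seminorm (star x) ≤ F.seminorm x := by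
  refine F.seminorm_le (F.seminorm_nonneg _) fun D _ f hf => ?_
  rw [map_star, norm_star]
  exact F.le_seminorm hf x

lemma seminorm_sq_le (x : P) : F.seminorm x * F.seminorm x ≤ F.seminorm (star x * x) := by
  have h : F.seminorm x ≤ √(F.seminorm (star x * x)) := by
    refine F.seminorm_le (Real.sqrt_nonneg _) fun D _ f hf => ?_
    refine Real.le_sqrt_of_sq_le ?_
    have := F.le_seminorm hf (star x * x)
    rwa [map_mul, map_star, CStarRing.norm_star_mul_self, ← sq] at this
  calc _ ≤ √(F.seminorm (star x * x)) * √(F.seminorm (star x * x)) :=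
        mul_le_mul h h (F.seminorm_nonneg _) (Real.sqrt_nonneg _)
    _ = _ := Real.mul_self_sqrt (F.seminorm_nonneg _)

/-- The `*`-algebra `P`, to be equipped with the seminorm of the family `F`. -/
def Pre (_F : RepFamily P) : Type := P

instance : Ring F.Pre := inferInstanceAs (Ring P)
instance : StarRing F.Pre := inferInstanceAs (StarRing P)
instance : Algebra ℂ F.Pre := inferInstanceAs (Algebra ℂ P)
instance [StarModule ℂ P] : StarModule ℂ F.Pre := inferInstanceAs (StarModule ℂ P)
instance : Norm F.Pre := ⟨F.seminorm⟩

instance : SeminormedRing F.Pre :=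
  { (inferInstance : Ring F.Pre),
    SeminormedAddCommGroup.ofCore (𝕜 := ℂ) (E := F.Pre)
      { norm_nonneg := F.seminorm_nonneg
        norm_smul := F.seminorm_smul
        norm_triangle := F.seminorm_add_le } with
    norm_mul_le := F.seminorm_mul_le }

instance : NormedAlgebra ℂ F.Pre where
  norm_smul_le := F.seminorm_smul_le

instance : NormedStarGroup F.Pre where
  norm_star_le := F.seminorm_star_le

/-- The enveloping C⋆-algebra of `P` for the family `F`: the Hausdorff completion of `P` for the
seminorm `x ↦ sup ‖f x‖`. -/
def Env : Type := UniformSpace.Completion F.Pre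

open UniformSpace

instance : NormedRing F.Env := inferInstanceAs (NormedRing (Completion F.Pre))
instance : CompleteSpace F.Env := inferInstanceAs (CompleteSpace (Completion F.Pre))
instance : Algebra ℂ F.Env := inferInstanceAs (Algebra ℂ (Completion F.Pre))
instance : NormedAlgebra ℂ F.Env where
  norm_smul_le := norm_smul_le (α := ℂ) (β := Completion F.Pre)

lemma uniformContinuous_star : UniformContinuous (star : F.Pre → F.Pre) :=
  (starNormedAddGroupHom : NormedAddGroupHom F.Pre F.Pre).uniformContinuous

instance : Star F.Env := ⟨Completion.map (star : F.Pre → F.Pre)⟩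

/-- The canonical map of `P` to its enveloping C⋆-algebra. -/
def coe (x : P) : F.Env := ((show F.Pre from x : F.Pre) : Completion F.Pre)

lemma coe_star (x : P) : F.coe (star x) = star (F.coe x) :=
  (Completion.map_coe F.uniformContinuous_star (x : F.Pre)).symm

lemma norm_coe (x : P) : ‖F.coe x‖ = F.seminorm x := Completion.norm_coe (E := F.Pre) x
lemma coe_mul (x y : P) : F.coe (x * y) = F.coe x * F.coe y := Completion.coe_mul (α := F.Pre) x y
lemma coe_add (x y : P) : F.coe (x + y) = F.coe x + F.coe y := Completion.coe_add (α := F.Pre) x y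
lemma coe_smul (c : ℂ) (x : P) : F.coe (c • x) = c • F.coe x :=
  Completion.coe_smul (X := F.Pre) c x

lemma continuous_star_env : Continuous (star : F.Env → F.Env) := Completion.continuous_map

lemma denseRange_coe : DenseRange F.coe := Completion.denseRange_coe (α := F.Pre)

instance : StarRing F.Env where
  star_involutive x := by
    refine F.denseRange_coe.induction_on x
      (isClosed_eq (F.continuous_star_env.comp F.continuous_star_env) continuous_id) fun a => ?_
    rw [← coe_star, ← coe_star, star_star]
  star_mul x y := by
    refine F.denseRange_coe.induction_on₂ (isClosed_eq
      (F.continuous_star_env.comp continuous_mul)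
      ((F.continuous_star_env.comp continuous_snd).mul (F.continuous_star_env.comp continuous_fst)))
      (fun a b => ?_) x y
    rw [← coe_mul, ← coe_star, ← coe_star, ← coe_star, ← coe_mul, star_mul]
  star_add x y := by
    refine F.denseRange_coe.induction_on₂ (isClosed_eq
      (F.continuous_star_env.comp continuous_add)
      ((F.continuous_star_env.comp continuous_fst).add (F.continuous_star_env.comp continuous_snd)))
      (fun a b => ?_) x y
    rw [← coe_add, ← coe_star, ← coe_star, ← coe_star, ← coe_add, star_add]

instance : CStarRing F.Env where
  norm_mul_self_le x := by
    refine F.denseRange_coe.induction_on x (isClosed_le (continuous_norm.mul continuous_norm)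
      (continuous_norm.comp (F.continuous_star_env.mul continuous_id))) fun a => ?_
    change ‖F.coe a‖ * ‖F.coe a‖ ≤ ‖star (F.coe a) * F.coe a‖
    rw [← coe_star, ← coe_mul, norm_coe, norm_coe]
    exact F.seminorm_sq_le a

end Seminorm

variable {P : Type} [Ring P] [StarRing P] [Algebra ℂ P] [StarModule ℂ P] (F : RepFamily P)

instance : StarModule ℂ F.Env where
  star_smul c x := by
    refine F.denseRange_coe.induction_on x (isClosed_eq
      (F.continuous_star_env.comp (continuous_const_smul c))
      (F.continuous_star_env.const_smul (star c))) fun a => ?_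
    rw [← coe_smul, ← coe_star, ← coe_star, ← coe_smul, star_smul]

instance : CStarAlgebra F.Env where

/-- The canonical `*`-homomorphism of `P` to its enveloping C⋆-algebra. -/
def toEnv : P →⋆ₐ[ℂ] F.Env where
  toFun := F.coe
  map_one' := rfl
  map_mul' := F.coe_mul
  map_zero' := rfl
  map_add' := F.coe_add
  commutes' c := by
    rw [Algebra.algebraMap_eq_smul_one, coe_smul, Algebra.algebraMap_eq_smul_one]; rfl
  map_star' := F.coe_star

/-- A `*`-homomorphism that is dominated by the seminorm extends to the enveloping C⋆-algebra. -/
def extend {D : Type} [CStarAlgebra D] (f : P →⋆ₐ[ℂ] D) (hf : ∀ x, ‖f x‖ ≤ F.seminorm x) :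
    F.Env →⋆ₐ[ℂ] D :=
  let g : F.Pre →L[ℂ] D := LinearMap.mkContinuous
    ({ toFun := fun x => f x, map_add' := map_add f, map_smul' := map_smul f } : F.Pre →ₗ[ℂ] D) 1
    (fun x => by rw [one_mul]; exact hf x)
  have hg : ∀ x : P, g.fromCompletion (F.coe x) = f x := fun x =>
    g.fromCompletion_apply_coe (x : F.Pre)
  have hc : Continuous fun x : F.Env => g.fromCompletion x := g.fromCompletion.continuous
  { toFun := fun x => g.fromCompletion x
    map_one' := (hg 1).trans (map_one f)
    map_zero' := map_zero g.fromCompletion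
    map_add' := map_add g.fromCompletion
    map_mul' := fun x y => by
      refine F.denseRange_coe.induction_on₂ (isClosed_eq (hc.comp continuous_mul)
        ((hc.comp continuous_fst).mul (hc.comp continuous_snd))) (fun a b => ?_) x y
      rw [← coe_mul, hg, hg, hg, map_mul]
    commutes' := fun c => by
      have h1 : algebraMap ℂ F.Env c = F.coe (algebraMap ℂ P c) := (F.toEnv.commutes c).symm
      rw [h1, hg, AlgHomClass.commutes]
    map_star' := fun x => by
      refine F.denseRange_coe.induction_on x (isClosed_eq (hc.comp F.continuous_star_env)
        hc.star) (fun a => ?_)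
      rw [← coe_star, hg, hg, map_star] }

lemma extend_toEnv {D : Type} [CStarAlgebra D] (f : P →⋆ₐ[ℂ] D)
    (hf : ∀ x, ‖f x‖ ≤ F.seminorm x) (x : P) : F.extend f hf (F.toEnv x) = f x :=
  ContinuousLinearMap.fromCompletion_apply_coe (α := F.Pre) _ x

/-- Two `*`-homomorphisms that agree on `P` are equal. -/
lemma hom_ext {D : Type} [CStarAlgebra D] {f g : F.Env →⋆ₐ[ℂ] D}
    (h : ∀ x : P, f (F.toEnv x) = g (F.toEnv x)) : f = g := by
  ext x
  exact F.denseRange_coe.induction_on x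
    (isClosed_eq (map_continuous f) (map_continuous g)) h

end RepFamily

/-! ### The minimal tensor product -/

section Hilbert

open UniformSpace

variable (H K : Type) [NormedAddCommGroup H] [InnerProductSpace ℂ H] [CompleteSpace H]
  [NormedAddCommGroup K] [InnerProductSpace ℂ K] [CompleteSpace K]

/-- The Hilbert space tensor product. -/
abbrev HTensor : Type := Completion (H ⊗[ℂ] K)

/-- `T ↦ T ⊗ 1` on the Hilbert space tensor product. -/
def ampLeft : (H →L[ℂ] H) →⋆ₐ[ℂ] (HTensor H K →L[ℂ] HTensor H K) where
  toFun T := (T.rTensor K).completion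
  map_one' := by
    ext x
    induction x using Completion.induction_on with
    | hp => apply isClosed_eq <;> fun_prop
    | ih x => simp
  map_mul' S T := by
    ext x
    induction x using Completion.induction_on with
    | hp => apply isClosed_eq <;> fun_prop
    | ih x => simp [ContinuousLinearMap.rTensor_mul]
  map_zero' := by
    ext x
    induction x using Completion.induction_on with
    | hp => apply isClosed_eq <;> fun_prop
    | ih x => simp
  map_add' S T := by
    ext x
    induction x using Completion.induction_on with
    | hp => apply isClosed_eq <;> fun_prop
    | ih x => simp [Completion.coe_add]
  commutes' c := by
    ext x
    induction x using Completion.induction_on with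
    | hp => apply isClosed_eq <;> fun_prop
    | ih x => simp [Algebra.algebraMap_eq_smul_one]
  map_star' T := by
    refine (ContinuousLinearMap.eq_adjoint_iff _ _).mpr fun x y => ?_
    induction x, y using Completion.induction_on₂ with
    | hp => apply isClosed_eq <;> fun_prop
    | ih x y =>
      simp only [ContinuousLinearMap.completion_apply_coe, Completion.inner_coe]
      induction x using TensorProduct.induction_on with
      | zero => simp
      | add a b ha hb => simp only [map_add, inner_add_left, ha, hb]
      | tmul a b =>
        induction y using TensorProduct.induction_on with
        | zero => simp
        | add c d hc hd => simp only [map_add, inner_add_right, hc, hd]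
        | tmul c d => simp [ContinuousLinearMap.star_eq_adjoint,
            ContinuousLinearMap.adjoint_inner_left]

/-- `S ↦ 1 ⊗ S` on the Hilbert space tensor product. -/
def ampRight : (K →L[ℂ] K) →⋆ₐ[ℂ] (HTensor H K →L[ℂ] HTensor H K) where
  toFun T := (T.lTensor H).completion
  map_one' := by
    ext x
    induction x using Completion.induction_on with
    | hp => apply isClosed_eq <;> fun_prop
    | ih x => simp
  map_mul' S T := by
    ext x
    induction x using Completion.induction_on with
    | hp => apply isClosed_eq <;> fun_prop
    | ih x => simp [ContinuousLinearMap.lTensor_mul]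
  map_zero' := by
    ext x
    induction x using Completion.induction_on with
    | hp => apply isClosed_eq <;> fun_prop
    | ih x => simp
  map_add' S T := by
    ext x
    induction x using Completion.induction_on with
    | hp => apply isClosed_eq <;> fun_prop
    | ih x => simp [Completion.coe_add]
  commutes' c := by
    ext x
    induction x using Completion.induction_on with
    | hp => apply isClosed_eq <;> fun_prop
    | ih x => simp [Algebra.algebraMap_eq_smul_one]
  map_star' T := by
    refine (ContinuousLinearMap.eq_adjoint_iff _ _).mpr fun x y => ?_
    induction x, y using Completion.induction_on₂ with
    | hp => apply isClosed_eq <;> fun_prop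
    | ih x y =>
      simp only [ContinuousLinearMap.completion_apply_coe, Completion.inner_coe]
      induction x using TensorProduct.induction_on with
      | zero => simp
      | add a b ha hb => simp only [map_add, inner_add_left, ha, hb]
      | tmul a b =>
        induction y using TensorProduct.induction_on with
        | zero => simp
        | add c d hc hd => simp only [map_add, inner_add_right, hc, hd]
        | tmul c d => simp [ContinuousLinearMap.star_eq_adjoint,
            ContinuousLinearMap.adjoint_inner_left]

lemma commute_amp (T : H →L[ℂ] H) (S : K →L[ℂ] K) :
    Commute (ampLeft H K T) (ampRight H K S) := by
  change _ * _ = _ * _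
  ext x
  induction x using Completion.induction_on with
  | hp => apply isClosed_eq <;> fun_prop
  | ih x =>
    simp only [ampLeft, ampRight, StarAlgHom.coe_mk', AlgHom.coe_mk, RingHom.coe_mk,
      MonoidHom.coe_mk, OneHom.coe_mk, mul_apply_eq_comp,
      ContinuousLinearMap.completion_apply_coe]
    congr 1
    induction x using TensorProduct.induction_on with
    | zero => simp
    | add a b ha hb => simp only [map_add, ha, hb]
    | tmul a b => simp

end Hilbert

section MinTensor

/-- The `*`-homomorphism `a ⊗ b ↦ f a * g b` given by two `*`-homomorphisms with commuting
ranges. -/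
def tensorLift {A B D : Type} [CStarAlgebra A] [CStarAlgebra B] [CStarAlgebra D]
    (f : A →⋆ₐ[ℂ] D) (g : B →⋆ₐ[ℂ] D) (h : ∀ a b, Commute (f a) (g b)) : A ⊗[ℂ] B →⋆ₐ[ℂ] D where
  __ := Algebra.TensorProduct.lift (f : A →ₐ[ℂ] D) (g : B →ₐ[ℂ] D) h
  map_star' x := by
    change Algebra.TensorProduct.lift (f : A →ₐ[ℂ] D) (g : B →ₐ[ℂ] D) h (star x) =
      star (Algebra.TensorProduct.lift (f : A →ₐ[ℂ] D) (g : B →ₐ[ℂ] D) h x)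
    induction x using TensorProduct.induction_on with
    | zero => simp
    | add a b ha hb => simp only [star_add, map_add, ha, hb]
    | tmul a b => simpa [map_star] using ((h a b).star_star).eq

lemma tensorLift_tmul {A B D : Type} [CStarAlgebra A] [CStarAlgebra B] [CStarAlgebra D]
    (f : A →⋆ₐ[ℂ] D) (g : B →⋆ₐ[ℂ] D) (h : ∀ a b, Commute (f a) (g b)) (a : A) (b : B) :
    tensorLift f g h (a ⊗ₜ b) = f a * g b :=
  Algebra.TensorProduct.lift_tmul (f : A →ₐ[ℂ] D) (g : B →ₐ[ℂ] D) h a b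

/-- The representation `π ⊗ σ` of the algebraic tensor product `A ⊗ B` on the Hilbert space tensor
product. -/
def tensorRep {A B H K : Type} [CStarAlgebra A] [CStarAlgebra B]
    [NormedAddCommGroup H] [InnerProductSpace ℂ H] [CompleteSpace H]
    [NormedAddCommGroup K] [InnerProductSpace ℂ K] [CompleteSpace K]
    (π : A →⋆ₐ[ℂ] (H →L[ℂ] H)) (σ : B →⋆ₐ[ℂ] (K →L[ℂ] K)) :
    A ⊗[ℂ] B →⋆ₐ[ℂ] (HTensor H K →L[ℂ] HTensor H K) :=
  tensorLift (D := HTensor H K →L[ℂ] HTensor H K) ((ampLeft H K).comp π) ((ampRight H K).comp σ)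
    fun a b => commute_amp H K (π a) (σ b)

lemma tensorRep_tmul {A B H K : Type} [CStarAlgebra A] [CStarAlgebra B]
    [NormedAddCommGroup H] [InnerProductSpace ℂ H] [CompleteSpace H]
    [NormedAddCommGroup K] [InnerProductSpace ℂ K] [CompleteSpace K]
    (π : A →⋆ₐ[ℂ] (H →L[ℂ] H)) (σ : B →⋆ₐ[ℂ] (K →L[ℂ] K)) (a : A) (b : B) :
    tensorRep π σ (a ⊗ₜ b) = ampLeft H K (π a) * ampRight H K (σ b) :=
  tensorLift_tmul (D := HTensor H K →L[ℂ] HTensor H K) _ _ _ a b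

variable (A B : Type) [CStarAlgebra A] [CStarAlgebra B]

/-- The representations of `A ⊗ B` of the form `π ⊗ σ`, for unital `*`-representations `π`, `σ` of
`A` and `B` on Hilbert spaces. -/
inductive IsSpatial : ∀ (D : Type) [CStarAlgebra D], (A ⊗[ℂ] B →⋆ₐ[ℂ] D) → Prop
  | mk (H K : Type) [NormedAddCommGroup H] [InnerProductSpace ℂ H] [CompleteSpace H]
    [NormedAddCommGroup K] [InnerProductSpace ℂ K] [CompleteSpace K]
    (π : A →⋆ₐ[ℂ] (H →L[ℂ] H)) (σ : B →⋆ₐ[ℂ] (K →L[ℂ] K)) :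
    IsSpatial (HTensor H K →L[ℂ] HTensor H K) (tensorRep π σ)

/-- The family of the representations `π ⊗ σ`. -/
def spatialFamily : RepFamily (A ⊗[ℂ] B) where
  Rep := IsSpatial A B
  bdd x := by
    have key : ∃ C : ℝ, ∀ (D : Type) [CStarAlgebra D] (f : A ⊗[ℂ] B →⋆ₐ[ℂ] D), ‖f x‖ ≤ C := by
      induction x using TensorProduct.induction_on with
      | zero => exact ⟨0, fun D _ f => by simp⟩
      | add a b ha hb =>
        obtain ⟨C, hC⟩ := ha
        obtain ⟨C', hC'⟩ := hb
        refine ⟨C + C', fun D _ f => ?_⟩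
        rw [map_add]
        exact (norm_add_le _ _).trans (add_le_add (hC D f) (hC' D f))
      | tmul a b =>
        refine ⟨‖a‖ * ‖b‖, fun D _ f => ?_⟩
        let g : A →⋆ₐ[ℂ] D :=
          { (f : A ⊗[ℂ] B →ₐ[ℂ] D).comp Algebra.TensorProduct.includeLeft with
            map_star' := fun a => by
              change f (star a ⊗ₜ 1) = star (f (a ⊗ₜ 1))
              rw [← map_star, TensorProduct.star_tmul, star_one] }
        let g' : B →⋆ₐ[ℂ] D :=
          { (f : A ⊗[ℂ] B →ₐ[ℂ] D).comp Algebra.TensorProduct.includeRight with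
            map_star' := fun b => by
              change f (1 ⊗ₜ star b) = star (f (1 ⊗ₜ b))
              rw [← map_star, TensorProduct.star_tmul, star_one] }
        have h : f (a ⊗ₜ b) = g a * g' b := by
          change _ = f (a ⊗ₜ 1) * f (1 ⊗ₜ b)
          rw [← map_mul, Algebra.TensorProduct.tmul_mul_tmul, mul_one, one_mul]
        rw [h]
        exact (norm_mul_le _ _).trans (mul_le_mul (NonUnitalStarAlgHom.norm_apply_le g a)
          (NonUnitalStarAlgHom.norm_apply_le g' b) (norm_nonneg _) (norm_nonneg _))
    obtain ⟨C, hC⟩ := key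
    exact ⟨C, fun D _ f _ => hC D f⟩

/-- The minimal (spatial) C⋆-tensor product of two unital C⋆-algebras. -/
abbrev MinTensor : Type := (spatialFamily A B).Env

variable {A B}

/-- Elementary tensors. -/
def mtmul (a : A) (b : B) : MinTensor A B := (spatialFamily A B).toEnv (a ⊗ₜ b)

lemma mtmul_mul (a a' : A) (b b' : B) :
    mtmul a b * mtmul a' b' = mtmul (a * a') (b * b') := by
  rw [mtmul, mtmul, ← map_mul, Algebra.TensorProduct.tmul_mul_tmul, mtmul]

lemma mtmul_star (a : A) (b : B) : star (mtmul a b) = mtmul (star a) (star b) := by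
  rw [mtmul, mtmul, ← map_star, TensorProduct.star_tmul]

/-- `a ↦ a ⊗ 1`. -/
def inclLeft : A →⋆ₐ[ℂ] MinTensor A B where
  toFun a := mtmul a 1
  map_one' := map_one (spatialFamily A B).toEnv
  map_mul' a b := by rw [mtmul_mul, mul_one]
  map_zero' := by rw [mtmul, TensorProduct.zero_tmul, map_zero]
  map_add' a b := by rw [mtmul, TensorProduct.add_tmul, map_add]; rfl
  commutes' c := AlgHomClass.commutes (spatialFamily A B).toEnv c
  map_star' a := by rw [mtmul_star, star_one]

/-- `b ↦ 1 ⊗ b`. -/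
def inclRight : B →⋆ₐ[ℂ] MinTensor A B where
  toFun b := mtmul 1 b
  map_one' := map_one (spatialFamily A B).toEnv
  map_mul' a b := by rw [mtmul_mul, mul_one]
  map_zero' := by rw [mtmul, TensorProduct.tmul_zero, map_zero]
  map_add' a b := by rw [mtmul, TensorProduct.tmul_add, map_add]; rfl
  commutes' c := by
    rw [mtmul, Algebra.algebraMap_eq_smul_one, TensorProduct.tmul_smul, map_smul,
      Algebra.algebraMap_eq_smul_one]
    exact congrArg (c • ·) (map_one (spatialFamily A B).toEnv)
  map_star' a := by rw [mtmul_star, star_one]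

lemma inclLeft_mul_inclRight (a : A) (b : B) :
    (inclLeft a * inclRight b : MinTensor A B) = mtmul a b :=
  (mtmul_mul a 1 1 b).trans (by rw [mul_one, one_mul])

lemma inclRight_mul_inclLeft (a : A) (b : B) :
    (inclRight b * inclLeft a : MinTensor A B) = mtmul a b :=
  (mtmul_mul 1 a b 1).trans (by rw [mul_one, one_mul])

/-- Functoriality of the minimal tensor product. -/
def MinTensor.map {A₂ B₂ : Type} [CStarAlgebra A₂] [CStarAlgebra B₂]
    (f : A →⋆ₐ[ℂ] A₂) (g : B →⋆ₐ[ℂ] B₂) : MinTensor A B →⋆ₐ[ℂ] MinTensor A₂ B₂ :=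
  (spatialFamily A B).extend
    (tensorLift (inclLeft.comp f) (inclRight.comp g) fun a b =>
      (inclLeft_mul_inclRight (f a) (g b)).trans (inclRight_mul_inclLeft (f a) (g b)).symm)
    fun x => by
      set φ := tensorLift ((inclLeft (A := A₂) (B := B₂)).comp f) (inclRight.comp g) fun a b =>
        (inclLeft_mul_inclRight (f a) (g b)).trans (inclRight_mul_inclLeft (f a) (g b)).symm
      have h1 : ∀ x : A ⊗[ℂ] B, φ x =
          (spatialFamily A₂ B₂).toEnv (TensorProduct.map (f : A →ₗ[ℂ] A₂) (g : B →ₗ[ℂ] B₂) x) := by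
        intro x
        induction x using TensorProduct.induction_on with
        | zero => simp
        | add a b ha hb => simp only [map_add, ha, hb]
        | tmul a b => exact (tensorLift_tmul _ _ _ a b).trans (inclLeft_mul_inclRight (f a) (g b))
      rw [h1]
      refine ((spatialFamily A₂ B₂).norm_coe _).le.trans
        (RepFamily.seminorm_le _ (RepFamily.seminorm_nonneg _ _) ?_)
      rintro _ _ _ ⟨H, K, π, σ⟩
      refine le_of_eq_of_le (congrArg norm ?_)
        ((spatialFamily A B).le_seminorm (IsSpatial.mk H K (π.comp f) (σ.comp g)) x)
      induction x using TensorProduct.induction_on with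
      | zero => simp
      | add a b ha hb => simp only [map_add, ha, hb]
      | tmul a b =>
        exact (tensorRep_tmul π σ (f a) (g b)).trans (tensorRep_tmul (π.comp f) (σ.comp g) a b).symm

lemma MinTensor.map_mtmul {A₂ B₂ : Type} [CStarAlgebra A₂] [CStarAlgebra B₂]
    (f : A →⋆ₐ[ℂ] A₂) (g : B →⋆ₐ[ℂ] B₂) (a : A) (b : B) :
    MinTensor.map f g (mtmul a b) = mtmul (f a) (g b) :=
  (RepFamily.extend_toEnv _ _ _ _).trans
    ((tensorLift_tmul _ _ _ a b).trans (inclLeft_mul_inclRight (f a) (g b)))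

end MinTensor

/-! ### Universal C⋆-algebras given by generators and relations -/

/-- The free complex `*`-algebra on `X`: noncommutative polynomials in the letters `(x, false)`,
which stands for `x`, and `(x, true)`, which stands for `x*`. -/
def FreeStar (X : Type) : Type := FreeAlgebra ℂ (X × Bool)

namespace FreeStar

variable {X : Type}

instance : Ring (FreeStar X) := inferInstanceAs (Ring (FreeAlgebra ℂ (X × Bool)))
instance : Algebra ℂ (FreeStar X) := inferInstanceAs (Algebra ℂ (FreeAlgebra ℂ (X × Bool)))

/-- The letters. -/
def letter (p : X × Bool) : FreeStar X := FreeAlgebra.ι ℂ p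

lemma induction {motive : FreeStar X → Prop} (scalar : ∀ c : ℂ, motive (algebraMap ℂ _ c))
    (letter : ∀ p, motive (letter p)) (mul : ∀ a b, motive a → motive b → motive (a * b))
    (add : ∀ a b, motive a → motive b → motive (a + b)) (a : FreeStar X) : motive a :=
  FreeAlgebra.induction ℂ (X × Bool) scalar letter mul add a

/-- The opposite algebra with the conjugate scalar multiplication. -/
abbrev conjAlgebra (X : Type) : Algebra ℂ (FreeStar X)ᵐᵒᵖ :=
  RingHom.toAlgebra' ((algebraMap ℂ (FreeStar X)ᵐᵒᵖ).comp (starRingEnd ℂ))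
    fun c x => Algebra.commutes (R := ℂ) (conj c) x

/-- The conjugate-linear antihomomorphism that exchanges `x` and `x*`. -/
def starHom : FreeStar X →+* (FreeStar X)ᵐᵒᵖ :=
  letI := conjAlgebra X
  ((FreeAlgebra.lift ℂ fun p : X × Bool => MulOpposite.op (letter (p.1, !p.2))) :
    FreeAlgebra ℂ (X × Bool) →ₐ[ℂ] (FreeStar X)ᵐᵒᵖ).toRingHom

lemma starHom_letter (p : X × Bool) :
    starHom (letter p) = MulOpposite.op (letter (p.1, !p.2)) :=
  letI := conjAlgebra X
  FreeAlgebra.lift_ι_apply (R := ℂ) (fun p : X × Bool => MulOpposite.op (letter (p.1, !p.2))) p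

lemma starHom_algebraMap (c : ℂ) :
    starHom (algebraMap ℂ (FreeStar X) c) = MulOpposite.op (algebraMap ℂ (FreeStar X) (conj c)) :=
  letI := conjAlgebra X
  ((FreeAlgebra.lift ℂ fun p : X × Bool => MulOpposite.op (letter (p.1, !p.2))) :
    FreeAlgebra ℂ (X × Bool) →ₐ[ℂ] (FreeStar X)ᵐᵒᵖ).commutes c

instance : Star (FreeStar X) := ⟨fun x => (starHom x).unop⟩

lemma star_def (x : FreeStar X) : star x = (starHom x).unop := rfl

@[simp] lemma star_letter (p : X × Bool) : star (letter p) = letter (p.1, !p.2) := by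
  rw [star_def, starHom_letter, MulOpposite.unop_op]

@[simp] lemma star_algebraMap (c : ℂ) :
    star (algebraMap ℂ (FreeStar X) c) = algebraMap ℂ (FreeStar X) (conj c) := by
  rw [star_def, starHom_algebraMap, MulOpposite.unop_op]

lemma star_mul' (x y : FreeStar X) : star (x * y) = star y * star x := by
  simp [star_def]

lemma star_add' (x y : FreeStar X) : star (x + y) = star x + star y := by
  simp [star_def]

instance : StarRing (FreeStar X) where
  star_involutive x := by
    induction x using induction with
    | scalar c => simp
    | letter p => simp
    | mul a b ha hb => rw [star_mul', star_mul', ha, hb]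
    | add a b ha hb => rw [star_add', star_add', ha, hb]
  star_mul := star_mul'
  star_add := star_add'

instance : StarModule ℂ (FreeStar X) where
  star_smul c x := by
    rw [Algebra.smul_def, star_mul, star_algebraMap, ← Algebra.commutes, Algebra.smul_def]; rfl

/-- The generators. -/
def gen (x : X) : FreeStar X := letter (x, false)

/-- Evaluation of noncommutative `*`-polynomials at elements of a C⋆-algebra. -/
def eval {D : Type} [CStarAlgebra D] (s : X → D) : FreeStar X →⋆ₐ[ℂ] D :=
  let f : FreeStar X →ₐ[ℂ] D :=
    FreeAlgebra.lift ℂ fun p : X × Bool => if p.2 then star (s p.1) else s p.1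
  have hf : ∀ p, f (letter p) = if p.2 then star (s p.1) else s p.1 := fun p =>
    FreeAlgebra.lift_ι_apply (R := ℂ) _ p
  { f with
    map_star' := fun x => by
      change f (star x) = star (f x)
      induction x using induction with
      | scalar c =>
        rw [star_algebraMap, AlgHom.commutes, AlgHom.commutes]; exact algebraMap_star_comm c
      | letter p =>
        rw [star_letter, hf, hf]
        rcases p with ⟨x, _ | _⟩ <;> simp
      | mul a b ha hb => rw [star_mul, map_mul, map_mul, star_mul, ha, hb]
      | add a b ha hb => rw [star_add, map_add, map_add, star_add, ha, hb] }

lemma eval_gen {D : Type} [CStarAlgebra D] (s : X → D) (x : X) : eval s (gen x) = s x :=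
  (FreeAlgebra.lift_ι_apply (R := ℂ) _ (x, false)).trans (if_neg Bool.false_ne_true)

lemma hom_ext {D : Type} [CStarAlgebra D] {f g : FreeStar X →⋆ₐ[ℂ] D}
    (h : ∀ x, f (gen x) = g (gen x)) (a : FreeStar X) : f a = g a := by
  induction a using induction with
  | scalar c => rw [AlgHomClass.commutes, AlgHomClass.commutes]
  | letter p =>
    rcases p with ⟨x, _ | _⟩
    · exact h x
    · have : letter (x, true) = star (gen x) := by simp [gen]
      rw [this, map_star, map_star, h]
  | mul a b ha hb => rw [map_mul, map_mul, ha, hb]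
  | add a b ha hb => rw [map_add, map_add, ha, hb]

end FreeStar

/-- Relations on the generators `X` that force them to be contractions. -/
structure Presentation (X : Type) where
  /-- the relations -/
  Rel : ∀ (D : Type) [CStarAlgebra D], (X → D) → Prop
  norm_le : ∀ (D : Type) [CStarAlgebra D] (s : X → D), Rel D s → ∀ x, ‖s x‖ ≤ 1

namespace Presentation

variable {X : Type} (R : Presentation X)

/-- The `*`-homomorphisms that send the generators to elements satisfying the relations. -/
def family : RepFamily (FreeStar X) where
  Rep := fun D _ f => R.Rel D fun x => f (FreeStar.gen x)
  bdd x := by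
    induction x using FreeStar.induction with
    | scalar c =>
      refine ⟨‖c‖, fun D _ f _ => ?_⟩
      rw [AlgHomClass.commutes, Algebra.algebraMap_eq_smul_one, norm_smul]
      refine mul_le_of_le_one_right (norm_nonneg _) ?_
      rcases subsingleton_or_nontrivial D with h | h
      · rw [Subsingleton.elim (1 : D) 0, norm_zero]; exact zero_le_one
      · exact CStarRing.norm_one.le
    | letter p =>
      refine ⟨1, fun D _ f hf => ?_⟩
      rcases p with ⟨x, _ | _⟩
      · exact R.norm_le D _ hf x
      · have : FreeStar.letter (x, true) = star (FreeStar.gen x) := by simp [FreeStar.gen]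
        rw [this, map_star, norm_star]
        exact R.norm_le D _ hf x
    | mul a b ha hb =>
      obtain ⟨C, hC⟩ := ha
      obtain ⟨C', hC'⟩ := hb
      refine ⟨C * C', fun D _ f hf => ?_⟩
      rw [map_mul]
      exact (norm_mul_le _ _).trans (mul_le_mul (hC D f hf) (hC' D f hf) (norm_nonneg _)
        ((norm_nonneg _).trans (hC D f hf)))
    | add a b ha hb =>
      obtain ⟨C, hC⟩ := ha
      obtain ⟨C', hC'⟩ := hb
      refine ⟨C + C', fun D _ f hf => ?_⟩
      rw [map_add]
      exact (norm_add_le _ _).trans (add_le_add (hC D f hf) (hC' D f hf))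

/-- The universal unital C⋆-algebra generated by `X` subject to the relations `R`. -/
abbrev Univ : Type := R.family.Env

/-- The generators of the universal C⋆-algebra. -/
def gen (x : X) : R.Univ := R.family.toEnv (FreeStar.gen x)

/-- The universal property. -/
def lift {D : Type} [CStarAlgebra D] (s : X → D) (hs : R.Rel D s) : R.Univ →⋆ₐ[ℂ] D :=
  R.family.extend (FreeStar.eval s) fun x => R.family.le_seminorm (by
    change R.Rel D fun x => FreeStar.eval s (FreeStar.gen x)
    simpa only [FreeStar.eval_gen] using hs) x

@[simp] lemma lift_gen {D : Type} [CStarAlgebra D] (s : X → D) (hs : R.Rel D s) (x : X) :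
    R.lift s hs (R.gen x) = s x :=
  (R.family.extend_toEnv _ _ _).trans (FreeStar.eval_gen s x)

lemma hom_ext {D : Type} [CStarAlgebra D] {f g : R.Univ →⋆ₐ[ℂ] D}
    (h : ∀ x, f (R.gen x) = g (R.gen x)) : f = g :=
  R.family.hom_ext fun x => FreeStar.hom_ext (f := f.comp R.family.toEnv)
    (g := g.comp R.family.toEnv) h x

/-- A polynomial relation that is implied by `R` holds in the universal C⋆-algebra. -/
lemma toEnv_eq {x y : FreeStar X}
    (h : ∀ (D : Type) [CStarAlgebra D] (f : FreeStar X →⋆ₐ[ℂ] D),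
      R.Rel D (fun x => f (FreeStar.gen x)) → f x = f y) :
    R.family.toEnv x = R.family.toEnv y := by
  rw [← sub_eq_zero, ← map_sub, ← norm_le_zero_iff]
  refine (R.family.norm_coe _).le.trans (R.family.seminorm_le le_rfl fun D _ f hf => ?_)
  rw [map_sub, h D f hf, sub_self, norm_zero]

end Presentation

/-- The relations of the quantum two-torus: `u = s 0` and `v = s 1` are unitary and `uv = μ vu`. -/
def torusRel (μ : Circle) : Presentation (Fin 2) where
  Rel := fun D _ s => s 0 ∈ unitary D ∧ s 1 ∈ unitary D ∧ s 0 * s 1 = (μ : ℂ) • (s 1 * s 0)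
  norm_le D _ s hs x := by
    have h : s x ∈ unitary D := by
      fin_cases x
      · exact hs.1
      · exact hs.2.1
    nontriviality D
    exact (CStarRing.norm_of_mem_unitary h).le

/-- The C⋆-algebra of the quantum two-torus. -/
abbrev QTorus (μ : Circle) : Type := (torusRel μ).Univ

namespace QTorus

variable (μ : Circle)

/-- The unitary `u`. -/
def u : unitary (QTorus μ) := ⟨(torusRel μ).gen 0, by
  rw [Unitary.mem_iff, Presentation.gen, ← map_star, ← map_mul, ← map_mul,
    ← map_one (torusRel μ).family.toEnv]
  constructor <;> refine (torusRel μ).toEnv_eq fun D _ f hf => ?_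
  · rw [map_mul, map_star, map_one]; exact Unitary.star_mul_self_of_mem hf.1
  · rw [map_mul, map_star, map_one]; exact Unitary.mul_star_self_of_mem hf.1⟩

/-- The unitary `v`. -/
def v : unitary (QTorus μ) := ⟨(torusRel μ).gen 1, by
  rw [Unitary.mem_iff, Presentation.gen, ← map_star, ← map_mul, ← map_mul,
    ← map_one (torusRel μ).family.toEnv]
  constructor <;> refine (torusRel μ).toEnv_eq fun D _ f hf => ?_
  · rw [map_mul, map_star, map_one]; exact Unitary.star_mul_self_of_mem hf.2.1
  · rw [map_mul, map_star, map_one]; exact Unitary.mul_star_self_of_mem hf.2.1⟩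

lemma u_mul_v : (u μ * v μ : QTorus μ) = (μ : ℂ) • (v μ * u μ : QTorus μ) := by
  change (torusRel μ).family.toEnv _ * (torusRel μ).family.toEnv _ =
    (μ : ℂ) • ((torusRel μ).family.toEnv _ * (torusRel μ).family.toEnv _)
  rw [← map_mul, ← map_mul, ← map_smul]
  refine (torusRel μ).toEnv_eq fun D _ f hf => ?_
  rw [map_mul, map_smul, map_mul]
  exact hf.2.2

end QTorus

/-! ### Actions of the circle group -/

/-- An action of the circle group on a unital C⋆-algebra by `*`-automorphisms, continuous in the
point-norm topology. -/
class CircleAction (A : Type) [CStarAlgebra A] where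
  /-- the automorphism by which `z` acts -/
  act : Circle → A →⋆ₐ[ℂ] A
  act_one : ∀ a, act 1 a = a
  act_mul : ∀ z w a, act (z * w) a = act z (act w a)
  continuous_act : ∀ a, Continuous fun z => act z a

open CircleAction

/-- `a` is homogeneous of degree `n`: `ρ_z(a) = zⁿ a` for all `z` in the circle. -/
def IsHomogeneous {A : Type} [CStarAlgebra A] [CircleAction A] (n : ℤ) (a : A) : Prop :=
  ∀ z : Circle, act z a = ((z ^ n : Circle) : ℂ) • a

section Homogeneous

variable {A : Type} [CStarAlgebra A] [CircleAction A]

lemma IsHomogeneous.one : IsHomogeneous 0 (1 : A) := fun z => by simp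

lemma IsHomogeneous.mul {m n : ℤ} {a b : A} (ha : IsHomogeneous m a) (hb : IsHomogeneous n b) :
    IsHomogeneous (m + n) (a * b) := fun z => by
  rw [map_mul, ha z, hb z, smul_mul_smul_comm, zpow_add, Circle.coe_mul]

lemma IsHomogeneous.star {n : ℤ} {a : A} (ha : IsHomogeneous n a) :
    IsHomogeneous (-n) (star a) := fun z => by
  rw [map_star, ha z, star_smul, zpow_neg, Circle.coe_inv_eq_conj]; rfl

end Homogeneous

/-! Fourier analysis of continuous functions on the circle with values in a Banach space -/

section Fourier

open MeasureTheory AddCircle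

variable {E : Type} [NormedAddCommGroup E] [NormedSpace ℂ E]

lemma integrable_fourier_smul (f : C(UnitAddCircle, E)) (n : ℤ) :
    Integrable (fun t => fourier n t • f t) (haarAddCircle (T := 1)) :=
  ((fourier n).continuous.smul f.continuous).integrable_of_hasCompactSupport
    (HasCompactSupport.of_compactSpace _)

/-- The `n`-th Fourier coefficient, as a bounded linear map. -/
def coefL (E : Type) [NormedAddCommGroup E] [NormedSpace ℂ E] (n : ℤ) :
    C(UnitAddCircle, E) →L[ℂ] E :=
  LinearMap.mkContinuous
    { toFun := fun f => fourierCoeff f n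
      map_add' := fun f g => by
        rw [fourierCoeff, fourierCoeff, fourierCoeff,
          ← integral_add (integrable_fourier_smul f _) (integrable_fourier_smul g _)]
        simp only [ContinuousMap.add_apply, smul_add]
      map_smul' := fun c f => fourierCoeff.const_smul f c n } 1
    fun f => by
      rw [one_mul]
      refine (norm_integral_le_of_norm_le_const (μ := haarAddCircle (T := 1)) (C := ‖f‖)
        (Filter.Eventually.of_forall fun t => ?_)).trans (by simp)
      rw [norm_smul, fourier_apply, Circle.norm_coe, one_mul]
      exact f.norm_coe_le_norm t

lemma coefL_apply (f : C(UnitAddCircle, E)) (n : ℤ) : coefL E n f = fourierCoeff f n := rfl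

variable [CompleteSpace E]

lemma coefL_fourier_smul (f : C(UnitAddCircle, E)) (k n : ℤ) (x : E)
    (hf : ∀ t, f t = fourier k t • x) : coefL E n f = (if n = k then (1 : ℂ) else 0) • x := by
  have h1 : coefL E n f = fourierCoeff (T := 1) (fourier k) n • x := by
    rw [coefL_apply, fourierCoeff, fourierCoeff, ← integral_smul_const]
    simp only [hf, smul_smul, smul_eq_mul]
  rw [h1, fourierCoeff_fourier, Pi.single_apply]

lemma coefL_map {E' : Type} [NormedAddCommGroup E'] [NormedSpace ℂ E'] [CompleteSpace E']
    (φ : E →L[ℂ] E') (f : C(UnitAddCircle, E)) (g : C(UnitAddCircle, E'))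
    (hg : ∀ t, g t = φ (f t)) (n : ℤ) : coefL E' n g = φ (coefL E n f) := by
  have := φ.integral_comp_comm (integrable_fourier_smul f (-n))
  rw [coefL_apply, coefL_apply, fourierCoeff, fourierCoeff, ← this]
  simp only [hg, map_smul]

/-- A continuous function whose Fourier coefficients all vanish is zero. -/
lemma eq_zero_of_coefL (f : C(UnitAddCircle, E)) (h : ∀ n, coefL E n f = 0) : f = 0 := by
  ext t
  refine SeparatingDual.eq_zero_of_forall_dual_eq_zero (R := ℂ) fun φ => ?_
  set g : C(UnitAddCircle, ℂ) := ⟨fun t => φ (f t), φ.continuous.comp f.continuous⟩ with hg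
  have h0 : fourierCoeff g = fun _ => 0 := by
    funext n
    exact (coefL_map φ f g (fun _ => rfl) n).trans (by rw [h n, map_zero])
  have := has_pointwise_sum_fourier_series_of_summable (f := g) (by rw [h0]; exact summable_zero) t
  rw [h0] at this
  simp only [zero_smul] at this
  exact this.unique hasSum_zero

end Fourier

section Orbit

open MeasureTheory AddCircle

variable {A : Type} [CStarAlgebra A] [CircleAction A]

/-- The orbit map `a ↦ (z ↦ ρ_z(a))`. -/
def orbitL (A : Type) [CStarAlgebra A] [CircleAction A] : A →L[ℂ] C(UnitAddCircle, A) :=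
  LinearMap.mkContinuous
    { toFun := fun a => ⟨fun t => act (toCircle t) a,
        (continuous_act a).comp (continuous_toCircle)⟩
      map_add' := fun a b => by ext; simp
      map_smul' := fun c a => by ext; simp } 1
    fun a => by
      rw [one_mul]
      refine (ContinuousMap.norm_le _ (norm_nonneg _)).2 fun t => ?_
      exact NonUnitalStarAlgHom.norm_apply_le (act (toCircle t)) a

lemma orbitL_apply (a : A) (t : UnitAddCircle) : orbitL A a t = act (toCircle t) a := rfl

lemma isHomogeneous_coefL (a : A) (n : ℤ) : IsHomogeneous n (coefL A n (orbitL A a)) := by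
  intro z
  obtain ⟨s, rfl⟩ : ∃ s : UnitAddCircle, toCircle s = z := by
    obtain ⟨s, hs⟩ := (homeomorphCircle (one_ne_zero (α := ℝ))).surjective z
    exact ⟨s, by rw [← hs, homeomorphCircle_apply]⟩
  let φ : A →L[ℂ] A := ⟨(act (toCircle s) : A →⋆ₐ[ℂ] A), map_continuous _⟩
  have h1 : act (toCircle s) (coefL A n (orbitL A a)) =
      ∫ t, fourier (-n) t • orbitL A a (s + t) ∂haarAddCircle (T := 1) := by
    refine (coefL_map φ (orbitL A a) ⟨fun t => orbitL A a (s + t), by fun_prop⟩ (fun t => ?_)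
      n).symm
    change orbitL A a (s + t) = act (toCircle s) (orbitL A a t)
    rw [orbitL_apply, orbitL_apply, toCircle_add, act_mul]
  have h2 := integral_add_left_eq_self (μ := haarAddCircle (T := 1))
    (fun t => fourier (-n) (t - s) • orbitL A a t) s
  simp only [add_sub_cancel_left] at h2
  rw [h1, h2, coefL_apply, fourierCoeff, ← integral_smul]
  refine integral_congr_ae (Filter.Eventually.of_forall fun t => ?_)
  change fourier (-n) (t - s) • orbitL A a t = _ • fourier (-n) t • orbitL A a t
  rw [smul_smul, ← toCircle_zsmul, fourier_apply, fourier_apply, ← Circle.coe_mul,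
    ← toCircle_add]
  congr 3
  rw [smul_sub, sub_eq_add_neg, ← neg_smul, neg_neg, add_comm]

/-- The homogeneous elements span a dense subspace. -/
lemma dense_span_homogeneous :
    (Submodule.span ℂ {a : A | ∃ n, IsHomogeneous n a}).topologicalClosure = ⊤ := by
  set N := (Submodule.span ℂ {a : A | ∃ n, IsHomogeneous n a}).topologicalClosure with hN
  have : IsClosed (N : Set A) := Submodule.isClosed_topologicalClosure _
  refine eq_top_iff.2 fun a _ => ?_
  let m : A →L[ℂ] A ⧸ N := N.mkQL
  let f : C(UnitAddCircle, A ⧸ N) := 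
    ⟨fun t => m (orbitL A a t), m.continuous.comp (orbitL A a).continuous⟩
  have hf : f = 0 := by
    refine eq_zero_of_coefL f fun n => ?_
    have h1 : coefL (A ⧸ N) n f = m (coefL A n (orbitL A a)) :=
      coefL_map m (orbitL A a) f (fun _ => rfl) n
    rw [h1]
    exact (Submodule.Quotient.mk_eq_zero N).2
      (Submodule.le_topologicalClosure _ (Submodule.subset_span ⟨n, isHomogeneous_coefL a n⟩))
  have h2 : m a = 0 := by
    have := DFunLike.congr_fun hf 0
    simpa [f, orbitL_apply, act_one] using this
  exact (Submodule.Quotient.mk_eq_zero N).1 h2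

lemma dense_homogeneous :
    Dense (Submodule.span ℂ {a : A | ∃ n, IsHomogeneous n a} : Set A) :=
  Submodule.dense_iff_topologicalClosure_eq_top.2 dense_span_homogeneous

end Orbit

/-- The linear span of a set that contains `1` and is closed under products and adjoints. -/
def spanStar {D : Type} [CStarAlgebra D] (G : Set D) (h1 : 1 ∈ G)
    (hmul : ∀ x ∈ G, ∀ y ∈ G, x * y ∈ Submodule.span ℂ G)
    (hstar : ∀ x ∈ G, star x ∈ Submodule.span ℂ G) : StarSubalgebra ℂ D where
  carrier := Submodule.span ℂ G
  mul_mem' {x y} hx hy := by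
    have h : Submodule.span ℂ G * Submodule.span ℂ G ≤ Submodule.span ℂ G := by
      rw [Submodule.span_mul_span, Submodule.span_le]
      rintro _ ⟨x, hx, y, hy, rfl⟩
      exact hmul x hx y hy
    exact h (Submodule.mul_mem_mul hx hy)
  one_mem' := Submodule.subset_span h1
  add_mem' := Submodule.add_mem _
  zero_mem' := Submodule.zero_mem _
  algebraMap_mem' c := by
    rw [Algebra.algebraMap_eq_smul_one]
    exact Submodule.smul_mem _ _ (Submodule.subset_span h1)
  star_mem' {x} hx := by
    change star x ∈ Submodule.span ℂ G
    induction hx using Submodule.span_induction with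
    | mem x hx => exact hstar x hx
    | zero => rw [star_zero]; exact Submodule.zero_mem _
    | add x y _ _ hx hy => rw [star_add]; exact Submodule.add_mem _ hx hy
    | smul c x _ hx => rw [star_smul]; exact Submodule.smul_mem _ _ hx

section Twist

open AddCircle

variable {A D : Type} [CStarAlgebra A] [CircleAction A] [CStarAlgebra D]

/-- If a unitary `w` commutes with the range of `θ : A → D`, then `a ↦ wⁿ θ(a)` for `a` homogeneous
of degree `n` extends to a `*`-homomorphism `A → D`. -/
theorem exists_twist (θ : A →⋆ₐ[ℂ] D) (w : unitary D) (hw : ∀ a, Commute (w : D) (θ a)) :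
    ∃ j : A →⋆ₐ[ℂ] D, ∀ (n : ℤ) (a : A), IsHomogeneous n a → j a = ((w ^ n : unitary D) : D) * θ a := by
  have hw' : ∀ (n : ℤ) (a : A), Commute ((w ^ n : unitary D) : D) (θ a) := by
    have hs : ∀ a, Commute (star (w : D)) (θ a) := fun a => by
      have := (hw (star a)).star_star
      rwa [map_star, star_star] at this
    intro n a
    obtain ⟨k, rfl | rfl⟩ := n.eq_nat_or_neg
    · rw [zpow_natCast, SubmonoidClass.coe_pow]
      exact (hw a).pow_left k
    · rw [zpow_neg, zpow_natCast, ← inv_pow, SubmonoidClass.coe_pow, ← Unitary.star_eq_inv,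
        Unitary.coe_star]
      exact (hs a).pow_left k
  let F : ℤ → A → C(UnitAddCircle, D) := fun n a =>
    ⟨fun t => fourier n t • (((w ^ n : unitary D) : D) * θ a), by fun_prop⟩
  let G : Set (A × C(UnitAddCircle, D)) := 
    {x | ∃ n a, IsHomogeneous n a ∧ x = (a, F n a)}
  let S := spanStar G ⟨0, 1, IsHomogeneous.one, by
      refine Prod.ext rfl ?_
      ext t; simp [F]⟩
    (by
      rintro _ ⟨m, a, ha, rfl⟩ _ ⟨n, b, hb, rfl⟩
      refine Submodule.subset_span ⟨m + n, _, ha.mul hb, Prod.ext rfl ?_⟩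
      ext t
      simp only [F, ContinuousMap.mul_apply, ContinuousMap.coe_mk, Prod.mk_mul_mk]
      rw [smul_mul_smul_comm, ← fourier_add, zpow_add, Submonoid.coe_mul, map_mul,
        mul_assoc, mul_assoc, ← mul_assoc (θ a), ← (hw' n a).eq, mul_assoc])
    (by
      rintro _ ⟨m, a, ha, rfl⟩
      refine Submodule.subset_span ⟨-m, _, ha.star, Prod.ext rfl ?_⟩
      ext t
      simp only [F, ContinuousMap.star_apply, ContinuousMap.coe_mk, Prod.star_def]
      rw [star_smul, star_mul, fourier_neg, map_star, zpow_neg, ← Unitary.star_eq_inv,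
        Unitary.coe_star, ((hw' m a).star_star).eq]
      rfl)
  let T := S.topologicalClosure
  have hT : IsClosed (T : Set (A × C(UnitAddCircle, D))) := S.isClosed_topologicalClosure
  let θL : A →L[ℂ] D := ⟨(θ : A →ₗ[ℂ] D), map_continuous θ⟩
  let p : T →⋆ₐ[ℂ] A := (StarAlgHom.fst ℂ A C(UnitAddCircle, D)).comp T.subtype
  have hcoef : ∀ x ∈ T, ∀ n : ℤ, coefL D n x.2 =
      ((w ^ n : unitary D) : D) * θ (coefL A n (orbitL A x.1)) := by
    intro x hx n
    let L : A × C(UnitAddCircle, D) →L[ℂ] D :=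
      (coefL D n).comp (ContinuousLinearMap.snd ℂ _ _) -
        (ContinuousLinearMap.mul ℂ D ((w ^ n : unitary D) : D)).comp
          (θL.comp ((coefL A n).comp ((orbitL A).comp (ContinuousLinearMap.fst ℂ _ _))))
    have hle : Submodule.span ℂ G ≤ LinearMap.ker (L : A × C(UnitAddCircle, D) →ₗ[ℂ] D) := by
      rw [Submodule.span_le]
      rintro _ ⟨k, a, ha, rfl⟩
      change coefL D n (F k a) - ((w ^ n : unitary D) : D) * θ (coefL A n (orbitL A a)) = 0
      rw [coefL_fourier_smul (F k a) k n (((w ^ k : unitary D) : D) * θ a) (fun _ => rfl),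
        coefL_fourier_smul (orbitL A a) k n a (fun t => by
          rw [orbitL_apply, ha, fourier_apply, toCircle_zsmul])]
      split_ifs with h
      · rw [h, one_smul, one_smul, sub_self]
      · simp
    have h0 : L x = 0 := by
      have : closure (S : Set (A × C(UnitAddCircle, D))) ⊆ {y | L y = 0} :=
        closure_minimal (fun y hy => hle hy) (isClosed_eq L.continuous continuous_const)
      exact this hx
    exact sub_eq_zero.1 h0
  have hinj : Function.Injective p := by
    rw [injective_iff_map_eq_zero]
    rintro ⟨⟨a, f⟩, hx⟩ (rfl : a = 0)
    have : f = 0 := eq_zero_of_coefL f fun n => by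
      rw [hcoef _ hx n]; simp
    subst this
    rfl
  have hsurj : Function.Surjective p := by
    have hr : IsClosed (Set.range p) :=
      (NonUnitalStarAlgHom.isometry p hinj).isClosedEmbedding.isClosed_range
    have hle : Submodule.span ℂ {a : A | ∃ n, IsHomogeneous n a} ≤ LinearMap.range (p : T →ₗ[ℂ] A) := by
      rw [Submodule.span_le]
      rintro a ⟨n, ha⟩
      exact ⟨⟨(a, F n a), S.le_topologicalClosure (Submodule.subset_span ⟨n, a, ha, rfl⟩)⟩, rfl⟩
    have hd : Dense (Set.range p) :=
      (dense_homogeneous (A := A)).mono hle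
    rw [← Set.range_eq_univ, ← hd.closure_eq, hr.closure_eq]
  let e : T ≃⋆ₐ[ℂ] A := StarAlgEquiv.ofBijective p ⟨hinj, hsurj⟩
  let ev : C(UnitAddCircle, D) →⋆ₐ[ℂ] D :=
    { toFun := fun f => f 0, map_one' := rfl, map_mul' := fun _ _ => rfl, map_zero' := rfl
      map_add' := fun _ _ => rfl, commutes' := fun _ => rfl, map_star' := fun _ => rfl }
  refine ⟨(ev.comp (StarAlgHom.snd ℂ A C(UnitAddCircle, D))).comp
    (T.subtype.comp (e.symm : A →⋆ₐ[ℂ] T)), fun n a ha => ?_⟩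
  have hmem : (a, F n a) ∈ T := S.le_topologicalClosure 
    (Submodule.subset_span ⟨n, a, ha, rfl⟩)
  have : e.symm a = ⟨(a, F n a), hmem⟩ := by
    rw [StarAlgEquiv.symm_apply_eq]; rfl
  change ((e.symm a : A × C(UnitAddCircle, D)).2) 0 = _
  rw [this]
  simp [F]

/-- A `*`-homomorphism is determined by its values on homogeneous elements. -/
lemma hom_ext_homogeneous {f g : A →⋆ₐ[ℂ] D}
    (h : ∀ (n : ℤ) (a : A), IsHomogeneous n a → f a = g a) : f = g := by
  have hle : Submodule.span ℂ {a : A | ∃ n, IsHomogeneous n a} ≤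
      LinearMap.eqLocus (f : A →ₗ[ℂ] D) (g : A →ₗ[ℂ] D) := by
    rw [Submodule.span_le]
    rintro a ⟨n, ha⟩
    exact h n a ha
  exact DFunLike.coe_injective (Continuous.ext_on dense_homogeneous (map_continuous f)
    (map_continuous g) fun a ha => hle ha)

end Twist

/-! ### The braided tensor product -/

/-- Equivariant morphisms of unital C⋆-algebras with an action of the circle group. -/
structure TMor (A B : Type) [CStarAlgebra A] [CircleAction A] [CStarAlgebra B] [CircleAction B]
    extends A →⋆ₐ[ℂ] B where
  equivariant : ∀ (z : Circle) (a : A), toStarAlgHom (act z a) = act z (toStarAlgHom a)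

instance (A B : Type) [CStarAlgebra A] [CircleAction A] [CStarAlgebra B] [CircleAction B] :
    CoeFun (TMor A B) fun _ => A → B := ⟨fun f => f.toStarAlgHom⟩

/-- The identity morphism. -/
def TMor.id (A : Type) [CStarAlgebra A] [CircleAction A] : TMor A A where
  toStarAlgHom := StarAlgHom.id ℂ A
  equivariant _ _ := rfl

/-- `x ↦ x ⊗ 1` on unitaries. -/
def unitaryLeft {A : Type} [CStarAlgebra A] (B : Type) [CStarAlgebra B] :
    unitary A →* unitary (MinTensor A B) where
  toFun x := ⟨inclLeft (x : A), by
    rw [Unitary.mem_iff, ← map_star, ← map_mul, ← map_mul,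
      Unitary.star_mul_self_of_mem x.2, Unitary.mul_star_self_of_mem x.2, map_one]
    exact ⟨rfl, rfl⟩⟩
  map_one' := Subtype.ext (map_one inclLeft)
  map_mul' x y := Subtype.ext (map_mul inclLeft (x : A) (y : A))

lemma QTorus.u_zpow_mul_v_zpow (μ : Circle) (m n : ℤ) :
    (((QTorus.u μ ^ m : unitary _) : QTorus μ) * ((QTorus.v μ ^ n : unitary _) : QTorus μ)) =
      ((μ ^ (m * n) : Circle) : ℂ) •
        (((QTorus.v μ ^ n : unitary _) : QTorus μ) * ((QTorus.u μ ^ m : unitary _) : QTorus μ)) := by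
  let c : Circle →* unitary (QTorus μ) :=
    { toFun := fun z => ⟨algebraMap ℂ (QTorus μ) z, by
        rw [Unitary.mem_iff, ← algebraMap_star_comm, ← map_mul, ← map_mul]
        have h : star (z : ℂ) * z = 1 := by
          have := Complex.normSq_eq_conj_mul_self (z := (z : ℂ))
          rw [Circle.normSq_coe, Complex.ofReal_one] at this
          exact this.symm
        rw [mul_comm (z : ℂ), h, map_one]
        exact ⟨rfl, rfl⟩⟩
      map_one' := by ext; simp
      map_mul' := fun z w => by ext; simp }
  have hc : ∀ z x, Commute (c z) x := fun z x => by
    ext; exact Algebra.commutes (z : ℂ) (x : QTorus μ)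
  have h1 : SemiconjBy (QTorus.u μ) (QTorus.v μ) (c μ * QTorus.v μ) := by
    ext
    change ((QTorus.u μ : QTorus μ) * QTorus.v μ) = (algebraMap ℂ (QTorus μ) μ * QTorus.v μ) * _
    rw [QTorus.u_mul_v, mul_assoc, Algebra.smul_def]
  have h2 : SemiconjBy (QTorus.u μ ^ m) (QTorus.v μ) (c μ ^ m * QTorus.v μ) := by
    have h3 : SemiconjBy (QTorus.v μ) (QTorus.u μ) ((c μ)⁻¹ * QTorus.u μ) := by
      change _ = _
      rw [mul_assoc, h1.eq]; group
    have h4 := (h3.zpow_right m).eq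
    rw [((hc μ _).inv_left).mul_zpow] at h4
    change _ = _
    rw [mul_assoc, h4, inv_zpow]; group
  have h5 := (h2.zpow_right n).eq
  rw [((hc μ _).zpow_left m).mul_zpow, ← zpow_mul, ← map_zpow] at h5
  have h6 := congrArg (Subtype.val) h5
  rw [Algebra.smul_def, ← mul_assoc]
  exact h6

/-- The C⋆-algebra `C(𝕋²_ζ) ⊗ A ⊗ B`. -/
abbrev Ambient (ζ : Circle) (A B : Type) [CStarAlgebra A] [CStarAlgebra B] : Type :=
  MinTensor (QTorus ζ) (MinTensor A B)

section Braided

variable (ζ : Circle) (A B : Type) [CStarAlgebra A] [CircleAction A] [CStarAlgebra B]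
  [CircleAction B]

section Tmul

variable {A B : Type} [CStarAlgebra A] [CStarAlgebra B]

/-- The elementary tensor `x ⊗ a ⊗ b`. -/
def tmul₃ (x : QTorus ζ) (a : A) (b : B) : Ambient ζ A B := mtmul x (mtmul a b)

lemma tmul₃_mul (x x' : QTorus ζ) (a a' : A) (b b' : B) :
    tmul₃ ζ x a b * tmul₃ ζ x' a' b' = tmul₃ ζ (x * x') (a * a') (b * b') := by
  simp only [tmul₃, mtmul_mul]

lemma tmul₃_star (x : QTorus ζ) (a : A) (b : B) :
    star (tmul₃ ζ x a b) = tmul₃ ζ (star x) (star a) (star b) := by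
  simp only [tmul₃, mtmul_star]

lemma tmul₃_smul (c : ℂ) (x : QTorus ζ) (a : A) (b : B) :
    tmul₃ ζ (c • x) a b = c • tmul₃ ζ x a b := by
  simp only [tmul₃, mtmul]
  rw [← TensorProduct.smul_tmul', map_smul]

end Tmul

theorem exists_j₁ : ∃ j : A →⋆ₐ[ℂ] Ambient ζ A B, ∀ (n : ℤ) (a : A), IsHomogeneous n a →
    j a = tmul₃ ζ ((QTorus.u ζ ^ n : unitary _) : QTorus ζ) a 1 := by
  let θ : A →⋆ₐ[ℂ] Ambient ζ A B :=
    (inclRight : MinTensor A B →⋆ₐ[ℂ] Ambient ζ A B).comp (inclLeft : A →⋆ₐ[ℂ] MinTensor A B)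
  obtain ⟨j, hj⟩ := exists_twist θ (unitaryLeft (MinTensor A B) (QTorus.u ζ)) fun a =>
    (inclLeft_mul_inclRight _ _).trans (inclRight_mul_inclLeft _ _).symm
  refine ⟨j, fun n a ha => (hj n a ha).trans ?_⟩
  rw [← map_zpow]
  exact inclLeft_mul_inclRight _ _

theorem exists_j₂ : ∃ j : B →⋆ₐ[ℂ] Ambient ζ A B, ∀ (n : ℤ) (b : B), IsHomogeneous n b →
    j b = tmul₃ ζ ((QTorus.v ζ ^ n : unitary _) : QTorus ζ) 1 b := by
  let θ : B →⋆ₐ[ℂ] Ambient ζ A B :=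
    (inclRight : MinTensor A B →⋆ₐ[ℂ] Ambient ζ A B).comp (inclRight : B →⋆ₐ[ℂ] MinTensor A B)
  obtain ⟨j, hj⟩ := exists_twist θ (unitaryLeft (MinTensor A B) (QTorus.v ζ)) fun a =>
    (inclLeft_mul_inclRight _ _).trans (inclRight_mul_inclLeft _ _).symm
  refine ⟨j, fun n a ha => (hj n a ha).trans ?_⟩
  rw [← map_zpow]
  exact inclLeft_mul_inclRight _ _

/-- The embedding `j₁` of `A`: the unique `*`-homomorphism with `j₁(a) = uⁿ ⊗ a ⊗ 1` for `a`
homogeneous of degree `n`. -/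
def amb₁ : A →⋆ₐ[ℂ] Ambient ζ A B := (exists_j₁ ζ A B).choose

/-- The embedding `j₂` of `B`: the unique `*`-homomorphism with `j₂(b) = vⁿ ⊗ 1 ⊗ b` for `b`
homogeneous of degree `n`. -/
def amb₂ : B →⋆ₐ[ℂ] Ambient ζ A B := (exists_j₂ ζ A B).choose

variable {A B}

lemma amb₁_apply {n : ℤ} {a : A} (ha : IsHomogeneous n a) :
    amb₁ ζ A B a = tmul₃ ζ ((QTorus.u ζ ^ n : unitary _) : QTorus ζ) a 1 :=
  (exists_j₁ ζ A B).choose_spec n a ha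

lemma amb₂_apply {n : ℤ} {b : B} (hb : IsHomogeneous n b) :
    amb₂ ζ A B b = tmul₃ ζ ((QTorus.v ζ ^ n : unitary _) : QTorus ζ) 1 b :=
  (exists_j₂ ζ A B).choose_spec n b hb

/-- The commutation rule of the two embeddings. -/
lemma amb₁_mul_amb₂ {m n : ℤ} {a : A} {b : B} (ha : IsHomogeneous m a) (hb : IsHomogeneous n b) :
    amb₁ ζ A B a * amb₂ ζ A B b =
      ((ζ ^ (m * n) : Circle) : ℂ) • (amb₂ ζ A B b * amb₁ ζ A B a) := by
  rw [amb₁_apply ζ ha, amb₂_apply ζ hb, tmul₃_mul, tmul₃_mul, QTorus.u_zpow_mul_v_zpow,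
    tmul₃_smul, mul_one, one_mul, mul_one, one_mul]

lemma amb₂_mul_amb₁ {m n : ℤ} {a : A} {b : B} (ha : IsHomogeneous m a) (hb : IsHomogeneous n b) :
    amb₂ ζ A B b * amb₁ ζ A B a =
      ((ζ ^ (-(m * n)) : Circle) : ℂ) • (amb₁ ζ A B a * amb₂ ζ A B b) := by
  rw [amb₁_mul_amb₂ ζ ha hb, smul_smul, ← Circle.coe_mul, ← zpow_add, neg_add_cancel, zpow_zero,
    Circle.coe_one, one_smul]

variable (A B)

/-- The span of the products `j₁(a) j₂(b)` with `a`, `b` homogeneous. -/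
def braidedHom : StarSubalgebra ℂ (Ambient ζ A B) :=
  spanStar {x | ∃ (m n : ℤ) (a : A) (b : B), IsHomogeneous m a ∧ IsHomogeneous n b ∧
      x = amb₁ ζ A B a * amb₂ ζ A B b}
    ⟨0, 0, 1, 1, .one, .one, by rw [map_one, map_one, one_mul]⟩
    (by
      rintro _ ⟨m, n, a, b, ha, hb, rfl⟩ _ ⟨m', n', a', b', ha', hb', rfl⟩
      have : amb₁ ζ A B a * amb₂ ζ A B b * (amb₁ ζ A B a' * amb₂ ζ A B b') =
          ((ζ ^ (-(m' * n)) : Circle) : ℂ) • (amb₁ ζ A B (a * a') * amb₂ ζ A B (b * b')) := by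
        rw [mul_assoc, ← mul_assoc (amb₂ ζ A B b), amb₂_mul_amb₁ ζ ha' hb, smul_mul_assoc,
          mul_smul_comm, map_mul, map_mul]
        simp only [mul_assoc]
      rw [this]
      exact Submodule.smul_mem _ _ (Submodule.subset_span
        ⟨_, _, _, _, ha.mul ha', hb.mul hb', rfl⟩))
    (by
      rintro _ ⟨m, n, a, b, ha, hb, rfl⟩
      rw [star_mul, ← map_star, ← map_star, amb₂_mul_amb₁ ζ ha.star hb.star]
      exact Submodule.smul_mem _ _ (Submodule.subset_span ⟨_, _, _, _, ha.star, hb.star, rfl⟩))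

/-- The homogeneous products `j₁(a) j₂(b)` have the same closed linear span as all of them. -/
lemma closure_span_eq :
    closure (Submodule.span ℂ {x | ∃ (a : A) (b : B), x = amb₁ ζ A B a * amb₂ ζ A B b} :
      Set (Ambient ζ A B)) = (braidedHom ζ A B).topologicalClosure := by
  rw [StarSubalgebra.topologicalClosure_coe]
  refine subset_antisymm (closure_minimal ?_ isClosed_closure) (closure_mono ?_)
  · let N : Submodule ℂ (Ambient ζ A B) :=
      (braidedHom ζ A B).topologicalClosure.toSubalgebra.toSubmodule
    have hN : IsClosed (N : Set (Ambient ζ A B)) :=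
      (braidedHom ζ A B).isClosed_topologicalClosure
    change ((Submodule.span ℂ _ : Submodule ℂ (Ambient ζ A B)) : Set _) ⊆ (N : Set (Ambient ζ A B))
    rw [SetLike.coe_subset_coe, Submodule.span_le]
    rintro _ ⟨a, b, rfl⟩
    have h1 : ∀ (m : ℤ) (a : A), IsHomogeneous m a → ∀ b, amb₁ ζ A B a * amb₂ ζ A B b ∈ N := by
      intro m a ha b
      have : b ∈ closure (Submodule.span ℂ {b : B | ∃ n, IsHomogeneous n b} : Set B) :=
        dense_homogeneous b
      refine closure_minimal (s := (Submodule.span ℂ {b : B | ∃ n, IsHomogeneous n b} : Set B))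
        (t := {b | amb₁ ζ A B a * amb₂ ζ A B b ∈ N}) ?_ (hN.preimage
          (continuous_const.mul (map_continuous (amb₂ ζ A B)))) this
      let f : B →ₗ[ℂ] Ambient ζ A B :=
        (LinearMap.mulLeft ℂ (amb₁ ζ A B a)).comp (amb₂ ζ A B : B →ₗ[ℂ] Ambient ζ A B)
      change ((Submodule.span ℂ _ : Submodule ℂ B) : Set B) ⊆ ((N.comap f : Submodule ℂ B) : Set B)
      rw [SetLike.coe_subset_coe, Submodule.span_le]
      rintro b ⟨n, hb⟩
      exact subset_closure (Submodule.subset_span ⟨m, n, a, b, ha, hb, rfl⟩)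
    have : a ∈ closure (Submodule.span ℂ {a : A | ∃ n, IsHomogeneous n a} : Set A) :=
      dense_homogeneous a
    refine closure_minimal (s := (Submodule.span ℂ {a : A | ∃ n, IsHomogeneous n a} : Set A))
      (t := {a | amb₁ ζ A B a * amb₂ ζ A B b ∈ N}) ?_ (hN.preimage
        ((map_continuous (amb₁ ζ A B)).mul continuous_const)) this
    let f : A →ₗ[ℂ] Ambient ζ A B :=
      (LinearMap.mulRight ℂ (amb₂ ζ A B b)).comp (amb₁ ζ A B : A →ₗ[ℂ] Ambient ζ A B)
    change ((Submodule.span ℂ _ : Submodule ℂ A) : Set A) ⊆ ((N.comap f : Submodule ℂ A) : Set A)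
    rw [SetLike.coe_subset_coe, Submodule.span_le]
    rintro a ⟨n, ha⟩
    exact h1 n a ha b
  · refine Submodule.span_mono ?_
    rintro _ ⟨m, n, a, b, ha, hb, rfl⟩
    exact ⟨a, b, rfl⟩

/-- The braided tensor product `A ⊠_ζ B = [j₁(A) j₂(B)]`, the closed linear span of the products
`j₁(a) j₂(b)` in `C(𝕋²_ζ) ⊗ A ⊗ B`. -/
def braided : StarSubalgebra ℂ (Ambient ζ A B) :=
  (braidedHom ζ A B).topologicalClosure.copy
    (closure (Submodule.span ℂ {x | ∃ (a : A) (b : B), x = amb₁ ζ A B a * amb₂ ζ A B b}))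
    (closure_span_eq ζ A B)

/-- The C⋆-algebra `A ⊠_ζ B`. -/
def BT : Type := ↥(braided ζ A B)

instance : IsClosed (braided ζ A B : Set (Ambient ζ A B)) := isClosed_closure

instance : CStarAlgebra (BT ζ A B) := inferInstanceAs (CStarAlgebra ↥(braided ζ A B))

/-- The inclusion of `A ⊠_ζ B` in `C(𝕋²_ζ) ⊗ A ⊗ B`. -/
def BT.val : BT ζ A B →⋆ₐ[ℂ] Ambient ζ A B := (braided ζ A B).subtype

variable {A B} in
lemma BT.val_injective : Function.Injective (BT.val ζ A B) := Subtype.val_injective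

/-- The morphism `j₁ : A → A ⊠_ζ B`. -/
def incl₁ : A →⋆ₐ[ℂ] BT ζ A B :=
  (amb₁ ζ A B).codRestrict (braided ζ A B) fun a =>
    subset_closure (Submodule.subset_span ⟨a, 1, by rw [map_one, mul_one]⟩)

/-- The morphism `j₂ : B → A ⊠_ζ B`. -/
def incl₂ : B →⋆ₐ[ℂ] BT ζ A B :=
  (amb₂ ζ A B).codRestrict (braided ζ A B) fun b =>
    subset_closure (Submodule.subset_span ⟨1, b, by rw [map_one, one_mul]⟩)

lemma BT.dense : Dense (Submodule.span ℂ {x : BT ζ A B | ∃ (a : A) (b : B),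
    x = incl₁ ζ A B a * incl₂ ζ A B b} : Set (BT ζ A B)) := by
  intro x
  have hind : Topology.IsInducing (BT.val ζ A B) := Topology.IsInducing.subtypeVal
  rw [hind.closure_eq_preimage_closure_image]
  have hx : BT.val ζ A B x ∈ closure (Submodule.span ℂ {x | ∃ (a : A) (b : B),
      x = amb₁ ζ A B a * amb₂ ζ A B b} : Set (Ambient ζ A B)) := x.2
  refine closure_mono ?_ hx
  have : (BT.val ζ A B : BT ζ A B → Ambient ζ A B) = (BT.val ζ A B : BT ζ A B →ₗ[ℂ] _) := rfl
  rw [this, ← Submodule.map_coe, SetLike.coe_subset_coe, Submodule.map_span]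
  refine Submodule.span_mono ?_
  rintro _ ⟨a, b, rfl⟩
  exact ⟨_, ⟨a, b, rfl⟩, map_mul (BT.val ζ A B) _ _⟩

variable {A B}

/-- Two `*`-homomorphisms on `A ⊠_ζ B` that agree on `j₁(A)` and on `j₂(B)` are equal. -/
lemma BT.hom_ext {D : Type} [CStarAlgebra D] {f g : BT ζ A B →⋆ₐ[ℂ] D}
    (h₁ : ∀ a, f (incl₁ ζ A B a) = g (incl₁ ζ A B a))
    (h₂ : ∀ b, f (incl₂ ζ A B b) = g (incl₂ ζ A B b)) : f = g := by
  have hle : Submodule.span ℂ {x : BT ζ A B | ∃ (a : A) (b : B),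
      x = incl₁ ζ A B a * incl₂ ζ A B b} ≤
      LinearMap.eqLocus (f : BT ζ A B →ₗ[ℂ] D) (g : BT ζ A B →ₗ[ℂ] D) := by
    rw [Submodule.span_le]
    rintro _ ⟨a, b, rfl⟩
    change f _ = g _
    rw [map_mul, map_mul, h₁, h₂]
  exact DFunLike.coe_injective (Continuous.ext_on (BT.dense ζ A B) (map_continuous f)
    (map_continuous g) fun a ha => hle ha)

variable {A₂ B₂ : Type} [CStarAlgebra A₂] [CircleAction A₂] [CStarAlgebra B₂] [CircleAction B₂]

lemma TMor.isHomogeneous (Φ : TMor A A₂) {n : ℤ} {a : A} (ha : IsHomogeneous n a) :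
    IsHomogeneous n (Φ a) := fun z => by
  rw [← Φ.equivariant, ha z, map_smul]

/-- The `*`-homomorphism `id ⊗ Φ ⊗ Ψ`. -/
def ambMap (Φ : TMor A A₂) (Ψ : TMor B B₂) : Ambient ζ A B →⋆ₐ[ℂ] Ambient ζ A₂ B₂ :=
  MinTensor.map (StarAlgHom.id ℂ _) (MinTensor.map Φ.toStarAlgHom Ψ.toStarAlgHom)

lemma ambMap_tmul₃ (Φ : TMor A A₂) (Ψ : TMor B B₂) (x : QTorus ζ) (a : A) (b : B) :
    ambMap ζ Φ Ψ (tmul₃ ζ x a b) = tmul₃ ζ x (Φ a) (Ψ b) := by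
  rw [tmul₃, ambMap, MinTensor.map_mtmul, MinTensor.map_mtmul]; rfl

lemma ambMap_amb₁ (Φ : TMor A A₂) (Ψ : TMor B B₂) (a : A) :
    ambMap ζ Φ Ψ (amb₁ ζ A B a) = amb₁ ζ A₂ B₂ (Φ a) := by
  refine DFunLike.congr_fun (hom_ext_homogeneous (f := (ambMap ζ Φ Ψ).comp (amb₁ ζ A B))
    (g := (amb₁ ζ A₂ B₂).comp Φ.toStarAlgHom) fun n a ha => ?_) a
  change ambMap ζ Φ Ψ (amb₁ ζ A B a) = amb₁ ζ A₂ B₂ (Φ a)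
  rw [amb₁_apply ζ ha, amb₁_apply ζ (Φ.isHomogeneous ha), ambMap_tmul₃, map_one]

lemma ambMap_amb₂ (Φ : TMor A A₂) (Ψ : TMor B B₂) (b : B) :
    ambMap ζ Φ Ψ (amb₂ ζ A B b) = amb₂ ζ A₂ B₂ (Ψ b) := by
  refine DFunLike.congr_fun (hom_ext_homogeneous (f := (ambMap ζ Φ Ψ).comp (amb₂ ζ A B))
    (g := (amb₂ ζ A₂ B₂).comp Ψ.toStarAlgHom) fun n b hb => ?_) b
  change ambMap ζ Φ Ψ (amb₂ ζ A B b) = amb₂ ζ A₂ B₂ (Ψ b)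
  rw [amb₂_apply ζ hb, amb₂_apply ζ (Ψ.isHomogeneous hb), ambMap_tmul₃, map_one]

/-- The `*`-homomorphism `Φ ⊠_ζ Ψ`, the restriction of `id ⊗ Φ ⊗ Ψ`. -/
def BT.mapHom (Φ : TMor A A₂) (Ψ : TMor B B₂) : BT ζ A B →⋆ₐ[ℂ] BT ζ A₂ B₂ :=
  ((ambMap ζ Φ Ψ).comp (BT.val ζ A B)).codRestrict (braided ζ A₂ B₂) fun x => by
    have hx : BT.val ζ A B x ∈ closure (Submodule.span ℂ {x | ∃ (a : A) (b : B),
      x = amb₁ ζ A B a * amb₂ ζ A B b} : Set (Ambient ζ A B)) := x.2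
    refine map_mem_closure (f := ambMap ζ Φ Ψ) (map_continuous _) hx ?_
    intro y hy
    induction hy using Submodule.span_induction with
    | mem y hy =>
      obtain ⟨a, b, rfl⟩ := hy
      rw [map_mul, ambMap_amb₁, ambMap_amb₂]
      exact Submodule.subset_span ⟨_, _, rfl⟩
    | zero => rw [map_zero]; exact Submodule.zero_mem _
    | add y z _ _ hy hz => rw [map_add]; exact Submodule.add_mem _ hy hz
    | smul c y _ hy => rw [map_smul]; exact Submodule.smul_mem _ _ hy

lemma BT.mapHom_incl₁ (Φ : TMor A A₂) (Ψ : TMor B B₂) (a : A) :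
    BT.mapHom ζ Φ Ψ (incl₁ ζ A B a) = incl₁ ζ A₂ B₂ (Φ a) :=
  Subtype.ext (ambMap_amb₁ ζ Φ Ψ a)

lemma BT.mapHom_incl₂ (Φ : TMor A A₂) (Ψ : TMor B B₂) (b : B) :
    BT.mapHom ζ Φ Ψ (incl₂ ζ A B b) = incl₂ ζ A₂ B₂ (Ψ b) :=
  Subtype.ext (ambMap_amb₂ ζ Φ Ψ b)

end Braided

/-- Each `ρ_z` is equivariant, since the circle group is commutative. -/
def actMor (A : Type) [CStarAlgebra A] [CircleAction A] (z : Circle) : TMor A A where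
  toStarAlgHom := act z
  equivariant w a := by rw [← act_mul, ← act_mul, mul_comm]

/-- Point-norm continuity of a family of `*`-homomorphisms can be checked on a dense set. -/
lemma continuous_of_dense {D : Type} [CStarAlgebra D] (φ : Circle → D →⋆ₐ[ℂ] D) {s : Set D}
    (hs : Dense s) (h : ∀ x ∈ s, Continuous fun z => φ z x) (x : D) :
    Continuous fun z => φ z x := by
  refine continuous_of_uniform_approx_of_continuous fun U hU => ?_
  obtain ⟨ε, hε, hU⟩ := Metric.mem_uniformity_dist.1 hU
  obtain ⟨y, hy, hxy⟩ := Metric.dense_iff.1 hs x ε hε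
  refine ⟨_, h _ hxy, fun z => hU ?_⟩
  rw [dist_eq_norm, ← map_sub]
  refine (NonUnitalStarAlgHom.norm_apply_le (φ z) _).trans_lt ?_
  rw [← dist_eq_norm, dist_comm]
  exact hy

section Objects

variable (ζ : Circle) (A B : Type) [CStarAlgebra A] [CircleAction A] [CStarAlgebra B]
  [CircleAction B]

/-- The action of the circle on `A ⊠_ζ B`, for which `j₁` and `j₂` are equivariant. -/
instance : CircleAction (BT ζ A B) where
  act z := BT.mapHom ζ (actMor A z) (actMor B z)
  act_one x := by
    refine DFunLike.congr_fun (BT.hom_ext ζ (f := BT.mapHom ζ (actMor A 1) (actMor B 1))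
      (g := StarAlgHom.id ℂ _) (fun a => ?_) fun b => ?_) x
    · rw [BT.mapHom_incl₁]; exact congrArg _ (act_one a)
    · rw [BT.mapHom_incl₂]; exact congrArg _ (act_one b)
  act_mul z w x := by
    refine DFunLike.congr_fun (BT.hom_ext ζ (f := BT.mapHom ζ (actMor A (z * w)) (actMor B (z * w)))
      (g := (BT.mapHom ζ (actMor A z) (actMor B z)).comp
        (BT.mapHom ζ (actMor A w) (actMor B w))) (fun a => ?_) fun b => ?_) x
    · rw [StarAlgHom.comp_apply, BT.mapHom_incl₁, BT.mapHom_incl₁, BT.mapHom_incl₁]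
      exact congrArg _ (act_mul z w a)
    · rw [StarAlgHom.comp_apply, BT.mapHom_incl₂, BT.mapHom_incl₂, BT.mapHom_incl₂]
      exact congrArg _ (act_mul z w b)
  continuous_act := continuous_of_dense _ (BT.dense ζ A B) fun x hx => by
    induction hx using Submodule.span_induction with
    | mem x hx =>
      obtain ⟨a, b, rfl⟩ := hx
      simp only [map_mul, BT.mapHom_incl₁, BT.mapHom_incl₂]
      exact ((map_continuous _).comp (continuous_act a)).mul
        ((map_continuous _).comp (continuous_act b))
    | zero => simp only [map_zero]; exact continuous_const
    | add x y _ _ hx hy => simp only [map_add]; exact hx.add hy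
    | smul c x _ hx => simp only [map_smul]; exact hx.const_smul c

/-- The morphism `j₁ : A → A ⊠_ζ B`. -/
def j₁ : TMor A (BT ζ A B) where
  toStarAlgHom := incl₁ ζ A B
  equivariant z a := (BT.mapHom_incl₁ ζ (actMor A z) (actMor B z) a).symm

/-- The morphism `j₂ : B → A ⊠_ζ B`. -/
def j₂ : TMor B (BT ζ A B) where
  toStarAlgHom := incl₂ ζ A B
  equivariant z b := (BT.mapHom_incl₂ ζ (actMor A z) (actMor B z) b).symm

variable {A B}

lemma j₁_mul_j₂ {m n : ℤ} {a : A} {b : B} (ha : IsHomogeneous m a) (hb : IsHomogeneous n b) :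
    j₁ ζ A B a * j₂ ζ A B b = ((ζ ^ (m * n) : Circle) : ℂ) • (j₂ ζ A B b * j₁ ζ A B a) :=
  Subtype.ext (amb₁_mul_amb₂ ζ ha hb)

variable {A₂ B₂ : Type} [CStarAlgebra A₂] [CircleAction A₂] [CStarAlgebra B₂] [CircleAction B₂]

/-- The equivariant morphism `Φ ⊠_ζ Ψ`. -/
def BT.map (Φ : TMor A A₂) (Ψ : TMor B B₂) : TMor (BT ζ A B) (BT ζ A₂ B₂) where
  toStarAlgHom := BT.mapHom ζ Φ Ψ
  equivariant z x := by
    refine DFunLike.congr_fun (BT.hom_ext ζ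
      (f := (BT.mapHom ζ Φ Ψ).comp (BT.mapHom ζ (actMor A z) (actMor B z)))
      (g := (BT.mapHom ζ (actMor A₂ z) (actMor B₂ z)).comp (BT.mapHom ζ Φ Ψ))
      (fun a => ?_) fun b => ?_) x
    · simp only [StarAlgHom.comp_apply, BT.mapHom_incl₁]
      exact congrArg _ (Φ.equivariant z a)
    · simp only [StarAlgHom.comp_apply, BT.mapHom_incl₂]
      exact congrArg _ (Ψ.equivariant z b)

@[simp] lemma BT.map_j₁ (Φ : TMor A A₂) (Ψ : TMor B B₂) (a : A) :
    BT.map ζ Φ Ψ (j₁ ζ A B a) = j₁ ζ A₂ B₂ (Φ a) := BT.mapHom_incl₁ ζ Φ Ψ a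

@[simp] lemma BT.map_j₂ (Φ : TMor A A₂) (Ψ : TMor B B₂) (b : B) :
    BT.map ζ Φ Ψ (j₂ ζ A B b) = j₂ ζ A₂ B₂ (Ψ b) := BT.mapHom_incl₂ ζ Φ Ψ b

end Objects

/-! ### The braided quantum group `SU_q(2)` -/

/-- The defining relations of `C(SU_q(2))`. -/
structure SURel {D : Type} [CStarAlgebra D] (q : ℂ) (α γ : D) : Prop where
  star_mul_add : star α * α + star γ * γ = 1
  mul_star_add : α * star α + ((‖q‖ : ℂ) ^ 2) • (star γ * γ) = 1
  mul_comm_smul : α * γ = conj q • (γ * α)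
  normal : γ * star γ = star γ * γ

section Relations

variable {D : Type} [CStarAlgebra D] {q : ℂ} {α γ : D}

lemma norm_le_one_of_star_mul_add {x y : D} (h : star x * x + star y * y = 1) : ‖x‖ ≤ 1 := by
  rcases subsingleton_or_nontrivial D with hD | hD
  · rw [Subsingleton.elim x 0, norm_zero]; exact zero_le_one
  let _ := CStarAlgebra.spectralOrder D
  let _ := CStarAlgebra.spectralOrderedRing D
  have h1 : star x * x ≤ 1 := by
    rw [← h]; exact le_add_of_nonneg_right (star_mul_self_nonneg y)
  have h2 := CStarAlgebra.norm_le_norm_of_nonneg_of_le (star_mul_self_nonneg x) h1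
  rw [CStarRing.norm_star_mul_self, CStarRing.norm_one] at h2
  nlinarith [norm_nonneg x]

lemma SURel.norm_fst_le (h : SURel q α γ) : ‖α‖ ≤ 1 := norm_le_one_of_star_mul_add h.star_mul_add

lemma SURel.norm_snd_le (h : SURel q α γ) : ‖γ‖ ≤ 1 :=
  norm_le_one_of_star_mul_add ((add_comm _ _).trans h.star_mul_add)

lemma SURel.fst_star_mul (h : SURel q α γ) : star α * α = 1 - star γ * γ :=
  eq_sub_of_add_eq h.star_mul_add

lemma SURel.fst_mul_star (h : SURel q α γ) :
    α * star α = 1 - (q * conj q) • (star γ * γ) := by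
  rw [Complex.mul_conj, Complex.normSq_eq_norm_sq, Complex.ofReal_pow]
  exact eq_sub_of_add_eq h.mul_star_add

lemma SURel.adj_comm (h : SURel q α γ) : star γ * star α = q • (star α * star γ) := by
  have := congrArg star h.mul_comm_smul
  rwa [star_mul, star_smul, star_mul, ← starRingEnd_apply, Complex.conj_conj] at this

lemma SURel.fst_mul_snd_star (h : SURel q α γ) : α * star γ = q • (star γ * α) := by
  rw [← sub_eq_zero, ← CStarRing.star_mul_self_eq_zero_iff, star_sub, star_mul, star_star,
    star_smul, star_mul, star_star, ← starRingEnd_apply]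
  set N := star γ * γ with hN
  have e1 : γ * star α * (α * star γ) = N - N * N := by
    have : γ * star α * (α * star γ) = γ * (star α * α) * star γ := by simp only [mul_assoc]
    rw [this, h.fst_star_mul, mul_sub, sub_mul, mul_one, h.normal, mul_assoc, mul_assoc, h.normal,
      ← mul_assoc, h.normal]
  have e2 : γ * star α * (q • (star γ * α)) = N - N * N := by
    have : γ * star α * (q • (star γ * α)) = γ * (q • (star α * star γ)) * α := by
      simp only [mul_smul_comm, smul_mul_assoc, mul_assoc]
    rw [this, ← h.adj_comm, ← mul_assoc, h.normal, mul_assoc, h.fst_star_mul, mul_sub, mul_one]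
  have e3 : conj q • (star α * γ) * (α * star γ) = N - N * N := by
    have : conj q • (star α * γ) * (α * star γ) = star α * (conj q • (γ * α)) * star γ := by
      simp only [mul_smul_comm, smul_mul_assoc, mul_assoc]
    rw [this, ← h.mul_comm_smul, ← mul_assoc, h.fst_star_mul, mul_assoc, h.normal, sub_mul, one_mul]
  have e4 : conj q • (star α * γ) * (q • (star γ * α)) = N - N * N := by
    have : conj q • (star α * γ) * (q • (star γ * α)) =
        star α * ((q * conj q) • (γ * star γ)) * α := by
      simp only [mul_smul_comm, smul_mul_assoc, mul_assoc, smul_smul]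
    have h2 : (q * conj q) • (γ * star γ) = 1 - α * star α := by
      rw [h.fst_mul_star, h.normal, sub_sub_cancel]
    rw [this, h2, mul_sub, sub_mul, mul_one, ← mul_assoc, mul_assoc (star α * α), h.fst_star_mul,
      ← hN]
    noncomm_ring
  rw [sub_mul, mul_sub, mul_sub, e1, e2, e3, e4, sub_self]

lemma SURel.snd_mul_fst_star (h : SURel q α γ) : γ * star α = conj q • (star α * γ) := by
  have := congrArg star h.fst_mul_snd_star
  rwa [star_mul, star_smul, star_mul, star_star, ← starRingEnd_apply] at this

lemma assoc_rule {x y z : D} (h : x * y = z) (w : D) : x * (y * w) = z * w := by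
  rw [← mul_assoc, h]

set_option linter.unusedSimpArgs false in
set_option maxHeartbeats 1000000 in
/-- The elements that define the coproduct satisfy the relations of `C(SU_q(2))`. -/
theorem SURel.coproduct {ζ ζ' : ℂ} (hζ : conj q * ζ = q) (hζ' : q * ζ' = conj q) {a c b d : D}
    (h1 : SURel q a c) (h2 : SURel q b d)
    (ba : b * a = a * b) (ba' : b * star a = star a * b) (b'a : star b * a = a * star b)
    (b'a' : star b * star a = star a * star b)
    (bc : b * c = c * b) (bc' : b * star c = star c * b) (b'c : star b * c = c * star b)
    (b'c' : star b * star c = star c * star b)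
    (da : d * a = a * d) (da' : d * star a = star a * d) (d'a : star d * a = a * star d)
    (d'a' : star d * star a = star a * star d)
    (dc : d * c = ζ' • (c * d)) (dc' : d * star c = ζ • (star c * d))
    (d'c : star d * c = ζ • (c * star d)) (d'c' : star d * star c = ζ' • (star c * star d)) :
    SURel q (a * b - q • (star c * d)) (c * b + star a * d) := by
  have n2 : ((‖q‖ : ℂ) ^ 2) = q * conj q := by
    rw [Complex.mul_conj, Complex.normSq_eq_norm_sq, Complex.ofReal_pow]
  have s1 : star (a * b - q • (star c * d)) =
      star b * star a - conj q • (star d * c) := by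
    rw [star_sub, star_mul, star_smul, star_mul, star_star]; rfl
  have s2 : star (c * b + star a * d) = star b * star c + star d * a := by
    rw [star_add, star_mul, star_mul, star_star]
  have hz : q * conj q * (ζ * ζ') = q * conj q := by
    linear_combination q * ζ' * hζ + q * hζ'
  constructor <;> try simp only [s1, s2, n2]
  all_goals
    simp only [mul_add, add_mul, mul_sub, sub_mul, smul_mul_assoc, mul_smul_comm, smul_smul,
    mul_assoc, mul_one, one_mul, smul_sub, smul_add,
    ba, ba', b'a, b'a', bc, bc', b'c, b'c', da, da', d'a, d'a', dc, dc', d'c, d'c',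
    assoc_rule ba, assoc_rule ba', assoc_rule b'a, assoc_rule b'a', assoc_rule bc,
    assoc_rule bc', assoc_rule b'c, assoc_rule b'c', assoc_rule da, assoc_rule da',
    assoc_rule d'a, assoc_rule d'a', assoc_rule dc, assoc_rule dc', assoc_rule d'c,
    assoc_rule d'c',
    h1.normal, h1.mul_comm_smul, h1.fst_mul_snd_star, h1.snd_mul_fst_star, h1.adj_comm,
    h1.fst_star_mul, h1.fst_mul_star, assoc_rule h1.normal, assoc_rule h1.mul_comm_smul,
    assoc_rule h1.fst_mul_snd_star, assoc_rule h1.snd_mul_fst_star, assoc_rule h1.adj_comm,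
    assoc_rule h1.fst_star_mul, assoc_rule h1.fst_mul_star,
    h2.normal, h2.mul_comm_smul, h2.fst_mul_snd_star, h2.snd_mul_fst_star, h2.adj_comm,
    h2.fst_star_mul, h2.fst_mul_star, assoc_rule h2.normal, assoc_rule h2.mul_comm_smul,
    assoc_rule h2.fst_mul_snd_star, assoc_rule h2.snd_mul_fst_star, assoc_rule h2.adj_comm,
    assoc_rule h2.fst_star_mul, assoc_rule h2.fst_mul_star] <;>
    match_scalars <;> first | ring1 | linear_combination hz | linear_combination -hζ' | linear_combination q * hζ |
      linear_combination hζ | linear_combination -hζ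

end Relations

/-- The presentation of `C(SU_q(2))` by `α = s 0` and `γ = s 1`. -/
def suPres (q : ℂ) : Presentation (Fin 2) where
  Rel := fun D _ s => SURel q (s 0) (s 1)
  norm_le D _ s hs x := by
    fin_cases x
    · exact hs.norm_fst_le
    · exact hs.norm_snd_le

/-- The universal unital C⋆-algebra `C(SU_q(2))`. -/
abbrev SUq2 (q : ℂ) : Type := (suPres q).Univ

variable (q : ℂ)

/-- The generator `α` of `C(SU_q(2))`. -/
def alpha : SUq2 q := (suPres q).gen 0

/-- The generator `γ` of `C(SU_q(2))`. -/
def gamma : SUq2 q := (suPres q).gen 1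

lemma suRel : SURel q (alpha q) (gamma q) := by
  set T := (suPres q).family.toEnv with hT
  have ha : alpha q = T (FreeStar.gen 0) := rfl
  have hc : gamma q = T (FreeStar.gen 1) := rfl
  constructor <;> simp only [ha, hc, ← map_star, ← map_mul, ← map_add, ← map_smul, ← map_one T] <;>
    refine (suPres q).toEnv_eq fun D _ f hf => ?_
  · simp only [map_star, map_mul, map_add, map_one]; exact hf.star_mul_add
  · simp only [map_star, map_mul, map_add, map_one, map_smul]; exact hf.mul_star_add
  · simp only [map_mul, map_smul]; exact hf.mul_comm_smul
  · simp only [map_star, map_mul]; exact hf.normal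

variable {q} in
lemma SURel.rotate {D : Type} [CStarAlgebra D] {α γ : D} (h : SURel q α γ) (z : Circle) :
    SURel q α ((z : ℂ) • γ) := by
  have hz : star (z : ℂ) * z = 1 := by
    have := Complex.normSq_eq_conj_mul_self (z := (z : ℂ))
    rw [Circle.normSq_coe, Complex.ofReal_one] at this
    exact this.symm
  have h1 : star ((z : ℂ) • γ) * ((z : ℂ) • γ) = star γ * γ := by
    rw [star_smul, smul_mul_smul_comm, hz, one_smul]
  have h2 : ((z : ℂ) • γ) * star ((z : ℂ) • γ) = γ * star γ := by
    rw [star_smul, smul_mul_smul_comm, mul_comm, hz, one_smul]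
  constructor
  · rw [h1, h.star_mul_add]
  · rw [h1, h.mul_star_add]
  · rw [mul_smul_comm, h.mul_comm_smul, smul_mul_assoc, smul_comm]
  · rw [h1, h2, h.normal]

/-- The `*`-homomorphism on `C(SU_q(2))` with prescribed images of `α` and `γ`. -/
def suLift {q : ℂ} {D : Type} [CStarAlgebra D] {a c : D} (h : SURel q a c) : SUq2 q →⋆ₐ[ℂ] D :=
  (suPres q).lift ![a, c] h

section

variable {q} {D : Type} [CStarAlgebra D]

@[simp] lemma suLift_alpha {a c : D} (h : SURel q a c) : suLift h (alpha q) = a :=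
  (suPres q).lift_gen ![a, c] h 0

@[simp] lemma suLift_gamma {a c : D} (h : SURel q a c) : suLift h (gamma q) = c :=
  (suPres q).lift_gen ![a, c] h 1

lemma su_hom_ext {f g : SUq2 q →⋆ₐ[ℂ] D} (h0 : f (alpha q) = g (alpha q))
    (h1 : f (gamma q) = g (gamma q)) (x : SUq2 q) : f x = g x := by
  refine DFunLike.congr_fun ((suPres q).hom_ext fun i => ?_) x
  fin_cases i
  · exact h0
  · exact h1

end

/-- The action of the circle on `C(SU_q(2))` with `ρ_z(α) = α` and `ρ_z(γ) = z γ`. -/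
instance : CircleAction (SUq2 q) where
  act z := suLift ((suRel q).rotate z)
  act_one x := by
    refine su_hom_ext (g := StarAlgHom.id ℂ _) ?_ ?_ x <;> simp
  act_mul z w x := by
    refine su_hom_ext (g := (suLift ((suRel q).rotate z)).comp (suLift ((suRel q).rotate w)))
      ?_ ?_ x
    · simp
    · simp [mul_smul, smul_comm (z : ℂ)]
  continuous_act := continuous_of_dense _ (s := Set.range (suPres q).family.toEnv)
      (suPres q).family.denseRange_coe <| by
    rintro _ ⟨x, rfl⟩
    induction x using FreeStar.induction with
    | scalar c => simp only [AlgHomClass.commutes]; exact continuous_const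
    | letter p =>
      have h0 : ∀ i, Continuous fun z : Circle =>
          suLift ((suRel q).rotate z) ((suPres q).gen i) := by
        intro i
        fin_cases i
        · change Continuous fun z : Circle => suLift ((suRel q).rotate z) (alpha q)
          simp only [suLift_alpha]; exact continuous_const
        · change Continuous fun z : Circle => suLift ((suRel q).rotate z) (gamma q)
          simp only [suLift_gamma]; exact (continuous_subtype_val (p := fun z => z ∈ Submonoid.unitSphere ℂ)).smul continuous_const
      rcases p with ⟨i, _ | _⟩
      · exact h0 i
      · have : FreeStar.letter (i, true) = star (FreeStar.gen i) := by simp [FreeStar.gen]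
        simp only [this, map_star]
        exact (h0 i).star
    | mul a b ha hb => simp only [map_mul]; exact ha.mul hb
    | add a b ha hb => simp only [map_add]; exact ha.add hb

lemma act_alpha (z : Circle) : act z (alpha q) = alpha q := suLift_alpha _

lemma act_gamma (z : Circle) : act z (gamma q) = (z : ℂ) • gamma q := suLift_gamma _

lemma alpha_homogeneous : IsHomogeneous 0 (alpha q) := fun z => by
  rw [act_alpha, zpow_zero, Circle.coe_one, one_smul]

lemma gamma_homogeneous : IsHomogeneous 1 (gamma q) := fun z => by
  rw [act_gamma, zpow_one]

/-- The parameter `ζ = q / conj q` (and `1` if `q = 0`). -/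
def zeta : Circle :=
  if h : q = 0 then 1 else ⟨q / conj q, mem_sphere_zero_iff_norm.2 (by
    rw [norm_div, RCLike.norm_conj, div_self (norm_ne_zero_iff.2 h)])⟩

variable {q} in
lemma zeta_coe (h : q ≠ 0) : (zeta q : ℂ) = q / conj q :=
  congrArg (fun z : Circle => (z : ℂ)) (dif_neg h)

lemma conj_mul_zeta : conj q * (zeta q : ℂ) = q := by
  rcases eq_or_ne q 0 with h | h
  · simp [h]
  · rw [zeta_coe h]
    exact mul_div_cancel₀ q ((map_ne_zero _).2 h)

lemma mul_zeta_inv : q * (((zeta q)⁻¹ : Circle) : ℂ) = conj q := by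
  have h := congrArg (fun x : ℂ => x * (((zeta q)⁻¹ : Circle) : ℂ)) (conj_mul_zeta q)
  refine h.symm.trans ?_
  rw [mul_assoc, ← Circle.coe_mul, mul_inv_cancel, Circle.coe_one, mul_one]

/-- The braided tensor square of `C(SU_q(2))`. -/
abbrev SU2SU (q : ℂ) : Type := BT (zeta q) (SUq2 q) (SUq2 q)

lemma j₂_mul_j₁ (ζ : Circle) {A B : Type} [CStarAlgebra A] [CircleAction A] [CStarAlgebra B]
    [CircleAction B] {m n : ℤ} {a : A} {b : B} (ha : IsHomogeneous m a) (hb : IsHomogeneous n b) :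
    j₂ ζ A B b * j₁ ζ A B a = ((ζ ^ (-(m * n)) : Circle) : ℂ) • (j₁ ζ A B a * j₂ ζ A B b) := by
  rw [j₁_mul_j₂ ζ ha hb, smul_smul, ← Circle.coe_mul, ← zpow_add, neg_add_cancel, zpow_zero,
    Circle.coe_one, one_smul]

lemma SURel.map {D E : Type} [CStarAlgebra D] [CStarAlgebra E] {α γ : D} (h : SURel q α γ)
    (f : D →⋆ₐ[ℂ] E) : SURel q (f α) (f γ) where
  star_mul_add := by
    rw [← map_star, ← map_star, ← map_mul, ← map_mul, ← map_add, h.star_mul_add, map_one]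
  mul_star_add := by
    rw [← map_star, ← map_star, ← map_mul, ← map_mul, ← map_smul, ← map_add, h.mul_star_add,
      map_one]
  mul_comm_smul := by rw [← map_mul, ← map_mul, ← map_smul, h.mul_comm_smul]
  normal := by rw [← map_star, ← map_mul, ← map_mul, h.normal]

/-- The image `j₁(α) j₂(α) - q j₁(γ*) j₂(γ)` of `α` under the coproduct. -/
def deltaAlpha : SU2SU q :=
  j₁ _ _ _ (alpha q) * j₂ _ _ _ (alpha q) - q • (j₁ _ _ _ (star (gamma q)) * j₂ _ _ _ (gamma q))

/-- The image `j₁(γ) j₂(α) + j₁(α*) j₂(γ)` of `γ` under the coproduct. -/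
def deltaGamma : SU2SU q :=
  j₁ _ _ _ (gamma q) * j₂ _ _ _ (alpha q) + j₁ _ _ _ (star (alpha q)) * j₂ _ _ _ (gamma q)

lemma deltaRel : SURel q (deltaAlpha q) (deltaGamma q) := by
  have ha := alpha_homogeneous q
  have hc := gamma_homogeneous q
  have key := fun {m n : ℤ} {a b : SUq2 q} (h : IsHomogeneous m a) (h' : IsHomogeneous n b) =>
    j₂_mul_j₁ (zeta q) h h'
  rw [deltaAlpha, deltaGamma, map_star, map_star]
  refine SURel.coproduct (ζ' := (((zeta q)⁻¹ : Circle) : ℂ)) (conj_mul_zeta q) (mul_zeta_inv q)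
    ((suRel q).map q (j₁ _ _ _).toStarAlgHom) ((suRel q).map q (j₂ _ _ _).toStarAlgHom)
    ?_ ?_ ?_ ?_ ?_ ?_ ?_ ?_ ?_ ?_ ?_ ?_ ?_ ?_ ?_ ?_ <;> try simp only [← map_star]
  · simpa using key ha ha
  · simpa using key ha.star ha
  · simpa using key ha ha.star
  · simpa using key ha.star ha.star
  · simpa using key hc ha
  · simpa using key hc.star ha
  · simpa using key hc ha.star
  · simpa using key hc.star ha.star
  · simpa using key ha hc
  · simpa using key ha.star hc
  · simpa using key ha hc.star
  · simpa using key ha.star hc.star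
  · simpa using key hc hc
  · simpa using key hc.star hc
  · simpa using key hc hc.star
  · simpa using key hc.star hc.star

/-- The coproduct `Δ : C(SU_q(2)) → C(SU_q(2)) ⊠_ζ C(SU_q(2))`. -/
def Delta : TMor (SUq2 q) (SU2SU q) where
  toStarAlgHom := suLift (deltaRel q)
  equivariant z x := by
    refine su_hom_ext (f := (suLift (deltaRel q)).comp (act z))
      (g := (act z).comp (suLift (deltaRel q))) ?_ ?_ x
    · simp only [StarAlgHom.comp_apply, act_alpha, suLift_alpha, deltaAlpha, map_sub, map_smul,
        map_mul, ← TMor.equivariant, map_star, act_gamma, star_smul, smul_mul_smul_comm]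
      rw [← starRingEnd_apply, ← Circle.coe_inv_eq_conj, ← Circle.coe_mul, inv_mul_cancel,
        Circle.coe_one, one_smul]
    · simp only [StarAlgHom.comp_apply, act_gamma, suLift_gamma, deltaGamma, map_add, map_smul,
        map_mul, ← TMor.equivariant, map_star, act_alpha, smul_mul_assoc, mul_smul_comm, smul_add]

/-- The trivial action of the circle on `C(𝕋)`. -/
instance : CircleAction C(Circle, ℂ) where
  act _ := StarAlgHom.id ℂ _
  act_one _ := rfl
  act_mul _ _ _ := rfl
  continuous_act _ := continuous_const

/-- The identity function `z` in `C(𝕋)`. -/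
def circleCoord : C(Circle, ℂ) := ⟨fun z => (z : ℂ), continuous_subtype_val⟩

lemma circleRel : SURel q circleCoord 0 := by
  have h : star circleCoord * circleCoord = 1 := by
    ext z
    change conj (z : ℂ) * z = 1
    rw [← Circle.coe_inv_eq_conj, ← Circle.coe_mul, inv_mul_cancel, Circle.coe_one]
  constructor
  · rw [h]; simp
  · rw [mul_comm, h]; simp
  · simp
  · simp

/-- The morphism `π : C(SU_q(2)) → C(𝕋)` with `π(α) = z` and `π(γ) = 0`. -/
def toCircleAlg : TMor (SUq2 q) C(Circle, ℂ) where
  toStarAlgHom := suLift (circleRel q)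
  equivariant z x := by
    refine su_hom_ext (f := (suLift (circleRel q)).comp (act z))
      (g := (act z).comp (suLift (circleRel q))) ?_ ?_ x
    · simp only [StarAlgHom.comp_apply, act_alpha, suLift_alpha]; rfl
    · simp only [StarAlgHom.comp_apply, act_gamma, suLift_gamma, map_smul, smul_zero, map_zero]

/-! ### The quotient sphere -/

/-- The subalgebra of those `a` in `C(SU_q(2))` with `(id ⊠ π)(Δ(a)) = j₁(a)`. -/
def sphere : StarSubalgebra ℂ (SUq2 q) :=
  StarAlgHom.equalizer
    ((BT.map (zeta q) (TMor.id _) (toCircleAlg q)).toStarAlgHom.comp (Delta q).toStarAlgHom)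
    (j₁ (zeta q) (SUq2 q) C(Circle, ℂ)).toStarAlgHom

lemma mem_sphere {a : SUq2 q} : a ∈ sphere q ↔
    BT.map (zeta q) (TMor.id _) (toCircleAlg q) (Delta q a) = j₁ (zeta q) (SUq2 q) C(Circle, ℂ) a :=
  Iff.rfl

instance : IsClosed (sphere q : Set (SUq2 q)) :=
  isClosed_eq (map_continuous ((BT.map (zeta q) (TMor.id _) (toCircleAlg q)).toStarAlgHom.comp
    (Delta q).toStarAlgHom)) (map_continuous (j₁ (zeta q) (SUq2 q) C(Circle, ℂ)).toStarAlgHom)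

/-- The C⋆-algebra `C(S²_q)` of the quotient sphere. -/
def CS2 : Type := ↥(sphere q)

instance : CStarAlgebra (CS2 q) := inferInstanceAs (CStarAlgebra ↥(sphere q))

/-- The inclusion of `C(S²_q)` in `C(SU_q(2))`. -/
def sphereHom : CS2 q →⋆ₐ[ℂ] SUq2 q := (sphere q).subtype

lemma act_mem_sphere (z : Circle) (x : CS2 q) : act z (sphereHom q x) ∈ sphere q := by
  have hx := (mem_sphere q).1 x.2
  rw [mem_sphere, TMor.equivariant, TMor.equivariant, TMor.equivariant]
  exact congrArg _ hx

/-- The action of the circle on `C(S²_q)`, the restriction of the action on `C(SU_q(2))`. -/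
instance : CircleAction (CS2 q) where
  act z := ((act z).comp (sphereHom q)).codRestrict (sphere q) (act_mem_sphere q z)
  act_one x := Subtype.ext (act_one (sphereHom q x))
  act_mul z w x := Subtype.ext (act_mul z w (sphereHom q x))
  continuous_act x := (continuous_act (sphereHom q x)).subtype_mk _

/-- The inclusion of `C(S²_q)` in `C(SU_q(2))` as an equivariant morphism. -/
def sphereIncl : TMor (CS2 q) (SUq2 q) where
  toStarAlgHom := sphereHom q
  equivariant _ _ := rfl

/-- `e` is the canonical identification `(A ⊠ B) ⊠ C = A ⊠ (B ⊠ C)`: it matches the three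
embeddings of `A`, `B` and `C`. There is at most one such `e`. -/
structure IsAssociator (ζ : Circle) {A B C : Type} [CStarAlgebra A] [CircleAction A]
    [CStarAlgebra B] [CircleAction B] [CStarAlgebra C] [CircleAction C]
    (e : BT ζ (BT ζ A B) C ≃⋆ₐ[ℂ] BT ζ A (BT ζ B C)) : Prop where
  fst : ∀ a : A, e (j₁ ζ _ C (j₁ ζ A B a)) = j₁ ζ A _ a
  snd : ∀ b : B, e (j₁ ζ _ C (j₂ ζ A B b)) = j₂ ζ A _ (j₁ ζ B C b)
  trd : ∀ c : C, e (j₂ ζ _ C c) = j₂ ζ A _ (j₂ ζ B C c)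

end BraidedSphere

end

open BraidedSphere

noncomputable section

namespace BraidedSphere

/-! ### States and vector functionals -/

section States

open scoped ComplexOrder

variable {A : Type} [CStarAlgebra A]

/-! The proof rests on a second circle action `rightAction` on C(SU_q(2)), written β below, which
multiplies both α and γ by w. It commutes with ρ, and `Delta_rightAction` says that Δ∘β_w = (id ⊠
β_w)∘Δ. Evaluating the C(𝕋)-leg of (id ⊠ π)∘Δ at w gives j₁∘β_w (`map_evalConst_Delta`). Since j₁ is
injective and the evaluations are jointly injective after id ⊠ -, the quotient sphere is exactly the
fixed point algebra of β (`mem_sphere_iff`).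

Averaging over β gives a projection E onto the sphere, and averaging over id ⊠ β gives E₂ on the
braided square, with E₂(j₁(a)j₂(b)) = j₁(a)j₂(E(b)) and E₂(j₁(a)Δ(b)) = j₁(a)Δ(E(b)). The first
identity shows that E₂ maps into the closed range of id ⊠ ι. For x in the sphere, Δ(x) is fixed by
id ⊠ β, so it lies in that range, and this defines Γ (`coaction`). The second identity deduces the
density of j₁(a)Γ(x) from the density of j₁(a)Δ(b). The latter (`deltaSpan_dense`) holds because
Δ(α), Δ(γ) arise from j₂(α), j₂(γ) by a matrix over j₁(C(SU_q(2))) that has an explicit inverse, and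
similarly for the adjoints.

Ergodicity comes from the character α ↦ 1, γ ↦ 0 on the second leg: it turns Δ(x) into j₁(x) and
j₂(x) into a scalar. Coassociativity of Γ follows from that of Δ, which is checked on generators,
through the injective map id ⊠ (id ⊠ ι) and the naturality of the associator.

Two facts about the minimal tensor product carry the rest. Injectivity of id ⊠ g for injective g is
obtained from slice maps by vector functionals; GNS representations supply enough of these. The
associator exists because both iterated products are minimal threefold products
(`Triple.IsMinimal`): three independent circle actions split them into multidegrees, and on each
multidegree product functionals on the two sides are proportional. So in the closed span of the
diagonal products inside the direct product of the two algebras, both coordinate projections are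
isomorphisms (`Triple.IsMinimal.exists_equiv`). -/

lemma im_eq_zero_of_norm_le_one {g : A →L[ℂ] ℂ} (hg : ‖g‖ ≤ 1) (h1 : g 1 = 1) {a : A}
    (ha : IsSelfAdjoint a) : (g a).im = 0 := by
  have hA : Nontrivial A := ⟨1, 0, fun h => by rw [h, map_zero] at h1; exact zero_ne_one h1⟩
  -- Shift by an imaginary scalar: ‖a + it‖² ≤ ‖a‖² + t² for self-adjoint a, while |g(a + it)|² ≥
  -- (Im g(a) + t)². The t² cancels and a bound linear in t remains.
  have key : ∀ t : ℝ, 2 * (g a).im * t ≤ ‖a‖ ^ 2 := by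
    intro t
    set c : ℂ := t * Complex.I with hc
    have hcc : conj c = -c := by simp [hc]
    have hc2 : c * c = -((t ^ 2 : ℝ) : ℂ) := by
      rw [hc]; push_cast; linear_combination (t : ℂ) ^ 2 * Complex.I_mul_I
    have e1 : star (a + c • 1) * (a + c • 1) = a * a + ((t ^ 2 : ℝ) : ℂ) • (1 : A) := by
      rw [star_add, star_smul, star_one, ha.star_eq, ← starRingEnd_apply, hcc]
      simp only [add_mul, mul_add, smul_mul_assoc, mul_smul_comm, one_mul, mul_one]
      have : ((t ^ 2 : ℝ) : ℂ) = -c * c := by rw [neg_mul, hc2, neg_neg]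
      rw [this]
      module
    have e2 : ‖a + c • (1 : A)‖ ^ 2 ≤ ‖a‖ ^ 2 + t ^ 2 := by
      rw [sq, ← CStarRing.norm_star_mul_self, e1]
      refine (norm_add_le _ _).trans (add_le_add ?_ ?_)
      · rw [sq]; exact norm_mul_le _ _
      · rw [norm_smul, CStarRing.norm_one, mul_one, Complex.norm_real, Real.norm_of_nonneg (sq_nonneg t)]
    have e3 : ‖g (a + c • 1)‖ ≤ ‖a + c • (1 : A)‖ :=
      (g.le_opNorm _).trans (mul_le_of_le_one_left (norm_nonneg _) hg)
    have e4 : ‖g (a + c • 1)‖ ^ 2 = (g a).re ^ 2 + ((g a).im + t) ^ 2 := by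
      rw [map_add, map_smul, h1, smul_eq_mul, mul_one, ← Complex.normSq_eq_norm_sq,
        Complex.normSq_apply]
      simp [hc]; ring
    have e5 : ‖g (a + c • 1)‖ ^ 2 ≤ ‖a + c • (1 : A)‖ ^ 2 :=
      pow_le_pow_left₀ (norm_nonneg _) e3 2
    nlinarith [sq_nonneg (g a).re, sq_nonneg (g a).im]
  by_contra h
  -- This t makes the left side of `key` equal to ‖a‖² + 1.
  have := key ((‖a‖ ^ 2 + 1) / (2 * (g a).im))
  rw [mul_div_cancel₀ _ (mul_ne_zero two_ne_zero h)] at this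
  linarith

/-- A functional of norm at most one with `g 1 = 1` is positive. -/
lemma nonneg_of_norm_le_one [PartialOrder A] [StarOrderedRing A] {g : A →L[ℂ] ℂ} (hg : ‖g‖ ≤ 1)
    (h1 : g 1 = 1) {a : A} (ha : 0 ≤ a) : 0 ≤ g a := by
  have hA : Nontrivial A := ⟨1, 0, fun h => by rw [h, map_zero] at h1; exact zero_ne_one h1⟩
  have him := im_eq_zero_of_norm_le_one hg h1 (IsSelfAdjoint.of_nonneg ha)
  -- From 0 ≤ a ≤ ‖a‖1 the element ‖a‖1 - a has norm at most ‖a‖, so g(a) lies in the disc of radius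
  -- ‖a‖ about ‖a‖, hence in the right half-plane.
  have h2 : ‖algebraMap ℝ A ‖a‖ - a‖ ≤ ‖a‖ := by
    have h3 : a ≤ algebraMap ℝ A ‖a‖ := (IsSelfAdjoint.of_nonneg ha).le_algebraMap_norm_self
    have h4 := CStarAlgebra.norm_le_norm_of_nonneg_of_le (sub_nonneg.2 h3)
      (sub_le_self (algebraMap ℝ A ‖a‖) ha)
    refine h4.trans_eq ?_
    rw [norm_algebraMap', Real.norm_of_nonneg (norm_nonneg _)]
  have h3 : ‖g (algebraMap ℝ A ‖a‖ - a)‖ ≤ ‖a‖ :=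
    ((g.le_opNorm _).trans (mul_le_of_le_one_left (norm_nonneg _) hg)).trans h2
  have h4 : g (algebraMap ℝ A ‖a‖ - a) = ‖a‖ - g a := by
    have : algebraMap ℝ A ‖a‖ = ((‖a‖ : ℝ) : ℂ) • (1 : A) := by
      rw [Algebra.algebraMap_eq_smul_one, Complex.coe_smul]
    rw [map_sub, this, map_smul, h1, smul_eq_mul, mul_one]
  rw [h4] at h3
  have h5 := (Complex.abs_re_le_norm _).trans h3
  rw [Complex.sub_re, Complex.ofReal_re] at h5
  rw [Complex.nonneg_iff]
  exact ⟨by linarith [(abs_le.1 h5).2], him.symm⟩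

/-- There is a state that attains the norm of a given nonzero positive element. -/
lemma exists_state [PartialOrder A] [StarOrderedRing A] {h : A} (hh : 0 ≤ h) (h0 : h ≠ 0) :
    ∃ f : A →ₚ[ℂ] ℂ, f 1 = 1 ∧ f h = ‖h‖ := by
  have hA : Nontrivial A := ⟨h, 0, h0⟩
  have hpos : 0 < ‖h‖ := norm_pos_iff.2 h0
  -- The norming functional is taken at ‖h‖1 + h instead of h. That element has norm at least 2‖h‖,
  -- so ‖h‖g(1) + g(h) can reach it only if g(1) = 1 and g(h) = ‖h‖ both hold.
  set x : A := ((‖h‖ : ℝ) : ℂ) • (1 : A) + h with hx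
  have hxn : 2 * ‖h‖ ≤ ‖x‖ := by
    have h1 := CStarAlgebra.norm_mem_spectrum_of_nonneg hh
    have h2 : ‖h‖ + ‖h‖ ∈ spectrum ℝ x := by
      have : x = algebraMap ℝ A ‖h‖ + h := by
        rw [hx, Algebra.algebraMap_eq_smul_one, Complex.coe_smul]
      rw [this]
      exact spectrum.add_mem_add_iff.2 h1
    have h3 := spectrum.norm_le_norm_of_mem h2
    rw [Real.norm_of_nonneg (by positivity)] at h3
    linarith
  obtain ⟨g, hg, hgx⟩ := exists_dual_vector ℂ x (by linarith)
  have n1 : ‖g 1‖ ≤ 1 := by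
    have := g.le_opNorm 1
    rwa [hg, CStarRing.norm_one, mul_one] at this
  have n2 : ‖g h‖ ≤ ‖h‖ := by
    have := g.le_opNorm h
    rwa [hg, one_mul] at this
  have e1 : (‖h‖ : ℂ) * g 1 + g h = ‖x‖ := by
    refine Eq.trans ?_ hgx
    rw [hx, map_add, map_smul, smul_eq_mul]
  have r1 : (g 1).re ≤ 1 := (Complex.re_le_norm _).trans n1
  have r2 : (g h).re ≤ ‖h‖ := (Complex.re_le_norm _).trans n2
  have e2 := congrArg Complex.re e1
  rw [Complex.add_re, Complex.re_ofReal_mul, Complex.ofReal_re] at e2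
  have r1' : (g 1).re = 1 := by nlinarith
  have r2' : (g h).re = ‖h‖ := by nlinarith
  have aux : ∀ (z : ℂ) (r : ℝ), z.re = r → ‖z‖ ≤ r → z = r := by
    intro z r h1 h2
    have h3 : z.re ^ 2 + z.im ^ 2 ≤ r ^ 2 := by
      have := pow_le_pow_left₀ (norm_nonneg z) h2 2
      rw [← Complex.normSq_eq_norm_sq, Complex.normSq_apply] at this
      linarith
    rw [h1] at h3
    exact Complex.ext h1 (by
      rw [Complex.ofReal_im]; exact pow_eq_zero_iff two_ne_zero |>.1 (by nlinarith [sq_nonneg z.im]))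
  have g1 : g 1 = 1 := by simpa using aux _ 1 r1' n1
  have g2 : g h = ‖h‖ := aux _ _ r2' n2
  exact ⟨PositiveLinearMap.mk₀ (g : A →ₗ[ℂ] ℂ) fun a ha => nonneg_of_norm_le_one hg.le g1 ha,
    g1, g2⟩

/-- A representation on a Hilbert space and a unit vector at which a given element attains its
norm. -/
theorem exists_rep {a : A} (ha : a ≠ 0) : ∃ (H : Type) (_ : NormedAddCommGroup H)
    (_ : InnerProductSpace ℂ H) (_ : CompleteSpace H) (π : A →⋆ₐ[ℂ] (H →L[ℂ] H)) (ξ : H),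
    ‖ξ‖ = 1 ∧ ‖π a ξ‖ = ‖a‖ := by
  let _ := CStarAlgebra.spectralOrder A
  let _ := CStarAlgebra.spectralOrderedRing A
  -- The state attains the norm of a⋆a, so the GNS vector ξ of 1 satisfies ‖π(a)ξ‖² = f(a⋆a) = ‖a‖².
  obtain ⟨f, hf1, hf2⟩ := exists_state (star_mul_self_nonneg a)
    (fun h => ha ((CStarRing.star_mul_self_eq_zero_iff a).1 h))
  refine ⟨f.GNS, inferInstance, inferInstance, inferInstance, f.gnsStarAlgHom,
    ((f.toPreGNS 1 : f.PreGNS) : f.GNS), ?_, ?_⟩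
  · rw [UniformSpace.Completion.norm_coe, f.preGNS_norm_def, f.ofPreGNS_toPreGNS, star_one,
      mul_one, hf1]
    simp
  · have : f.gnsStarAlgHom a ((f.toPreGNS 1 : f.PreGNS) : f.GNS) =
        ((f.toPreGNS a : f.PreGNS) : f.GNS) := by
      rw [PositiveLinearMap.gnsStarAlgHom_apply]
      refine (f.gnsNonUnitalStarAlgHom_apply_coe (a := a) (b := f.toPreGNS 1)).trans ?_
      rw [f.leftMulMapPreGNS_apply]
      simp
    rw [this, UniformSpace.Completion.norm_coe, f.preGNS_norm_def, f.ofPreGNS_toPreGNS, hf2,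
      Complex.ofReal_re, CStarRing.norm_star_mul_self, Real.sqrt_mul_self (norm_nonneg a)]

/-- Vector functionals `a ↦ ⟪η, π(a) ξ⟫` of representations on Hilbert spaces. -/
def IsCoef (φ : A →L[ℂ] ℂ) : Prop :=
  ∃ (H : Type) (_ : NormedAddCommGroup H) (_ : InnerProductSpace ℂ H) (_ : CompleteSpace H)
    (π : A →⋆ₐ[ℂ] (H →L[ℂ] H)) (ξ η : H), ∀ a, φ a = inner ℂ η (π a ξ)

lemma exists_isCoef {H : Type} [NormedAddCommGroup H] [InnerProductSpace ℂ H] [CompleteSpace H]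
    (π : A →⋆ₐ[ℂ] (H →L[ℂ] H)) (ξ η : H) :
    ∃ φ : A →L[ℂ] ℂ, IsCoef φ ∧ ∀ a, φ a = inner ℂ η (π a ξ) := by
  let πL : A →L[ℂ] (H →L[ℂ] H) := ⟨(π : A →ₗ[ℂ] (H →L[ℂ] H)), map_continuous π⟩
  let φ : A →L[ℂ] ℂ :=
    (innerSL ℂ η).comp ((ContinuousLinearMap.apply ℂ H ξ).comp πL)
  have h : ∀ a, φ a = inner ℂ η (π a ξ) := fun _ => rfl
  exact ⟨φ, ⟨H, inferInstance, inferInstance, inferInstance, π, ξ, η, h⟩, h⟩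

lemma IsCoef.comp {B : Type} [CStarAlgebra B] {φ : A →L[ℂ] ℂ} (hφ : IsCoef φ) (f : B →⋆ₐ[ℂ] A) :
    ∃ ψ : B →L[ℂ] ℂ, IsCoef ψ ∧ ∀ b, ψ b = φ (f b) := by
  obtain ⟨H, _, _, _, π, ξ, η, h⟩ := hφ
  obtain ⟨ψ, hψ, e⟩ := exists_isCoef (π.comp f) ξ η
  exact ⟨ψ, hψ, fun b => (e b).trans (h (f b)).symm⟩

/-- The vector functionals separate the points. -/
lemma exists_isCoef_ne_zero {a : A} (ha : a ≠ 0) : ∃ φ : A →L[ℂ] ℂ, IsCoef φ ∧ φ a ≠ 0 := by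
  obtain ⟨H, _, _, _, π, ξ, -, h⟩ := exists_rep ha
  obtain ⟨φ, hφ, e⟩ := exists_isCoef π ξ (π a ξ)
  refine ⟨φ, hφ, ?_⟩
  rw [e, inner_self_ne_zero, ← norm_ne_zero_iff, h, norm_ne_zero_iff]
  exact ha

/-- Phrased with set membership so that it can serve as a separation hypothesis in
`eq_zero_of_separating`. -/
lemma eq_zero_of_isCoef {a : A} (h : ∀ φ ∈ {φ : A →L[ℂ] ℂ | IsCoef φ}, φ a = 0) : a = 0 := by
  by_contra hne
  obtain ⟨φ, hφ, hn⟩ := exists_isCoef_ne_zero hne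
  exact hn (h φ hφ)

end States

/-! ### Slice maps on the minimal tensor product -/

namespace RepFamily

variable {P : Type} [Ring P] [StarRing P] [Algebra ℂ P] [StarModule ℂ P] (F : RepFamily P)

/-- Bounded linear maps extend to the enveloping C⋆-algebra. -/
lemma exists_extendL {E : Type} [NormedAddCommGroup E] [NormedSpace ℂ E] [CompleteSpace E]
    (g : P →ₗ[ℂ] E) (C : ℝ) (hg : ∀ x, ‖g x‖ ≤ C * F.seminorm x) :
    ∃ G : F.Env →L[ℂ] E, ∀ x, G (F.toEnv x) = g x := by
  let g' : F.Pre →L[ℂ] E := LinearMap.mkContinuous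
    ({ toFun := fun x => g x, map_add' := map_add g, map_smul' := map_smul g } : F.Pre →ₗ[ℂ] E) C
    (fun x => hg x)
  exact ⟨g'.fromCompletion, fun x => g'.fromCompletion_apply_coe (x : F.Pre)⟩

/-- An element that is killed by all homomorphisms of the family is zero. -/
lemma eq_zero_of_extend {x : F.Env} (h : ∀ (D : Type) [CStarAlgebra D] (f : P →⋆ₐ[ℂ] D)
    (hf : F.Rep D f), F.extend f (F.le_seminorm hf) x = 0) : x = 0 := by
  rw [← norm_le_zero_iff]
  refine le_of_forall_pos_lt_add fun ε hε => ?_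
  -- Every f in the family kills x, so ‖f y‖ is at most the distance from x to y; the supremum over
  -- f is the norm of y in the completion.
  obtain ⟨y, hy⟩ := F.denseRange_coe.exists_dist_lt x (half_pos hε)
  have h1 : F.seminorm y ≤ dist x (F.coe y) := by
    refine F.seminorm_le dist_nonneg fun D _ f hf => ?_
    have h2 := F.extend_toEnv f (F.le_seminorm hf) y
    rw [← h2, dist_comm, dist_eq_norm]
    have h3 := NonUnitalStarAlgHom.norm_apply_le (F.extend f (F.le_seminorm hf)) (F.coe y - x)
    rwa [map_sub, h D f hf, sub_zero] at h3
  rw [← F.norm_coe] at h1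
  have h4 : ‖x‖ ≤ dist x (F.coe y) + ‖F.coe y‖ := by
    rw [dist_eq_norm]
    simpa using norm_add_le (x - F.coe y) (F.coe y)
  linarith

end RepFamily

section Slice

open UniformSpace

variable {A B : Type} [CStarAlgebra A] [CStarAlgebra B]

lemma dense_span_mtmul :
    Dense (Submodule.span ℂ {x : MinTensor A B | ∃ a b, x = mtmul a b} : Set (MinTensor A B)) := by
  refine (spatialFamily A B).denseRange_coe.mono ?_
  rintro _ ⟨x, rfl⟩
  change (spatialFamily A B).toEnv x ∈ Submodule.span ℂ _
  induction x using TensorProduct.induction_on with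
  | zero => rw [map_zero]; exact Submodule.zero_mem _
  | add a b ha hb => rw [map_add]; exact Submodule.add_mem _ ha hb
  | tmul a b => exact Submodule.subset_span ⟨a, b, rfl⟩

lemma MinTensor.clm_ext {E : Type} [NormedAddCommGroup E] [NormedSpace ℂ E]
    {f g : MinTensor A B →L[ℂ] E} (h : ∀ a b, f (mtmul a b) = g (mtmul a b)) : f = g :=
  ContinuousLinearMap.ext_on dense_span_mtmul (by rintro _ ⟨a, b, rfl⟩; exact h a b)

/-! ### Product representations and their matrix coefficients -/

section Rep

variable {H K : Type} [NormedAddCommGroup H] [InnerProductSpace ℂ H] [CompleteSpace H]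
  [NormedAddCommGroup K] [InnerProductSpace ℂ K] [CompleteSpace K]

lemma tensorRep_tmul_apply (π : A →⋆ₐ[ℂ] (H →L[ℂ] H)) (σ : B →⋆ₐ[ℂ] (K →L[ℂ] K)) (a : A) (b : B)
    (ξ : H) (k : K) :
    tensorRep π σ (a ⊗ₜ b) ((ξ ⊗ₜ[ℂ] k : H ⊗[ℂ] K) : HTensor H K) =
      ((π a ξ ⊗ₜ[ℂ] σ b k : H ⊗[ℂ] K) : HTensor H K) := by
  rw [tensorRep_tmul]
  simp [ampLeft, ampRight]

/-- The extension of `π ⊗ σ` to the minimal tensor product. -/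
def minRep (π : A →⋆ₐ[ℂ] (H →L[ℂ] H)) (σ : B →⋆ₐ[ℂ] (K →L[ℂ] K)) :
    MinTensor A B →⋆ₐ[ℂ] (HTensor H K →L[ℂ] HTensor H K) :=
  (spatialFamily A B).extend (D := HTensor H K →L[ℂ] HTensor H K) (tensorRep π σ) fun x =>
    (spatialFamily A B).le_seminorm (D := HTensor H K →L[ℂ] HTensor H K)
      (IsSpatial.mk H K π σ) x

lemma minRep_mtmul (π : A →⋆ₐ[ℂ] (H →L[ℂ] H)) (σ : B →⋆ₐ[ℂ] (K →L[ℂ] K)) (a : A) (b : B)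
    (ξ : H) (k : K) :
    minRep π σ (mtmul a b) ((ξ ⊗ₜ[ℂ] k : H ⊗[ℂ] K) : HTensor H K) =
      ((π a ξ ⊗ₜ[ℂ] σ b k : H ⊗[ℂ] K) : HTensor H K) := by
  rw [← tensorRep_tmul_apply, minRep, mtmul, RepFamily.extend_toEnv]

lemma inner_minRep_mtmul (π : A →⋆ₐ[ℂ] (H →L[ℂ] H)) (σ : B →⋆ₐ[ℂ] (K →L[ℂ] K)) (a : A) (b : B)
    (ξ η : H) (k l : K) :
    inner ℂ ((η ⊗ₜ[ℂ] l : H ⊗[ℂ] K) : HTensor H K)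
      (minRep π σ (mtmul a b) ((ξ ⊗ₜ[ℂ] k : H ⊗[ℂ] K) : HTensor H K)) =
      inner ℂ η (π a ξ) * inner ℂ l (σ b k) := by
  rw [minRep_mtmul, Completion.inner_coe, TensorProduct.inner_tmul]

/-- An operator on the Hilbert space tensor product whose matrix coefficients at elementary tensors
vanish is zero. -/
lemma eq_zero_of_inner_tmul {T : HTensor H K →L[ℂ] HTensor H K}
    (h : ∀ (ξ η : H) (k l : K), inner ℂ ((η ⊗ₜ[ℂ] l : H ⊗[ℂ] K) : HTensor H K)
      (T ((ξ ⊗ₜ[ℂ] k : H ⊗[ℂ] K) : HTensor H K)) = 0) : T = 0 := by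
  have h1 : ∀ x y : HTensor H K, inner ℂ y (T x) = 0 := by
    intro x y
    induction x, y using Completion.induction_on₂ with
    | hp => apply isClosed_eq <;> fun_prop
    | ih x y =>
      induction x using TensorProduct.induction_on with
      | zero => rw [Completion.coe_zero, map_zero, inner_zero_right]
      | add a b ha hb => rw [Completion.coe_add, map_add, inner_add_right, ha, hb, add_zero]
      | tmul ξ k =>
        induction y using TensorProduct.induction_on with
        | zero => rw [Completion.coe_zero, inner_zero_left]
        | add c d hc hd => rw [Completion.coe_add, inner_add_left, hc, hd, add_zero]
        | tmul η l => exact h ξ η k l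
  ext x
  exact inner_self_eq_zero (𝕜 := ℂ) |>.1 (h1 x _)

end Rep

/-- The product of two vector functionals, as a vector functional on the minimal tensor product. -/
lemma IsCoef.tensor {φ : A →L[ℂ] ℂ} {ψ : B →L[ℂ] ℂ} (hφ : IsCoef φ) (hψ : IsCoef ψ) :
    ∃ ω : MinTensor A B →L[ℂ] ℂ, IsCoef ω ∧ ∀ a b, ω (mtmul a b) = φ a * ψ b := by
  obtain ⟨H, _, _, _, π, ξ, η, h⟩ := hφ
  obtain ⟨K, _, _, _, σ, k, l, h'⟩ := hψ
  obtain ⟨ω, hω, e⟩ := exists_isCoef (minRep π σ) ((ξ ⊗ₜ[ℂ] k : H ⊗[ℂ] K) : HTensor H K)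
    ((η ⊗ₜ[ℂ] l : H ⊗[ℂ] K) : HTensor H K)
  exact ⟨ω, hω, fun a b => by rw [e, inner_minRep_mtmul, h, h']⟩

/-- An element on which all products of vector functionals vanish is zero. -/
lemma eq_zero_of_coef_tensor {x : MinTensor A B} (h : ∀ (φ : A →L[ℂ] ℂ) (ψ : B →L[ℂ] ℂ), IsCoef φ →
    IsCoef ψ → ∀ ω : MinTensor A B →L[ℂ] ℂ, (∀ a b, ω (mtmul a b) = φ a * ψ b) → ω x = 0) :
    x = 0 := by
  refine (spatialFamily A B).eq_zero_of_extend ?_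
  rintro _ _ _ ⟨H, K, π, σ⟩
  change minRep π σ x = 0
  refine eq_zero_of_inner_tmul fun ξ η k l => ?_
  obtain ⟨φ, hφ, e⟩ := exists_isCoef π ξ η
  obtain ⟨ψ, hψ, e'⟩ := exists_isCoef σ k l
  obtain ⟨ω, hω, e''⟩ := exists_isCoef (minRep π σ) ((ξ ⊗ₜ[ℂ] k : H ⊗[ℂ] K) : HTensor H K)
    ((η ⊗ₜ[ℂ] l : H ⊗[ℂ] K) : HTensor H K)
  rw [← e'']
  exact h φ ψ hφ hψ ω fun a b => by rw [e'', inner_minRep_mtmul, e, e']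

/-- The slice map `a ⊗ b ↦ φ(a) b`. -/
lemma IsCoef.exists_slice_right {φ : A →L[ℂ] ℂ} (hφ : IsCoef φ) :
    ∃ R : MinTensor A B →L[ℂ] B, ∀ a b, R (mtmul a b) = φ a • b := by
  obtain ⟨H, _, _, _, π, ξ, η, h⟩ := hφ
  let r : A ⊗[ℂ] B →ₗ[ℂ] B :=
    TensorProduct.lift ((LinearMap.lsmul ℂ B).comp (φ : A →ₗ[ℂ] ℂ))
  have hr : ∀ a b, r (a ⊗ₜ b) = φ a • b := fun _ _ => rfl
  obtain ⟨R, hR⟩ := (spatialFamily A B).exists_extendL r (‖η‖ * ‖ξ‖) fun x => by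
    by_cases h0 : r x = 0
    · rw [h0, norm_zero]
      exact mul_nonneg (by positivity) (RepFamily.seminorm_nonneg _ _)
    -- Boundedness of the slice for the spatial norm: σ and the unit vector k are chosen so that
    -- r(x) attains its norm at k. The coefficient of r(x) at (k, l) is the coefficient of (π ⊗
    -- σ)(x) at (ξ ⊗ k, η ⊗ l), and Cauchy–Schwarz with l = σ(r x)k gives ‖r x‖ ≤ ‖η‖‖ξ‖‖(π ⊗
    -- σ)(x)‖.
    obtain ⟨K, _, _, _, σ, k, hk, e⟩ := exists_rep h0
    have key : ∀ (l : K) (y : A ⊗[ℂ] B), inner ℂ l (σ (r y) k) =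
        inner ℂ ((η ⊗ₜ[ℂ] l : H ⊗[ℂ] K) : HTensor H K)
          (tensorRep π σ y ((ξ ⊗ₜ[ℂ] k : H ⊗[ℂ] K) : HTensor H K)) := by
      intro l y
      induction y using TensorProduct.induction_on with
      | zero => simp
      | add a b ha hb =>
        simp only [map_add, add_apply, inner_add_right, ha, hb]
      | tmul a b =>
        rw [tensorRep_tmul_apply, Completion.inner_coe, TensorProduct.inner_tmul, ← h, hr,
          map_smul, smul_apply, inner_smul_right]
    have hn : ‖tensorRep π σ x‖ ≤ (spatialFamily A B).seminorm x :=
      (spatialFamily A B).le_seminorm (IsSpatial.mk H K π σ) x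
    have h1 : ‖r x‖ * ‖r x‖ ≤ (‖η‖ * ‖r x‖) * (‖tensorRep π σ x‖ * ‖ξ‖) := by
      have h2 := norm_inner_le_norm (𝕜 := ℂ) ((η ⊗ₜ[ℂ] σ (r x) k : H ⊗[ℂ] K) : HTensor H K)
        (tensorRep π σ x ((ξ ⊗ₜ[ℂ] k : H ⊗[ℂ] K) : HTensor H K))
      rw [← key, inner_self_eq_norm_sq_to_K, e, Completion.norm_coe, TensorProduct.norm_tmul, e,
        ← RCLike.ofReal_pow, RCLike.norm_ofReal, abs_of_nonneg (by positivity), sq] at h2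
      refine h2.trans (mul_le_mul_of_nonneg_left ?_ (by positivity))
      refine (ContinuousLinearMap.le_opNorm _ _).trans_eq ?_
      rw [Completion.norm_coe, TensorProduct.norm_tmul, hk, mul_one]
    have h3 : 0 < ‖r x‖ := norm_pos_iff.2 h0
    have h4 : ‖r x‖ ≤ ‖η‖ * ‖ξ‖ * ‖tensorRep π σ x‖ := by
      refine le_of_mul_le_mul_right (h1.trans_eq ?_) h3
      ring
    exact h4.trans (mul_le_mul_of_nonneg_left hn (by positivity))
  exact ⟨R, fun a b => hR _⟩

/-- The slice map `a ⊗ b ↦ ψ(b) a`. -/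
lemma IsCoef.exists_slice_left {ψ : B →L[ℂ] ℂ} (hψ : IsCoef ψ) :
    ∃ L : MinTensor A B →L[ℂ] A, ∀ a b, L (mtmul a b) = ψ b • a := by
  obtain ⟨K, _, _, _, σ, k, l, h⟩ := hψ
  let r : A ⊗[ℂ] B →ₗ[ℂ] A :=
    TensorProduct.lift ((LinearMap.lsmul ℂ A).comp (ψ : B →ₗ[ℂ] ℂ)).flip
  have hr : ∀ a b, r (a ⊗ₜ b) = ψ b • a := fun _ _ => rfl
  obtain ⟨L, hL⟩ := (spatialFamily A B).exists_extendL r (‖l‖ * ‖k‖) fun x => by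
    by_cases h0 : r x = 0
    · rw [h0, norm_zero]
      exact mul_nonneg (by positivity) (RepFamily.seminorm_nonneg _ _)
    obtain ⟨H, _, _, _, π, ξ, hξ, e⟩ := exists_rep h0
    have key : ∀ (η : H) (y : A ⊗[ℂ] B), inner ℂ η (π (r y) ξ) =
        inner ℂ ((η ⊗ₜ[ℂ] l : H ⊗[ℂ] K) : HTensor H K)
          (tensorRep π σ y ((ξ ⊗ₜ[ℂ] k : H ⊗[ℂ] K) : HTensor H K)) := by
      intro η y
      induction y using TensorProduct.induction_on with
      | zero => simp
      | add a b ha hb =>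
        simp only [map_add, add_apply, inner_add_right, ha, hb]
      | tmul a b =>
        rw [tensorRep_tmul_apply, Completion.inner_coe, TensorProduct.inner_tmul, ← h, hr,
          map_smul, smul_apply, inner_smul_right, mul_comm]
    have hn : ‖tensorRep π σ x‖ ≤ (spatialFamily A B).seminorm x :=
      (spatialFamily A B).le_seminorm (IsSpatial.mk H K π σ) x
    have h1 : ‖r x‖ * ‖r x‖ ≤ (‖r x‖ * ‖l‖) * (‖tensorRep π σ x‖ * ‖k‖) := by
      have h2 := norm_inner_le_norm (𝕜 := ℂ) ((π (r x) ξ ⊗ₜ[ℂ] l : H ⊗[ℂ] K) : HTensor H K)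
        (tensorRep π σ x ((ξ ⊗ₜ[ℂ] k : H ⊗[ℂ] K) : HTensor H K))
      rw [← key, inner_self_eq_norm_sq_to_K, e, Completion.norm_coe, TensorProduct.norm_tmul, e,
        ← RCLike.ofReal_pow, RCLike.norm_ofReal, abs_of_nonneg (by positivity), sq] at h2
      refine h2.trans (mul_le_mul_of_nonneg_left ?_ (by positivity))
      refine (ContinuousLinearMap.le_opNorm _ _).trans_eq ?_
      rw [Completion.norm_coe, TensorProduct.norm_tmul, hξ, one_mul]
    have h3 : 0 < ‖r x‖ := norm_pos_iff.2 h0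
    have h4 : ‖r x‖ ≤ ‖l‖ * ‖k‖ * ‖tensorRep π σ x‖ := by
      refine le_of_mul_le_mul_right (h1.trans_eq ?_) h3
      ring
    exact h4.trans (mul_le_mul_of_nonneg_left hn (by positivity))
  exact ⟨L, fun a b => hL _⟩

/-- An element all of whose slices by vector functionals vanish is zero. -/
lemma eq_zero_of_slice_right {x : MinTensor A B} (h : ∀ φ : A →L[ℂ] ℂ, IsCoef φ →
    ∀ R : MinTensor A B →L[ℂ] B, (∀ a b, R (mtmul a b) = φ a • b) → R x = 0) : x = 0 := by
  refine eq_zero_of_coef_tensor fun φ ψ hφ hψ ω hω => ?_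
  obtain ⟨R, hR⟩ := hφ.exists_slice_right (B := B)
  have : ω = ψ.comp R := MinTensor.clm_ext fun a b => by
    rw [hω, ContinuousLinearMap.comp_apply, hR, map_smul, smul_eq_mul]
  rw [this, ContinuousLinearMap.comp_apply, h φ hφ R hR, map_zero]

/-- If the vector functionals in `S` separate the points of `A` and those in `S'` the points of
`B`, their products separate the points of the minimal tensor product. -/
theorem eq_zero_of_separating {S : Set (A →L[ℂ] ℂ)} {S' : Set (B →L[ℂ] ℂ)}
    (hS : ∀ φ ∈ S, IsCoef φ) (sep : ∀ a, (∀ φ ∈ S, φ a = 0) → a = 0)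
    (hS' : ∀ ψ ∈ S', IsCoef ψ) (sep' : ∀ b, (∀ ψ ∈ S', ψ b = 0) → b = 0)
    {x : MinTensor A B} (h : ∀ φ ∈ S, ∀ ψ ∈ S', ∀ ω : MinTensor A B →L[ℂ] ℂ, IsCoef ω →
      (∀ a b, ω (mtmul a b) = φ a * ψ b) → ω x = 0) : x = 0 := by
  refine eq_zero_of_coef_tensor fun φ' ψ' hφ' hψ' ω hω => ?_
  -- A Fubini argument replaces arbitrary functionals by those in S and S' one leg at a time. For φ
  -- in S the slice of x by φ is killed by S', hence zero, so φ(L x) = ψ'(R x) = 0; as φ varies in S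
  -- this gives L x = 0.
  obtain ⟨L, hL⟩ := hψ'.exists_slice_left (A := A)
  have h1 : L x = 0 := by
    refine sep _ fun φ hφ => ?_
    obtain ⟨R, hR⟩ := (hS φ hφ).exists_slice_right (B := B)
    have h2 : R x = 0 := sep' _ fun ψ hψ => by
      obtain ⟨ω', hω', e⟩ := (hS φ hφ).tensor (hS' ψ hψ)
      have e' : ω' = ψ.comp R := MinTensor.clm_ext fun a b => by
        rw [e, ContinuousLinearMap.comp_apply, hR, map_smul, smul_eq_mul]
      rw [← ContinuousLinearMap.comp_apply, ← e']
      exact h φ hφ ψ hψ ω' hω' e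
    have h3 : φ.comp L = ψ'.comp R := MinTensor.clm_ext fun a b => by
      simp only [ContinuousLinearMap.comp_apply, hR, hL, map_smul, smul_eq_mul, mul_comm]
    rw [← ContinuousLinearMap.comp_apply, h3, ContinuousLinearMap.comp_apply, h2, map_zero]
  have : ω = φ'.comp L := MinTensor.clm_ext fun a b => by
    rw [hω, ContinuousLinearMap.comp_apply, hL, map_smul, smul_eq_mul, mul_comm]
  rw [this, ContinuousLinearMap.comp_apply, h1, map_zero]

/-- If the homomorphisms `g i` are jointly injective, so are the `id ⊗ g i`. -/
theorem MinTensor.map_id_jointly_injective {ι : Type} {B' : ι → Type} [∀ i, CStarAlgebra (B' i)]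
    (g : ∀ i, B →⋆ₐ[ℂ] B' i) (hg : ∀ b, (∀ i, g i b = 0) → b = 0) {x : MinTensor A B}
    (h : ∀ i, MinTensor.map (StarAlgHom.id ℂ A) (g i) x = 0) : x = 0 := by
  -- Slicing off the first leg commutes with g i on the second, so each g i kills each slice of x.
  refine eq_zero_of_slice_right fun φ hφ R hR => hg _ fun i => ?_
  obtain ⟨R', hR'⟩ := hφ.exists_slice_right (B := B' i)
  let G : B →L[ℂ] B' i := ⟨(g i : B →ₗ[ℂ] B' i), map_continuous (g i)⟩
  let M : MinTensor A B →L[ℂ] MinTensor A (B' i) :=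
    ⟨(MinTensor.map (StarAlgHom.id ℂ A) (g i) : MinTensor A B →ₗ[ℂ] MinTensor A (B' i)),
      map_continuous (MinTensor.map (StarAlgHom.id ℂ A) (g i))⟩
  have e : G.comp R = R'.comp M := MinTensor.clm_ext fun a b => by
    change g i (R (mtmul a b)) = R' (MinTensor.map (StarAlgHom.id ℂ A) (g i) (mtmul a b))
    rw [hR, map_smul, MinTensor.map_mtmul, hR']
    rfl
  have e' : g i (R x) = R' (MinTensor.map (StarAlgHom.id ℂ A) (g i) x) := DFunLike.congr_fun e x
  rw [e', h i, map_zero]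

/-- Vector functionals that do not vanish at a and at b have a product that does not vanish at a ⊗
b. -/
lemma mtmul_eq_zero {a : A} {b : B} (h : mtmul a b = (0 : MinTensor A B)) : a = 0 ∨ b = 0 := by
  by_contra! hne
  obtain ⟨φ, hφ, h1⟩ := exists_isCoef_ne_zero hne.1
  obtain ⟨ψ, hψ, h2⟩ := exists_isCoef_ne_zero hne.2
  obtain ⟨ω, -, e⟩ := hφ.tensor hψ
  have := e a b
  rw [h, map_zero] at this
  exact mul_ne_zero h1 h2 this.symm

end Slice

/-! ### The quantum torus is not zero -/

section Torus

variable {H : Type} [NormedAddCommGroup H] [InnerProductSpace ℂ H] [CompleteSpace H]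

/-- A unitary that sends the basis `b` to the orthonormal family `v` with dense span. -/
lemma exists_unitary_of_orthonormal (b : HilbertBasis ℤ ℂ H) {v : ℤ → H} (hv : Orthonormal ℂ v)
    (hd : ⊤ ≤ (Submodule.span ℂ (Set.range v)).topologicalClosure) :
    ∃ U : unitary (H →L[ℂ] H), ∀ n, (U : H →L[ℂ] H) (b n) = v n := by
  let e : H ≃ₗᵢ[ℂ] H := b.repr.trans (HilbertBasis.mk hv hd).repr.symm
  refine ⟨Unitary.linearIsometryEquiv.symm e, fun n => ?_⟩
  have h1 : (HilbertBasis.mk hv hd) n = v n := congrFun (HilbertBasis.coe_mk hv hd) n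
  change (HilbertBasis.mk hv hd).repr.symm (b.repr (b n)) = v n
  rw [HilbertBasis.repr_self, HilbertBasis.repr_symm_single, h1]

/-- U is the bilateral shift b n ↦ b (n + 1) and V is diagonal with entries μ^(-n); the sign of the
exponent is what gives UV = μVU. -/
lemma exists_torusRel (μ : Circle) (b : HilbertBasis ℤ ℂ H) :
    ∃ s : Fin 2 → (H →L[ℂ] H), (torusRel μ).Rel (H →L[ℂ] H) s := by
  have hspan : ⊤ ≤ (Submodule.span ℂ (Set.range b)).topologicalClosure := b.dense_span.ge
  obtain ⟨U, hU⟩ := exists_unitary_of_orthonormal b (v := fun n => b (n + 1))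
    (b.orthonormal.comp _ (add_left_injective 1)) (by
      have : Set.range (fun n => b (n + 1)) = Set.range b :=
        (Equiv.addRight (1 : ℤ)).surjective.range_comp b
      rwa [this])
  obtain ⟨V, hV⟩ := exists_unitary_of_orthonormal b
    (v := fun n => ((μ ^ (-n) : Circle) : ℂ) • b n) (by
      have h := b.orthonormal
      rw [orthonormal_iff_ite] at h ⊢
      intro i j
      rw [inner_smul_left, inner_smul_right, h i j]
      split_ifs with hij
      · rw [hij, mul_one, ← Circle.coe_inv_eq_conj, ← Circle.coe_mul, inv_mul_cancel,
          Circle.coe_one]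
      · simp) (by
      refine hspan.trans (Submodule.topologicalClosure_mono (Submodule.span_le.2 ?_))
      rintro _ ⟨n, rfl⟩
      have : b n = ((μ ^ n : Circle) : ℂ) • ((μ ^ (-n) : Circle) : ℂ) • b n := by
        rw [smul_smul, ← Circle.coe_mul, ← zpow_add, add_neg_cancel, zpow_zero, Circle.coe_one,
          one_smul]
      rw [this]
      exact Submodule.smul_mem _ _ (Submodule.subset_span ⟨n, rfl⟩))
  refine ⟨![U, V], U.2, V.2, ?_⟩
  refine ContinuousLinearMap.ext_on (s := Set.range b)
    (Submodule.dense_iff_topologicalClosure_eq_top.2 b.dense_span) ?_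
  rintro _ ⟨n, rfl⟩
  change (U : H →L[ℂ] H) ((V : H →L[ℂ] H) (b n)) =
    (μ : ℂ) • (V : H →L[ℂ] H) ((U : H →L[ℂ] H) (b n))
  rw [hV, map_smul, hU, hV, smul_smul, ← Circle.coe_mul, ← zpow_one_add]
  congr 3
  ring

/-- A universal C⋆-algebra could collapse to zero; a representation on ℓ²(ℤ) excludes this. It makes
the monomials u^m v^n nonzero, which the injectivity of j₁ and the product functionals below depend
on. -/
instance (μ : Circle) : Nontrivial (QTorus μ) := by
  let b : HilbertBasis ℤ ℂ (lp (fun _ : ℤ => ℂ) 2) := ⟨LinearIsometryEquiv.refl ℂ _⟩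
  obtain ⟨s, hs⟩ := exists_torusRel μ b
  refine ⟨1, 0, fun h => ?_⟩
  have h1 := congrArg ((torusRel μ).lift s hs) h
  rw [map_one, map_zero] at h1
  have h2 := DFunLike.congr_fun h1 (b 0)
  have h3 := b.orthonormal.1 0
  have h4 : b 0 = 0 := h2
  rw [h4, norm_zero] at h3
  exact zero_ne_one h3

end Torus

/-! ### Spectral projections of circle actions -/

section Spec

variable {D E : Type} [CStarAlgebra D] [CStarAlgebra E]

/-- The projection to the homogeneous elements of degree `n` for the circle action `ρ`. -/
def spec (ρ : CircleAction D) (n : ℤ) : D →L[ℂ] D := (coefL D n).comp (@orbitL D _ ρ)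

lemma spec_homogeneous (ρ : CircleAction D) (n : ℤ) {k : ℤ} {x : D}
    (hx : @IsHomogeneous D _ ρ k x) : spec ρ n x = if n = k then x else 0 := by
  have h := coefL_fourier_smul (@orbitL D _ ρ x) k n x (fun t => by
    rw [orbitL_apply, hx, fourier_apply, AddCircle.toCircle_zsmul])
  refine h.trans ?_
  split_ifs <;> simp

lemma isHomogeneous_spec (ρ : CircleAction D) (n : ℤ) (x : D) :
    @IsHomogeneous D _ ρ n (spec ρ n x) :=
  @isHomogeneous_coefL D _ ρ x n

/-- The components of x are the Fourier coefficients of its orbit map, which is continuous, so it is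
zero if they vanish; its value at the identity is x. -/
lemma eq_zero_of_spec (ρ : CircleAction D) {x : D} (h : ∀ n, spec ρ n x = 0) : x = 0 := by
  have h1 : @orbitL D _ ρ x = 0 := eq_zero_of_coefL _ h
  have h2 := DFunLike.congr_fun h1 0
  rw [orbitL_apply, AddCircle.toCircle_zero, CircleAction.act_one] at h2
  exact h2

/-- The averaging integral commutes with any bounded linear intertwiner. Multiplicativity of f is
not required, and this is used later for maps such as b ↦ j₁(a)j₂(b). -/
lemma map_spec (ρ : CircleAction D) (σ : CircleAction E) (f : D →L[ℂ] E)
    (hf : ∀ z x, f (ρ.act z x) = σ.act z (f x)) (n : ℤ) (x : D) :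
    f (spec ρ n x) = spec σ n (f x) :=
  (coefL_map f (@orbitL D _ ρ x) (@orbitL E _ σ (f x)) (fun _ => (hf _ x).symm) n).symm

/-- A `*`-homomorphism as a bounded linear map. -/
def toCLM (f : D →⋆ₐ[ℂ] E) : D →L[ℂ] E := ⟨(f : D →ₗ[ℂ] E), map_continuous f⟩

@[simp] lemma toCLM_apply (f : D →⋆ₐ[ℂ] E) (x : D) : toCLM f x = f x := rfl

/-- The diagonal action on a product. -/
@[reducible] def prodAction (ρ : CircleAction D) (σ : CircleAction E) : CircleAction (D × E) where
  act z := ((ρ.act z).comp (StarAlgHom.fst ℂ D E)).prod ((σ.act z).comp (StarAlgHom.snd ℂ D E))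
  act_one _ := Prod.ext (ρ.act_one _) (σ.act_one _)
  act_mul z w _ := Prod.ext (ρ.act_mul z w _) (σ.act_mul z w _)
  continuous_act x := (ρ.continuous_act x.1).prodMk (σ.continuous_act x.2)

end Spec

open CircleAction

/-- An action of the circle group by equivariant automorphisms. -/
structure EquivAction (A : Type) [CStarAlgebra A] [CircleAction A] where
  /-- the automorphism by which `z` acts -/
  mor : Circle → TMor A A
  mor_one : ∀ a, mor 1 a = a
  mor_mul : ∀ z w a, mor (z * w) a = mor z (mor w a)
  continuous_mor : ∀ a, Continuous fun z => mor z a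

namespace EquivAction

variable {A B : Type} [CStarAlgebra A] [CircleAction A] [CStarAlgebra B] [CircleAction B]

/-- The underlying circle action. -/
@[reducible] def toAction (S : EquivAction A) : CircleAction A where
  act z := (S.mor z).toStarAlgHom
  act_one := S.mor_one
  act_mul := S.mor_mul
  continuous_act := S.continuous_mor

variable (A) in
/-- The trivial action. -/
def triv : EquivAction A where
  mor _ := TMor.id A
  mor_one _ := rfl
  mor_mul _ _ _ := rfl
  continuous_mor _ := continuous_const

variable (A) in
/-- The given action. -/
def self : EquivAction A where
  mor := actMor A
  mor_one := act_one
  mor_mul := act_mul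
  continuous_mor := continuous_act

/-- The action on a braided tensor product that is given by actions on the factors. -/
def braid (ζ : Circle) (S : EquivAction A) (R : EquivAction B) : EquivAction (BT ζ A B) where
  mor z := BT.map ζ (S.mor z) (R.mor z)
  mor_one x := by
    refine DFunLike.congr_fun (BT.hom_ext ζ (f := BT.mapHom ζ (S.mor 1) (R.mor 1))
      (g := StarAlgHom.id ℂ _) (fun a => ?_) fun b => ?_) x
    · rw [BT.mapHom_incl₁]; exact congrArg _ (S.mor_one a)
    · rw [BT.mapHom_incl₂]; exact congrArg _ (R.mor_one b)
  mor_mul z w x := by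
    refine DFunLike.congr_fun (BT.hom_ext ζ (f := BT.mapHom ζ (S.mor (z * w)) (R.mor (z * w)))
      (g := (BT.mapHom ζ (S.mor z) (R.mor z)).comp (BT.mapHom ζ (S.mor w) (R.mor w)))
      (fun a => ?_) fun b => ?_) x
    · rw [StarAlgHom.comp_apply, BT.mapHom_incl₁, BT.mapHom_incl₁, BT.mapHom_incl₁]
      exact congrArg _ (S.mor_mul z w a)
    · rw [StarAlgHom.comp_apply, BT.mapHom_incl₂, BT.mapHom_incl₂, BT.mapHom_incl₂]
      exact congrArg _ (R.mor_mul z w b)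
  continuous_mor := continuous_of_dense (fun z => (BT.map ζ (S.mor z) (R.mor z)).toStarAlgHom)
    (BT.dense ζ A B) fun x hx => by
    induction hx using Submodule.span_induction with
    | mem x hx =>
      obtain ⟨a, b, rfl⟩ := hx
      simp only [BT.map, map_mul, BT.mapHom_incl₁, BT.mapHom_incl₂]
      exact ((map_continuous _).comp (S.continuous_mor a)).mul
        ((map_continuous _).comp (R.continuous_mor b))
    | zero => simp only [map_zero]; exact continuous_const
    | add x y _ _ hx hy => simp only [map_add]; exact hx.add hy
    | smul c x _ hx => simp only [map_smul]; exact hx.const_smul c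

@[simp] lemma braid_mor_j₁ (ζ : Circle) (S : EquivAction A) (R : EquivAction B) (z : Circle)
    (a : A) : (braid ζ S R).mor z (j₁ ζ A B a) = j₁ ζ A B (S.mor z a) :=
  BT.map_j₁ ζ _ _ a

@[simp] lemma braid_mor_j₂ (ζ : Circle) (S : EquivAction A) (R : EquivAction B) (z : Circle)
    (b : B) : (braid ζ S R).mor z (j₂ ζ A B b) = j₂ ζ A B (R.mor z b) :=
  BT.map_j₂ ζ _ _ b

@[simp] lemma triv_mor (z : Circle) (a : A) : (triv A).mor z a = a := rfl

@[simp] lemma self_mor (z : Circle) (a : A) : (self A).mor z a = act z a := rfl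

lemma toAction_act (S : EquivAction A) (z : Circle) (a : A) : S.toAction.act z a = S.mor z a := rfl

end EquivAction

/-! ### Injectivity for the braided tensor product -/

section BraidedInjective

variable (ζ : Circle) {A B : Type} [CStarAlgebra A] [CircleAction A] [CStarAlgebra B]
  [CircleAction B]

/-- If the morphisms `g i` are jointly injective, so are the `id ⊠ g i`. -/
theorem BT.map_id_jointly_injective {ι : Type} {B' : ι → Type} [∀ i, CStarAlgebra (B' i)]
    [∀ i, CircleAction (B' i)] (g : ∀ i, TMor B (B' i)) (hg : ∀ b, (∀ i, g i b = 0) → b = 0)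
    {x : BT ζ A B} (h : ∀ i, BT.map ζ (TMor.id A) (g i) x = 0) : x = 0 := by
  refine BT.val_injective ζ ?_
  rw [map_zero]
  -- The map id ⊠ g i is the restriction of id ⊗ (id ⊗ g i), so the statement for the minimal tensor
  -- product is applied twice, once for each leg to the left of B.
  refine MinTensor.map_id_jointly_injective (ι := ι)
    (fun i => MinTensor.map (StarAlgHom.id ℂ A) (g i).toStarAlgHom)
    (fun b hb => MinTensor.map_id_jointly_injective (fun i => (g i).toStarAlgHom) hg hb)
    fun i => ?_
  have h1 := congrArg (BT.val ζ A (B' i)) (h i)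
  rw [map_zero] at h1
  exact h1

theorem BT.map_id_injective {B' : Type} [CStarAlgebra B'] [CircleAction B'] (g : TMor B B')
    (hg : Function.Injective g) : Function.Injective (BT.map ζ (TMor.id A) g) := by
  refine (injective_iff_map_eq_zero (BT.map ζ (TMor.id A) g).toStarAlgHom).2 fun x hx => ?_
  exact BT.map_id_jointly_injective ζ (ι := Unit) (fun _ => g)
    (fun b hb => (injective_iff_map_eq_zero g.toStarAlgHom).1 hg b (hb ())) fun _ => hx

lemma coe_unitary_ne_zero {D : Type} [CStarAlgebra D] [Nontrivial D] (w : unitary D) :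
    (w : D) ≠ 0 := fun h => by
  have := Unitary.coe_star_mul_self w
  rw [h, mul_zero] at this
  exact zero_ne_one this

/-- The map j₁ is equivariant, so it suffices to treat the homogeneous components of a. On the
component of degree n it has the value uⁿ ⊗ aₙ ⊗ 1, an elementary tensor whose other two entries are
nonzero. -/
theorem j₁_injective [Nontrivial B] : Function.Injective (j₁ ζ A B) := by
  refine (injective_iff_map_eq_zero (j₁ ζ A B).toStarAlgHom).2 fun a ha => ?_
  refine eq_zero_of_spec (inferInstanceAs (CircleAction A)) fun n => ?_
  have h1 : j₁ ζ A B (spec (inferInstanceAs (CircleAction A)) n a) = 0 := by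
    have := map_spec (inferInstanceAs (CircleAction A)) (inferInstanceAs (CircleAction (BT ζ A B)))
      (toCLM (j₁ ζ A B).toStarAlgHom) (fun z x => (j₁ ζ A B).equivariant z x) n a
    refine this.trans ?_
    rw [toCLM_apply, ha, map_zero]
  have h2 := congrArg (BT.val ζ A B) h1
  have h3 : amb₁ ζ A B (spec (inferInstanceAs (CircleAction A)) n a) = 0 := by
    rw [map_zero] at h2; exact h2
  rw [amb₁_apply ζ (isHomogeneous_spec _ n a), tmul₃] at h3
  rcases mtmul_eq_zero h3 with h4 | h4
  · exact absurd h4 (coe_unitary_ne_zero _)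
  · exact (mtmul_eq_zero h4).resolve_right one_ne_zero

end BraidedInjective

/-! ### Functionals on the braided tensor product -/

section BraidedFunctionals

variable (ζ : Circle) {A B : Type} [CStarAlgebra A] [CircleAction A] [CStarAlgebra B]
  [CircleAction B]

/-- The element `u^m v^n` of the quantum torus. -/
def torusMono (m n : ℤ) : QTorus ζ := ((QTorus.u ζ ^ m * QTorus.v ζ ^ n : unitary _) : QTorus ζ)

/-- Provides the nonzero scalars that `Triple.IsMinimal` asks for. -/
lemma exists_isCoef_torusMono (m n : ℤ) :
    ∃ τ : QTorus ζ →L[ℂ] ℂ, IsCoef τ ∧ τ (torusMono ζ m n) ≠ 0 :=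
  exists_isCoef_ne_zero (coe_unitary_ne_zero _)

/-- On homogeneous elements a product of the two legs is a single elementary tensor of the ambient
algebra, so functionals τ ⊗ φ ⊗ ψ can be evaluated on it factor by factor. -/
lemma val_j₁_mul_j₂ {m n : ℤ} {a : A} {b : B} (ha : IsHomogeneous m a) (hb : IsHomogeneous n b) :
    BT.val ζ A B (j₁ ζ A B a * j₂ ζ A B b) = tmul₃ ζ (torusMono ζ m n) a b := by
  rw [map_mul]
  change amb₁ ζ A B a * amb₂ ζ A B b = _
  rw [amb₁_apply ζ ha, amb₂_apply ζ hb, tmul₃_mul, mul_one, one_mul]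
  rfl

/-- `G` is the functional `τ ⊗ φ ⊗ ψ` on `A ⊠ B`. -/
def IsBraidedProd (τ : QTorus ζ →L[ℂ] ℂ) (φ : A →L[ℂ] ℂ) (ψ : B →L[ℂ] ℂ) (G : BT ζ A B →L[ℂ] ℂ) :
    Prop :=
  IsCoef G ∧ ∀ (m n : ℤ) (a : A) (b : B), IsHomogeneous m a → IsHomogeneous n b →
    G (j₁ ζ A B a * j₂ ζ A B b) = τ (torusMono ζ m n) * (φ a * ψ b)

variable {ζ}

lemma isBraidedProd_of_ambient {τ : QTorus ζ →L[ℂ] ℂ} {φ : A →L[ℂ] ℂ} {ψ : B →L[ℂ] ℂ}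
    {κ : MinTensor A B →L[ℂ] ℂ} {ω : Ambient ζ A B →L[ℂ] ℂ} (hω : IsCoef ω)
    (hκ : ∀ a b, κ (mtmul a b) = φ a * ψ b) (h : ∀ x y, ω (mtmul x y) = τ x * κ y) :
    ∃ G, IsBraidedProd ζ τ φ ψ G ∧ ∀ x, G x = ω (BT.val ζ A B x) := by
  obtain ⟨G, hG, e⟩ := hω.comp (BT.val ζ A B)
  refine ⟨G, ⟨hG, fun m n a b ha hb => ?_⟩, e⟩
  rw [e, val_j₁_mul_j₂ ζ ha hb, tmul₃, h, hκ]

lemma exists_isBraidedProd {τ : QTorus ζ →L[ℂ] ℂ} {φ : A →L[ℂ] ℂ} {ψ : B →L[ℂ] ℂ} (hτ : IsCoef τ)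
    (hφ : IsCoef φ) (hψ : IsCoef ψ) : ∃ G, IsBraidedProd ζ τ φ ψ G := by
  obtain ⟨κ, hκ, eκ⟩ := hφ.tensor hψ
  obtain ⟨ω, hω, eω⟩ := hτ.tensor hκ
  obtain ⟨G, hG, -⟩ := isBraidedProd_of_ambient hω eκ eω
  exact ⟨G, hG⟩

/-- Products of functionals in separating sets separate the points of `A ⊠ B`. -/
theorem BT.eq_zero_of_separating {S : Set (A →L[ℂ] ℂ)} {S' : Set (B →L[ℂ] ℂ)}
    (hS : ∀ φ ∈ S, IsCoef φ) (sep : ∀ a, (∀ φ ∈ S, φ a = 0) → a = 0)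
    (hS' : ∀ ψ ∈ S', IsCoef ψ) (sep' : ∀ b, (∀ ψ ∈ S', ψ b = 0) → b = 0) {x : BT ζ A B}
    (h : ∀ τ, IsCoef τ → ∀ φ ∈ S, ∀ ψ ∈ S', ∀ G, IsBraidedProd ζ τ φ ψ G → G x = 0) : x = 0 := by
  refine BT.val_injective ζ ?_
  rw [map_zero]
  -- The separation theorem is used twice: for the torus leg against A ⊗ B, with all vector
  -- functionals on the torus, and inside A ⊗ B to see that the products φ ⊗ ψ separate there.
  refine BraidedSphere.eq_zero_of_separating (S := {τ | IsCoef τ})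
    (S' := {κ | IsCoef κ ∧ ∃ φ ∈ S, ∃ ψ ∈ S', ∀ a b, κ (mtmul a b) = φ a * ψ b})
    (fun _ hτ => hτ) (fun _ => eq_zero_of_isCoef) (fun _ hκ => hκ.1) (fun y hy => ?_) ?_
  · exact BraidedSphere.eq_zero_of_separating hS sep hS' sep' fun φ hφ ψ hψ κ hκ e =>
      hy κ ⟨hκ, φ, hφ, ψ, hψ, e⟩
  · rintro τ hτ κ ⟨-, φ, hφ, ψ, hψ, eκ⟩ ω hω eω
    obtain ⟨G, hG, e⟩ := isBraidedProd_of_ambient hω eκ eω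
    rw [← e]
    exact h τ hτ φ hφ ψ hψ G hG

end BraidedFunctionals

/-- A bounded linear map that sends a set to a closed subspace sends its closed span there. -/
lemma mem_of_closure_span {E F : Type} [NormedAddCommGroup E] [NormedSpace ℂ E]
    [NormedAddCommGroup F] [NormedSpace ℂ F] (f : E →L[ℂ] F) {N : Submodule ℂ F}
    (hN : IsClosed (N : Set F)) {s : Set E} (h : ∀ x ∈ s, f x ∈ N) {x : E}
    (hx : x ∈ closure (Submodule.span ℂ s : Set E)) : f x ∈ N := by
  refine closure_minimal (t := f ⁻¹' N) ?_ (hN.preimage f.continuous) hx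
  change _ ≤ N.comap (f : E →ₗ[ℂ] F)
  exact Submodule.span_le.2 h

/-- A closed subalgebra that contains the images of the homogeneous elements contains the image. -/
lemma mem_of_homogeneous {A D : Type} [CStarAlgebra A] [CircleAction A] [CStarAlgebra D]
    (f : A →⋆ₐ[ℂ] D) {N : StarSubalgebra ℂ D} (hN : IsClosed (N : Set D))
    (h : ∀ n a, IsHomogeneous n a → f a ∈ N) (a : A) : f a ∈ N :=
  mem_of_closure_span (toCLM f) (N := Subalgebra.toSubmodule N.toSubalgebra) hN
    (by rintro a ⟨n, hn⟩; exact h n a hn) (dense_homogeneous a)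

/-- A closed subalgebra that contains the images of the generators of `A ⊠ B` contains the
image. -/
lemma BT.mem_of_generators {ζ : Circle} {A B D : Type} [CStarAlgebra A] [CircleAction A]
    [CStarAlgebra B] [CircleAction B] [CStarAlgebra D] (f : BT ζ A B →⋆ₐ[ℂ] D)
    {N : StarSubalgebra ℂ D} (hN : IsClosed (N : Set D)) (h₁ : ∀ a, f (j₁ ζ A B a) ∈ N)
    (h₂ : ∀ b, f (j₂ ζ A B b) ∈ N) (x : BT ζ A B) : f x ∈ N := by
  refine mem_of_closure_span (toCLM f) (N := Subalgebra.toSubmodule N.toSubalgebra) hN ?_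
    (BT.dense ζ A B x)
  rintro _ ⟨a, b, rfl⟩
  change f _ ∈ N
  rw [map_mul]
  exact mul_mem (h₁ a) (h₂ b)

/-! ### Threefold braided products -/

/-- Three morphisms to `D` with braided commutation relations, and three actions on `D` that extend
the actions on the factors separately. -/
structure Triple (ζ : Circle) (A B C D : Type) [CStarAlgebra A] [CircleAction A]
    [CStarAlgebra B] [CircleAction B] [CStarAlgebra C] [CircleAction C] [CStarAlgebra D] where
  /-- the morphism on the first factor -/
  iA : A →⋆ₐ[ℂ] D
  /-- the morphism on the second factor -/
  iB : B →⋆ₐ[ℂ] D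
  /-- the morphism on the third factor -/
  iC : C →⋆ₐ[ℂ] D
  ba : ∀ {m n a b}, IsHomogeneous m a → IsHomogeneous n b →
    iB b * iA a = ((ζ ^ (-(m * n)) : Circle) : ℂ) • (iA a * iB b)
  ca : ∀ {m n a c}, IsHomogeneous m a → IsHomogeneous n c →
    iC c * iA a = ((ζ ^ (-(m * n)) : Circle) : ℂ) • (iA a * iC c)
  cb : ∀ {m n b c}, IsHomogeneous m b → IsHomogeneous n c →
    iC c * iB b = ((ζ ^ (-(m * n)) : Circle) : ℂ) • (iB b * iC c)
  /-- the action that extends the action on the first factor -/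
  ρA : CircleAction D
  /-- the action that extends the action on the second factor -/
  ρB : CircleAction D
  /-- the action that extends the action on the third factor -/
  ρC : CircleAction D
  ρA_iA : ∀ z a, ρA.act z (iA a) = iA (act z a)
  ρA_iB : ∀ z b, ρA.act z (iB b) = iB b
  ρA_iC : ∀ z c, ρA.act z (iC c) = iC c
  ρB_iA : ∀ z a, ρB.act z (iA a) = iA a
  ρB_iB : ∀ z b, ρB.act z (iB b) = iB (act z b)
  ρB_iC : ∀ z c, ρB.act z (iC c) = iC c
  ρC_iA : ∀ z a, ρC.act z (iA a) = iA a
  ρC_iB : ∀ z b, ρC.act z (iB b) = iB b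
  ρC_iC : ∀ z c, ρC.act z (iC c) = iC (act z c)

namespace Triple

variable {ζ : Circle} {A B C D D' E : Type} [CStarAlgebra A] [CircleAction A]
  [CStarAlgebra B] [CircleAction B] [CStarAlgebra C] [CircleAction C] [CStarAlgebra D]
  [CStarAlgebra D'] [CStarAlgebra E]

section

variable (t : Triple ζ A B C D)

/-- The products of homogeneous elements of given degrees. -/
def monos (m n k : ℤ) : Set D :=
  {x | ∃ a b c, IsHomogeneous m a ∧ IsHomogeneous n b ∧ IsHomogeneous k c ∧
    x = t.iA a * t.iB b * t.iC c}

/-- The span of the products of homogeneous elements. -/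
def poly : StarSubalgebra ℂ D :=
  spanStar {x | ∃ m n k, x ∈ t.monos m n k}
    ⟨0, 0, 0, 1, 1, 1, .one, .one, .one, by simp only [map_one, mul_one]⟩
    (by
      rintro _ ⟨m, n, k, a, b, c, ha, hb, hc, rfl⟩ _ ⟨m', n', k', a', b', c', ha', hb', hc', rfl⟩
      -- The braided relations restore the order A, B, C at the cost of a scalar; only its existence
      -- matters for the span.
      have : ∃ s : ℂ, t.iA a * t.iB b * t.iC c * (t.iA a' * t.iB b' * t.iC c') =
          s • (t.iA (a * a') * t.iB (b * b') * t.iC (c * c')) := by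
        simp only [mul_assoc, assoc_rule (t.ca ha' hc), assoc_rule (t.cb hb' hc),
          assoc_rule (t.ba ha' hb), smul_mul_assoc, mul_smul_comm, smul_smul, map_mul]
        exact ⟨_, rfl⟩
      obtain ⟨s, hs⟩ := this
      rw [hs]
      exact Submodule.smul_mem _ _ (Submodule.subset_span
        ⟨_, _, _, _, _, _, ha.mul ha', hb.mul hb', hc.mul hc', rfl⟩))
    (by
      rintro _ ⟨m, n, k, a, b, c, ha, hb, hc, rfl⟩
      have : ∃ s : ℂ, star (t.iA a * t.iB b * t.iC c) =
          s • (t.iA (star a) * t.iB (star b) * t.iC (star c)) := by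
        rw [star_mul, star_mul, ← map_star, ← map_star, ← map_star, t.ba ha.star hb.star,
          mul_smul_comm, ← mul_assoc, t.ca ha.star hc.star, smul_mul_assoc, mul_assoc,
          t.cb hb.star hc.star, mul_smul_comm, smul_smul, smul_smul, ← mul_assoc]
        exact ⟨_, rfl⟩
      obtain ⟨s, hs⟩ := this
      rw [hs]
      exact Submodule.smul_mem _ _ (Submodule.subset_span
        ⟨_, _, _, _, _, _, ha.star, hb.star, hc.star, rfl⟩))

/-- The closed linear span of the products of homogeneous elements. -/
def alg : StarSubalgebra ℂ D := t.poly.topologicalClosure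

lemma isClosed_alg : IsClosed (t.alg : Set D) := t.poly.isClosed_topologicalClosure

lemma mono_mem_alg {m n k : ℤ} {x : D} (hx : x ∈ t.monos m n k) : x ∈ t.alg :=
  t.poly.le_topologicalClosure (Submodule.subset_span ⟨m, n, k, hx⟩)

lemma iA_mem (a : A) : t.iA a ∈ t.alg :=
  mem_of_homogeneous _ t.isClosed_alg (fun n a ha =>
    t.mono_mem_alg ⟨a, 1, 1, ha, .one, .one, by simp only [map_one, mul_one]⟩) a

lemma iB_mem (b : B) : t.iB b ∈ t.alg :=
  mem_of_homogeneous _ t.isClosed_alg (fun n b hb =>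
    t.mono_mem_alg ⟨1, b, 1, .one, hb, .one, by simp only [map_one, mul_one, one_mul]⟩) b

lemma iC_mem (c : C) : t.iC c ∈ t.alg :=
  mem_of_homogeneous _ t.isClosed_alg (fun n c hc =>
    t.mono_mem_alg ⟨1, 1, c, .one, .one, hc, by simp only [map_one, one_mul]⟩) c

/-- The component of degree `(m, n, k)`. -/
def component (m n k : ℤ) : D →L[ℂ] D :=
  (spec t.ρC k).comp ((spec t.ρB n).comp (spec t.ρA m))

lemma eq_zero_of_component {x : D} (h : ∀ m n k, t.component m n k x = 0) : x = 0 :=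
  eq_zero_of_spec t.ρA fun m => eq_zero_of_spec t.ρB fun n => eq_zero_of_spec t.ρC fun k => h m n k

/-- Each of the three actions moves only one of the three factors, so a product of homogeneous
elements is homogeneous for all of them, with the three degrees independent of each other. -/
lemma component_mono (m n k : ℤ) {m' n' k' : ℤ} {x : D} (hx : x ∈ t.monos m' n' k') :
    t.component m n k x = if m = m' ∧ n = n' ∧ k = k' then x else 0 := by
  obtain ⟨a, b, c, ha, hb, hc, rfl⟩ := hx
  have h1 : @IsHomogeneous D _ t.ρA m' (t.iA a * t.iB b * t.iC c) := fun z => by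
    rw [map_mul, map_mul, t.ρA_iA, t.ρA_iB, t.ρA_iC, ha z, map_smul, smul_mul_assoc,
      smul_mul_assoc]
  have h2 : @IsHomogeneous D _ t.ρB n' (t.iA a * t.iB b * t.iC c) := fun z => by
    rw [map_mul, map_mul, t.ρB_iA, t.ρB_iB, t.ρB_iC, hb z, map_smul, mul_smul_comm,
      smul_mul_assoc]
  have h3 : @IsHomogeneous D _ t.ρC k' (t.iA a * t.iB b * t.iC c) := fun z => by
    rw [map_mul, map_mul, t.ρC_iA, t.ρC_iB, t.ρC_iC, hc z, map_smul, mul_smul_comm]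
  simp only [component, ContinuousLinearMap.comp_apply]
  rw [spec_homogeneous t.ρA m h1]
  by_cases hm : m = m'
  · rw [if_pos hm, spec_homogeneous t.ρB n h2]
    by_cases hn : n = n'
    · rw [if_pos hn, spec_homogeneous t.ρC k h3]
      simp [hm, hn]
    · simp [hn]
  · simp [hm]

/-- By continuity it suffices to consider monomials, which the component map either keeps or kills.
This isolates a single multidegree, where product functionals on different threefold products can be
compared. -/
lemma component_mem {x : D} (hx : x ∈ t.alg) (m n k : ℤ) :
    t.component m n k x ∈ closure (Submodule.span ℂ (t.monos m n k) : Set D) := by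
  have hx' : x ∈ closure (Submodule.span ℂ {x | ∃ m n k, x ∈ t.monos m n k} : Set D) := hx
  refine map_mem_closure (t.component m n k).continuous hx' ?_
  change Submodule.span ℂ _ ≤ (Submodule.span ℂ (t.monos m n k)).comap
    (t.component m n k : D →ₗ[ℂ] D)
  rw [Submodule.span_le]
  rintro y ⟨m', n', k', hy⟩
  change t.component m n k y ∈ Submodule.span ℂ (t.monos m n k)
  rw [t.component_mono m n k hy]
  split_ifs with h
  · obtain ⟨rfl, rfl, rfl⟩ := h
    exact Submodule.subset_span hy
  · exact Submodule.zero_mem _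

/-- On the products of degree `(m, n, k)`, the functional `Ω` is `s` times `φ ⊗ ψ ⊗ χ`. -/
def IsProdOn (φ : A →L[ℂ] ℂ) (ψ : B →L[ℂ] ℂ) (χ : C →L[ℂ] ℂ) (Ω : D →L[ℂ] ℂ) (m n k : ℤ) (s : ℂ) :
    Prop :=
  ∀ a b c, IsHomogeneous m a → IsHomogeneous n b → IsHomogeneous k c →
    Ω (t.iA a * t.iB b * t.iC c) = s * (φ a * ψ b * χ c)

/-- `D` is generated by the three factors and its norm is the minimal one: there are enough product
functionals. -/
structure IsMinimal : Prop where
  generates : ∀ N : StarSubalgebra ℂ D, IsClosed (N : Set D) → (∀ a, t.iA a ∈ N) →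
    (∀ b, t.iB b ∈ N) → (∀ c, t.iC c ∈ N) → ∀ x, x ∈ N
  exists_prod : ∀ φ ψ χ, IsCoef φ → IsCoef ψ → IsCoef χ → ∀ m n k,
    ∃ Ω s, s ≠ 0 ∧ t.IsProdOn φ ψ χ Ω m n k s
  separates : ∀ x, (∀ φ ψ χ, IsCoef φ → IsCoef ψ → IsCoef χ → ∀ Ω,
    (∀ m n k, ∃ s, t.IsProdOn φ ψ χ Ω m n k s) → Ω x = 0) → x = 0

/-- A homomorphism that matches the morphisms on the factors and the actions. -/
structure IsHom (t' : Triple ζ A B C D') (f : D →⋆ₐ[ℂ] D') : Prop where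
  iA : ∀ a, f (t.iA a) = t'.iA a
  iB : ∀ b, f (t.iB b) = t'.iB b
  iC : ∀ c, f (t.iC c) = t'.iC c
  ρA : ∀ z x, f (t.ρA.act z x) = t'.ρA.act z (f x)
  ρB : ∀ z x, f (t.ρB.act z x) = t'.ρB.act z (f x)
  ρC : ∀ z x, f (t.ρC.act z x) = t'.ρC.act z (f x)

variable {t}

lemma IsHom.component {t' : Triple ζ A B C D'} {f : D →⋆ₐ[ℂ] D'} (hf : t.IsHom t' f) (m n k : ℤ)
    (x : D) : f (t.component m n k x) = t'.component m n k (f x) := by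
  have h1 := map_spec t.ρA t'.ρA (toCLM f) hf.ρA m x
  have h2 := map_spec t.ρB t'.ρB (toCLM f) hf.ρB n (spec t.ρA m x)
  have h3 := map_spec t.ρC t'.ρC (toCLM f) hf.ρC k (spec t.ρB n (spec t.ρA m x))
  simp only [toCLM_apply] at h1 h2 h3
  simp only [Triple.component, ContinuousLinearMap.comp_apply, h1, h2, h3]

/-- The kernels of homomorphisms to minimal products agree. -/
lemma IsHom.eq_zero {t₁ : Triple ζ A B C D} {t₂ : Triple ζ A B C D'} {t : Triple ζ A B C E}
    {f : E →⋆ₐ[ℂ] D} {g : E →⋆ₐ[ℂ] D'} (hf : t.IsHom t₁ f) (hg : t.IsHom t₂ g)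
    (h₁ : t₁.IsMinimal) (h₂ : t₂.IsMinimal) {x : E} (hx : x ∈ t.alg) (h0 : f x = 0) : g x = 0 := by
  -- The scalars in `IsProdOn` depend on the multidegree, so the functionals are compared on one
  -- component y at a time.
  refine t₂.eq_zero_of_component fun m n k => ?_
  rw [← hg.component]
  set y := t.component m n k x with hy
  have hfy : f y = 0 := by rw [hy, hf.component, h0, map_zero]
  have hmem : y ∈ closure (Submodule.span ℂ (t.monos m n k) : Set E) := t.component_mem hx m n k
  refine h₂.separates _ fun φ ψ χ hφ hψ hχ Ω hΩ => ?_
  obtain ⟨s, hs⟩ := hΩ m n k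
  obtain ⟨Ω', s', hs0, hs'⟩ := h₁.exists_prod φ ψ χ hφ hψ hχ m n k
  -- On monomials of this degree Ω∘g and Ω'∘f are s and s' times the same functional φ ⊗ ψ ⊗ χ, so
  -- this combination vanishes on y. With f y = 0 and s' ≠ 0 it follows that Ω(g y) = 0.
  let L : E →L[ℂ] ℂ := s' • Ω.comp (toCLM g) - s • Ω'.comp (toCLM f)
  have hL : ∀ z, L z = s' * Ω (g z) - s * Ω' (f z) := fun _ => rfl
  have hle : Submodule.span ℂ (t.monos m n k) ≤ LinearMap.ker (L : E →ₗ[ℂ] ℂ) := by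
    rw [Submodule.span_le]
    rintro _ ⟨a, b, c, ha, hb, hc, rfl⟩
    change L _ = 0
    rw [hL, map_mul g, map_mul g, map_mul f, map_mul f, hf.iA, hf.iB, hf.iC, hg.iA, hg.iB, hg.iC,
      hs a b c ha hb hc, hs' a b c ha hb hc]
    ring
  have hLy : L y = 0 := closure_minimal (t := {z | L z = 0}) (fun z hz => hle hz)
    (isClosed_eq L.continuous continuous_const) hmem
  rw [hL, hfy, map_zero, mul_zero, sub_zero] at hLy
  exact (mul_eq_zero.1 hLy).resolve_left hs0

end

/-- The diagonal of two threefold products. -/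
def prod (t₁ : Triple ζ A B C D) (t₂ : Triple ζ A B C D') : Triple ζ A B C (D × D') where
  iA := t₁.iA.prod t₂.iA
  iB := t₁.iB.prod t₂.iB
  iC := t₁.iC.prod t₂.iC
  ba ha hb := Prod.ext (t₁.ba ha hb) (t₂.ba ha hb)
  ca ha hb := Prod.ext (t₁.ca ha hb) (t₂.ca ha hb)
  cb ha hb := Prod.ext (t₁.cb ha hb) (t₂.cb ha hb)
  ρA := prodAction t₁.ρA t₂.ρA
  ρB := prodAction t₁.ρB t₂.ρB
  ρC := prodAction t₁.ρC t₂.ρC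
  ρA_iA z a := Prod.ext (t₁.ρA_iA z a) (t₂.ρA_iA z a)
  ρA_iB z a := Prod.ext (t₁.ρA_iB z a) (t₂.ρA_iB z a)
  ρA_iC z a := Prod.ext (t₁.ρA_iC z a) (t₂.ρA_iC z a)
  ρB_iA z a := Prod.ext (t₁.ρB_iA z a) (t₂.ρB_iA z a)
  ρB_iB z a := Prod.ext (t₁.ρB_iB z a) (t₂.ρB_iB z a)
  ρB_iC z a := Prod.ext (t₁.ρB_iC z a) (t₂.ρB_iC z a)
  ρC_iA z a := Prod.ext (t₁.ρC_iA z a) (t₂.ρC_iA z a)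
  ρC_iB z a := Prod.ext (t₁.ρC_iB z a) (t₂.ρC_iB z a)
  ρC_iC z a := Prod.ext (t₁.ρC_iC z a) (t₂.ρC_iC z a)

lemma isHom_fst (t₁ : Triple ζ A B C D) (t₂ : Triple ζ A B C D') :
    (t₁.prod t₂).IsHom t₁ (StarAlgHom.fst ℂ D D') where
  iA _ := rfl
  iB _ := rfl
  iC _ := rfl
  ρA _ _ := rfl
  ρB _ _ := rfl
  ρC _ _ := rfl

lemma isHom_snd (t₁ : Triple ζ A B C D) (t₂ : Triple ζ A B C D') :
    (t₁.prod t₂).IsHom t₂ (StarAlgHom.snd ℂ D D') where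
  iA _ := rfl
  iB _ := rfl
  iC _ := rfl
  ρA _ _ := rfl
  ρB _ _ := rfl
  ρC _ _ := rfl

/-- An injective homomorphism from the closed span of the products to a minimal product is
bijective. -/
lemma IsHom.bijective {t : Triple ζ A B C E} {t' : Triple ζ A B C D} {f : E →⋆ₐ[ℂ] D}
    (hf : t.IsHom t' f) (h : t'.IsMinimal) (hinj : ∀ x ∈ t.alg, f x = 0 → x = 0) :
    Function.Bijective (f.comp t.alg.subtype) := by
  have hcl : IsClosed (t.alg : Set E) := t.isClosed_alg
  have hi : Function.Injective (f.comp t.alg.subtype) := by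
    refine (injective_iff_map_eq_zero _).2 fun x hx => Subtype.ext (hinj x x.2 hx)
  refine ⟨hi, fun y => ?_⟩
  -- An injective `*`-homomorphism is isometric, so its range is closed; it contains the three
  -- factors, which generate the target.
  have hr : IsClosed (((f.comp t.alg.subtype).range : StarSubalgebra ℂ D) : Set D) :=
    (NonUnitalStarAlgHom.isometry (f.comp t.alg.subtype) hi).isClosedEmbedding.isClosed_range
  have hy := h.generates (f.comp t.alg.subtype).range hr
    (fun a => ⟨⟨_, t.iA_mem a⟩, hf.iA a⟩) (fun b => ⟨⟨_, t.iB_mem b⟩, hf.iB b⟩)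
    (fun c => ⟨⟨_, t.iC_mem c⟩, hf.iC c⟩) y
  exact hy

/-- Minimal threefold products are unique. -/
theorem IsMinimal.exists_equiv {t₁ : Triple ζ A B C D} {t₂ : Triple ζ A B C D'}
    (h₁ : t₁.IsMinimal) (h₂ : t₂.IsMinimal) : ∃ e : D ≃⋆ₐ[ℂ] D',
      (∀ a, e (t₁.iA a) = t₂.iA a) ∧ (∀ b, e (t₁.iB b) = t₂.iB b) ∧
      ∀ c, e (t₁.iC c) = t₂.iC c := by
  let t := t₁.prod t₂
  -- The algebra `t.alg` in D × D' will be the graph of the isomorphism. If one coordinate of an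
  -- element vanishes, so does the other, because the two projections have the same kernel on it.
  have b₁ := (isHom_fst t₁ t₂).bijective h₁ fun x hx h0 =>
    Prod.ext h0 ((isHom_fst t₁ t₂).eq_zero (isHom_snd t₁ t₂) h₁ h₂ hx h0)
  have b₂ := (isHom_snd t₁ t₂).bijective h₂ fun x hx h0 =>
    Prod.ext ((isHom_snd t₁ t₂).eq_zero (isHom_fst t₁ t₂) h₂ h₁ hx h0) h0
  let e₁ := StarAlgEquiv.ofBijective _ b₁
  let e₂ := StarAlgEquiv.ofBijective _ b₂
  have key : ∀ x (hx : x ∈ t.alg), (e₁.symm.trans e₂) x.1 = x.2 := fun x hx => by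
    have h : e₁.symm x.1 = ⟨x, hx⟩ := by rw [StarAlgEquiv.symm_apply_eq]; rfl
    rw [StarAlgEquiv.trans_apply, h]; rfl
  exact ⟨e₁.symm.trans e₂, fun a => key _ (t.iA_mem a), fun b => key _ (t.iB_mem b),
    fun c => key _ (t.iC_mem c)⟩

end Triple

/-! ### The associator -/

section Associator

variable (ζ : Circle) (A B C : Type) [CStarAlgebra A] [CircleAction A] [CStarAlgebra B]
  [CircleAction B] [CStarAlgebra C] [CircleAction C]

/-- `(A ⊠ B) ⊠ C` as a threefold product. -/
def leftTriple : Triple ζ A B C (BT ζ (BT ζ A B) C) where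
  iA := (j₁ ζ (BT ζ A B) C).toStarAlgHom.comp (j₁ ζ A B).toStarAlgHom
  iB := (j₁ ζ (BT ζ A B) C).toStarAlgHom.comp (j₂ ζ A B).toStarAlgHom
  iC := (j₂ ζ (BT ζ A B) C).toStarAlgHom
  ba ha hb := by
    simp only [StarAlgHom.comp_apply, ← map_mul, ← map_smul]
    rw [j₂_mul_j₁ ζ ha hb]
  ca ha hc := j₂_mul_j₁ ζ ((j₁ ζ A B).isHomogeneous ha) hc
  cb hb hc := j₂_mul_j₁ ζ ((j₂ ζ A B).isHomogeneous hb) hc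
  ρA := (((EquivAction.self A).braid ζ (.triv B)).braid ζ (.triv C)).toAction
  ρB := (((EquivAction.triv A).braid ζ (.self B)).braid ζ (.triv C)).toAction
  ρC := ((EquivAction.triv (BT ζ A B)).braid ζ (.self C)).toAction
  ρA_iA z a := by simp [EquivAction.toAction_act]
  ρA_iB z b := by simp [EquivAction.toAction_act]
  ρA_iC z c := by simp [EquivAction.toAction_act]
  ρB_iA z a := by simp [EquivAction.toAction_act]
  ρB_iB z b := by simp [EquivAction.toAction_act]
  ρB_iC z c := by simp [EquivAction.toAction_act]
  ρC_iA z a := by simp [EquivAction.toAction_act]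
  ρC_iB z b := by simp [EquivAction.toAction_act]
  ρC_iC z c := by simp [EquivAction.toAction_act]

/-- `A ⊠ (B ⊠ C)` as a threefold product. -/
def rightTriple : Triple ζ A B C (BT ζ A (BT ζ B C)) where
  iA := (j₁ ζ A (BT ζ B C)).toStarAlgHom
  iB := (j₂ ζ A (BT ζ B C)).toStarAlgHom.comp (j₁ ζ B C).toStarAlgHom
  iC := (j₂ ζ A (BT ζ B C)).toStarAlgHom.comp (j₂ ζ B C).toStarAlgHom
  ba ha hb := j₂_mul_j₁ ζ ha ((j₁ ζ B C).isHomogeneous hb)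
  ca ha hc := j₂_mul_j₁ ζ ha ((j₂ ζ B C).isHomogeneous hc)
  cb hb hc := by
    simp only [StarAlgHom.comp_apply, ← map_mul, ← map_smul]
    rw [j₂_mul_j₁ ζ hb hc]
  ρA := ((EquivAction.self A).braid ζ (.triv (BT ζ B C))).toAction
  ρB := ((EquivAction.triv A).braid ζ ((EquivAction.self B).braid ζ (.triv C))).toAction
  ρC := ((EquivAction.triv A).braid ζ ((EquivAction.triv B).braid ζ (.self C))).toAction
  ρA_iA z a := by simp [EquivAction.toAction_act]
  ρA_iB z b := by simp [EquivAction.toAction_act]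
  ρA_iC z c := by simp [EquivAction.toAction_act]
  ρB_iA z a := by simp [EquivAction.toAction_act]
  ρB_iB z b := by simp [EquivAction.toAction_act]
  ρB_iC z c := by simp [EquivAction.toAction_act]
  ρC_iA z a := by simp [EquivAction.toAction_act]
  ρC_iB z b := by simp [EquivAction.toAction_act]
  ρC_iC z c := by simp [EquivAction.toAction_act]

/-- The product functionals on `A ⊠ B`. -/
def braidedProds : Set (BT ζ A B →L[ℂ] ℂ) :=
  {G | ∃ τ φ ψ, IsCoef τ ∧ IsCoef φ ∧ IsCoef ψ ∧ IsBraidedProd ζ τ φ ψ G}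

variable {A B C}

lemma eq_zero_of_braidedProds {x : BT ζ A B} (h : ∀ G ∈ braidedProds ζ A B, G x = 0) : x = 0 :=
  BT.eq_zero_of_separating (S := {φ | IsCoef φ}) (S' := {ψ | IsCoef ψ}) (fun _ h => h)
    (fun _ => eq_zero_of_isCoef) (fun _ h => h) (fun _ => eq_zero_of_isCoef)
    fun τ hτ φ hφ ψ hψ G hG => h G ⟨τ, φ, ψ, hτ, hφ, hψ, hG⟩

variable {ζ}

/-- The element j₁(a)j₂(b) has degree m + n in A ⊠ B, so the outer torus leg contributes u^(m+n)v^k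
and the inner one u^m v^n. -/
lemma leftTriple_isProdOn {τ τ' : QTorus ζ →L[ℂ] ℂ} {φ : A →L[ℂ] ℂ} {ψ : B →L[ℂ] ℂ} {χ : C →L[ℂ] ℂ}
    {G : BT ζ A B →L[ℂ] ℂ} {Ω : BT ζ (BT ζ A B) C →L[ℂ] ℂ} (hG : IsBraidedProd ζ τ φ ψ G)
    (hΩ : IsBraidedProd ζ τ' G χ Ω) (m n k : ℤ) :
    (leftTriple ζ A B C).IsProdOn φ ψ χ Ω m n k
      (τ' (torusMono ζ (m + n) k) * τ (torusMono ζ m n)) := by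
  intro a b c ha hb hc
  have h1 := hΩ.2 (m + n) k (j₁ ζ A B a * j₂ ζ A B b) c
    (((j₁ ζ A B).isHomogeneous ha).mul ((j₂ ζ A B).isHomogeneous hb)) hc
  rw [map_mul (j₁ ζ (BT ζ A B) C).toStarAlgHom, hG.2 m n a b ha hb] at h1
  refine h1.trans ?_
  ring

/-- Here the inner product is B ⊠ C, and its total degree n + k is the exponent of v in the outer
torus monomial. -/
lemma rightTriple_isProdOn {τ τ' : QTorus ζ →L[ℂ] ℂ} {φ : A →L[ℂ] ℂ} {ψ : B →L[ℂ] ℂ}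
    {χ : C →L[ℂ] ℂ} {G : BT ζ B C →L[ℂ] ℂ} {Ω : BT ζ A (BT ζ B C) →L[ℂ] ℂ}
    (hG : IsBraidedProd ζ τ ψ χ G) (hΩ : IsBraidedProd ζ τ' φ G Ω) (m n k : ℤ) :
    (rightTriple ζ A B C).IsProdOn φ ψ χ Ω m n k
      (τ' (torusMono ζ m (n + k)) * τ (torusMono ζ n k)) := by
  intro a b c ha hb hc
  have h1 := hΩ.2 m (n + k) a (j₁ ζ B C b * j₂ ζ B C c) ha
    (((j₁ ζ B C).isHomogeneous hb).mul ((j₂ ζ B C).isHomogeneous hc))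
  rw [map_mul (j₂ ζ A (BT ζ B C)).toStarAlgHom, ← mul_assoc, hG.2 n k b c hb hc] at h1
  refine h1.trans ?_
  ring

/-- Product functionals can be iterated, because a product functional on A ⊠ B is again a vector
functional and so may serve as a factor in the outer product. The torus functionals are chosen not
to vanish at the two monomials of the given degree. -/
lemma leftTriple_isMinimal : (leftTriple ζ A B C).IsMinimal where
  generates N hN hA hB hC x :=
    BT.mem_of_generators (StarAlgHom.id ℂ _) hN
      (fun y => BT.mem_of_generators (j₁ ζ (BT ζ A B) C).toStarAlgHom hN hA hB y) hC x
  exists_prod φ ψ χ hφ hψ hχ m n k := by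
    obtain ⟨τ, hτ, hn⟩ := exists_isCoef_torusMono ζ m n
    obtain ⟨τ', hτ', hn'⟩ := exists_isCoef_torusMono ζ (m + n) k
    obtain ⟨G, hG⟩ := exists_isBraidedProd hτ hφ hψ
    obtain ⟨Ω, hΩ⟩ := exists_isBraidedProd hτ' hG.1 hχ
    exact ⟨Ω, _, mul_ne_zero hn' hn, leftTriple_isProdOn hG hΩ m n k⟩
  separates x h := by
    refine BT.eq_zero_of_separating (S := braidedProds ζ A B) (S' := {χ | IsCoef χ}) ?_
      (fun _ => eq_zero_of_braidedProds ζ) (fun _ h => h) (fun _ => eq_zero_of_isCoef) ?_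
    · rintro G ⟨τ, φ, ψ, -, -, -, hG⟩
      exact hG.1
    · rintro τ' - G ⟨τ, φ, ψ, -, hφ, hψ, hG⟩ χ hχ Ω hΩ
      exact h φ ψ χ hφ hψ hχ Ω fun m n k => ⟨_, leftTriple_isProdOn hG hΩ m n k⟩

lemma rightTriple_isMinimal : (rightTriple ζ A B C).IsMinimal where
  generates N hN hA hB hC x :=
    BT.mem_of_generators (StarAlgHom.id ℂ _) hN hA
      (fun y => BT.mem_of_generators (j₂ ζ A (BT ζ B C)).toStarAlgHom hN hB hC y) x
  exists_prod φ ψ χ hφ hψ hχ m n k := by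
    obtain ⟨τ, hτ, hn⟩ := exists_isCoef_torusMono ζ n k
    obtain ⟨τ', hτ', hn'⟩ := exists_isCoef_torusMono ζ m (n + k)
    obtain ⟨G, hG⟩ := exists_isBraidedProd hτ hψ hχ
    obtain ⟨Ω, hΩ⟩ := exists_isBraidedProd hτ' hφ hG.1
    exact ⟨Ω, _, mul_ne_zero hn' hn, rightTriple_isProdOn hG hΩ m n k⟩
  separates x h := by
    refine BT.eq_zero_of_separating (S := {φ | IsCoef φ}) (S' := braidedProds ζ B C)
      (fun _ h => h) (fun _ => eq_zero_of_isCoef) ?_ (fun _ => eq_zero_of_braidedProds ζ) ?_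
    · rintro G ⟨τ, φ, ψ, -, -, -, hG⟩
      exact hG.1
    · rintro τ' - φ hφ G ⟨τ, ψ, χ, -, hψ, hχ, hG⟩ Ω hΩ
      exact h φ ψ χ hφ hψ hχ Ω fun m n k => ⟨_, rightTriple_isProdOn hG hΩ m n k⟩

variable (ζ A B C)

/-- The canonical isomorphism `(A ⊠ B) ⊠ C ≅ A ⊠ (B ⊠ C)` exists. -/
theorem exists_isAssociator :
    ∃ e : BT ζ (BT ζ A B) C ≃⋆ₐ[ℂ] BT ζ A (BT ζ B C), IsAssociator ζ e := by
  obtain ⟨e, hA, hB, hC⟩ :=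
    (leftTriple_isMinimal (ζ := ζ) (A := A) (B := B) (C := C)).exists_equiv rightTriple_isMinimal
  exact ⟨e, hA, hB, hC⟩

end Associator

/-! ### The right circle action on `C(SU_q(2))` -/

section RightAction

variable {q : ℂ}

/-- In each relation the terms are multiplied by the same power of z: the relations with adjoints
are unchanged and both sides of the third gain z². -/
lemma SURel.scale {D : Type} [CStarAlgebra D] {α γ : D} (h : SURel q α γ) (z : Circle) :
    SURel q ((z : ℂ) • α) ((z : ℂ) • γ) := by
  have hz : star (z : ℂ) * z = 1 := by
    rw [← starRingEnd_apply, ← Circle.coe_inv_eq_conj, ← Circle.coe_mul, inv_mul_cancel,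
      Circle.coe_one]
  have h1 : ∀ x : D, star ((z : ℂ) • x) * ((z : ℂ) • x) = star x * x := fun x => by
    rw [star_smul, smul_mul_smul_comm, hz, one_smul]
  have h2 : ∀ x : D, ((z : ℂ) • x) * star ((z : ℂ) • x) = x * star x := fun x => by
    rw [star_smul, smul_mul_smul_comm, mul_comm, hz, one_smul]
  constructor
  · rw [h1, h1, h.star_mul_add]
  · rw [h1, h2, h.mul_star_add]
  · rw [smul_mul_smul_comm, smul_mul_smul_comm, h.mul_comm_smul, smul_comm]
  · rw [h1, h2, h.normal]

variable (q)

/-- The circle action on `C(SU_q(2))` that multiplies both generators by `z`. -/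
def rightAction : EquivAction (SUq2 q) where
  mor z :=
    { toStarAlgHom := suLift ((suRel q).scale z)
      equivariant := fun w x => by
        refine su_hom_ext (f := (suLift ((suRel q).scale z)).comp (act w))
          (g := (act w).comp (suLift ((suRel q).scale z))) ?_ ?_ x
        · simp [act_alpha]
        · simp [act_gamma, smul_comm (z : ℂ)] }
  mor_one x := by
    refine su_hom_ext (f := suLift ((suRel q).scale 1)) (g := StarAlgHom.id ℂ _) ?_ ?_ x <;> simp
  mor_mul z w x := by
    refine su_hom_ext (f := suLift ((suRel q).scale (z * w)))
      (g := (suLift ((suRel q).scale z)).comp (suLift ((suRel q).scale w))) ?_ ?_ x <;>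
    simp [mul_smul, smul_comm (z : ℂ)]
  continuous_mor := continuous_of_dense (fun z => suLift ((suRel q).scale z))
      (s := Set.range (suPres q).family.toEnv) (suPres q).family.denseRange_coe <| by
    rintro _ ⟨x, rfl⟩
    induction x using FreeStar.induction with
    | scalar c => simp only [AlgHomClass.commutes]; exact continuous_const
    | letter p =>
      have hc : Continuous fun z : Circle => (z : ℂ) := continuous_subtype_val
      have h0 : ∀ i, Continuous fun z : Circle =>
          suLift ((suRel q).scale z) ((suPres q).gen i) := by
        intro i
        fin_cases i
        · change Continuous fun z : Circle => suLift ((suRel q).scale z) (alpha q)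
          simp only [suLift_alpha]; exact hc.smul continuous_const
        · change Continuous fun z : Circle => suLift ((suRel q).scale z) (gamma q)
          simp only [suLift_gamma]; exact hc.smul continuous_const
      rcases p with ⟨i, _ | _⟩
      · exact h0 i
      · have : FreeStar.letter (i, true) = star (FreeStar.gen i) := by simp [FreeStar.gen]
        simp only [this, map_star]
        exact (h0 i).star
    | mul a b ha hb => simp only [map_mul]; exact ha.mul hb
    | add a b ha hb => simp only [map_add]; exact ha.add hb

@[simp] lemma rightAction_alpha (z : Circle) :
    (rightAction q).mor z (alpha q) = (z : ℂ) • alpha q :=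
  suLift_alpha ((suRel q).scale z)

@[simp] lemma rightAction_gamma (z : Circle) :
    (rightAction q).mor z (gamma q) = (z : ℂ) • gamma q :=
  suLift_gamma ((suRel q).scale z)

lemma Delta_alpha : Delta q (alpha q) = deltaAlpha q := suLift_alpha (deltaRel q)

lemma Delta_gamma : Delta q (gamma q) = deltaGamma q := suLift_gamma (deltaRel q)

lemma toCircleAlg_alpha : toCircleAlg q (alpha q) = circleCoord := suLift_alpha (circleRel q)

lemma toCircleAlg_gamma : toCircleAlg q (gamma q) = 0 := suLift_gamma (circleRel q)

/-- The action `id ⊠ β` on `C(SU_q(2)) ⊠ C(SU_q(2))`, for the right action `β`. -/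
def rightAction₂ : EquivAction (SU2SU q) := (EquivAction.triv _).braid (zeta q) (rightAction q)

/-- The coproduct intertwines the right actions. -/
lemma Delta_rightAction (z : Circle) (x : SUq2 q) :
    Delta q ((rightAction q).mor z x) = (rightAction₂ q).mor z (Delta q x) := by
  refine su_hom_ext (f := (Delta q).toStarAlgHom.comp ((rightAction q).mor z).toStarAlgHom)
    (g := ((rightAction₂ q).mor z).toStarAlgHom.comp (Delta q).toStarAlgHom) ?_ ?_ x
  -- Every term of Δ(α) and of Δ(γ) has exactly one of α, γ, without adjoint, in its second leg;
  -- hence id ⊠ β_z multiplies the whole by z.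
  · simp only [StarAlgHom.comp_apply, rightAction_alpha, map_smul, Delta_alpha, deltaAlpha,
      map_sub, map_mul, rightAction₂, EquivAction.braid_mor_j₁, EquivAction.braid_mor_j₂,
      EquivAction.triv_mor, rightAction_gamma, mul_smul_comm, smul_sub, smul_comm q]
  · simp only [StarAlgHom.comp_apply, rightAction_alpha, map_smul, Delta_gamma, deltaGamma,
      map_add, map_mul, rightAction₂, EquivAction.braid_mor_j₁, EquivAction.braid_mor_j₂,
      EquivAction.triv_mor, rightAction_gamma, mul_smul_comm, smul_add]

/-- Evaluation at `w`, with values in the constant functions. -/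
def evalConst (w : Circle) : TMor C(Circle, ℂ) C(Circle, ℂ) where
  toFun f := algebraMap ℂ C(Circle, ℂ) (f w)
  map_one' := by simp
  map_mul' f g := by simp
  map_zero' := by simp
  map_add' f g := by simp
  commutes' c := by simp
  map_star' f := algebraMap_star_comm (f w)
  -- The action on C(𝕋) is trivial. Keeping the values inside C(𝕋) as constants avoids introducing ℂ
  -- as a further algebra with action.
  equivariant _ _ := rfl

lemma evalConst_apply (w : Circle) (f : C(Circle, ℂ)) :
    evalConst w f = (f w) • (1 : C(Circle, ℂ)) := Algebra.algebraMap_eq_smul_one (f w)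

/-- Evaluation of `(id ⊠ π) ∘ Δ` at a point of the circle is the right action. -/
lemma map_evalConst_Delta (w : Circle) (x : SUq2 q) :
    BT.map (zeta q) (TMor.id _) (evalConst w)
      (BT.map (zeta q) (TMor.id _) (toCircleAlg q) (Delta q x)) =
        j₁ (zeta q) (SUq2 q) C(Circle, ℂ) ((rightAction q).mor w x) := by
  refine su_hom_ext (f := (BT.map (zeta q) (TMor.id _) (evalConst w)).toStarAlgHom.comp
      ((BT.map (zeta q) (TMor.id _) (toCircleAlg q)).toStarAlgHom.comp (Delta q).toStarAlgHom))
    (g := (j₁ (zeta q) (SUq2 q) C(Circle, ℂ)).toStarAlgHom.comp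
      ((rightAction q).mor w).toStarAlgHom) ?_ ?_ x
  · have h : circleCoord w = (w : ℂ) := rfl
    simp only [StarAlgHom.comp_apply, Delta_alpha, deltaAlpha, map_sub, map_mul, map_smul,
      BT.map_j₁, BT.map_j₂, toCircleAlg_alpha, toCircleAlg_gamma, evalConst_apply, h, map_zero,
      mul_zero, smul_zero, sub_zero, map_one, mul_smul_comm, mul_one, rightAction_alpha]
    rfl
  · have h : circleCoord w = (w : ℂ) := rfl
    simp only [StarAlgHom.comp_apply, Delta_gamma, deltaGamma, map_add, map_mul, map_smul,
      BT.map_j₁, BT.map_j₂, toCircleAlg_alpha, toCircleAlg_gamma, evalConst_apply, h, map_zero,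
      mul_zero, add_zero, map_one, mul_smul_comm, mul_one, rightAction_gamma]
    rfl

/-- The quotient sphere consists of the fixed points of the right action. -/
lemma mem_sphere_iff {a : SUq2 q} : a ∈ sphere q ↔ ∀ w, (rightAction q).mor w a = a := by
  rw [mem_sphere]
  constructor
  · intro h w
    have h1 := map_evalConst_Delta q w a
    rw [h, BT.map_j₁] at h1
    exact (j₁_injective (zeta q) h1).symm
  · intro h
    -- Conversely, an element of C(SU_q(2)) ⊠ C(𝕋) is zero once all point evaluations in the second
    -- leg kill it, since they are jointly injective on C(𝕋).
    rw [← sub_eq_zero]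
    refine BT.map_id_jointly_injective (zeta q) evalConst (fun f hf => ?_) fun w => ?_
    · ext w
      have := DFunLike.congr_fun (hf w) 1
      simpa [evalConst_apply] using this
    · rw [map_sub, map_evalConst_Delta, h, BT.map_j₁, sub_eq_zero]
      rfl

end RightAction

/-! ### Averaging over the right action -/

section Average

variable (q : ℂ)

/-- The average over the right action. -/
def average : SUq2 q →L[ℂ] SUq2 q := spec (rightAction q).toAction 0

/-- The average over the right action on the second factor. -/
def average₂ : SU2SU q →L[ℂ] SU2SU q := spec (rightAction₂ q).toAction 0

/-- Degree zero for the right action means fixed by it, which characterises the sphere. -/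
lemma average_mem_sphere (a : SUq2 q) : average q a ∈ sphere q := by
  rw [mem_sphere_iff]
  intro w
  have := isHomogeneous_spec (rightAction q).toAction 0 a w
  rw [zpow_zero, Circle.coe_one, one_smul] at this
  exact this

lemma average₂_of_fixed {x : SU2SU q} (h : ∀ w, (rightAction₂ q).mor w x = x) :
    average₂ q x = x := by
  refine (spec_homogeneous (rightAction₂ q).toAction 0 (k := 0) fun z => ?_).trans (if_pos rfl)
  rw [zpow_zero, Circle.coe_one, one_smul]
  exact h z

/-- The linear map b ↦ j₁(a)j₂(b) intertwines β with id ⊠ β, since the latter fixes j₁(a); averages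
therefore correspond. -/
lemma average₂_j₁_mul_j₂ (a b : SUq2 q) :
    average₂ q (j₁ _ _ _ a * j₂ _ _ _ b) = j₁ (zeta q) _ (SUq2 q) a * j₂ _ _ _ (average q b) := by
  let f : SUq2 q →L[ℂ] SU2SU q :=
    (ContinuousLinearMap.mul ℂ (SU2SU q) (j₁ _ _ _ a)).comp (toCLM (j₂ _ _ _).toStarAlgHom)
  refine (map_spec (rightAction q).toAction (rightAction₂ q).toAction f (fun z x => ?_) 0 b).symm
  change _ * j₂ _ _ _ ((rightAction q).mor z x) = (rightAction₂ q).mor z (_ * _)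
  simp [rightAction₂]

/-- The same argument for b ↦ j₁(a)Δ(b), where the intertwining is that of the coproduct with the
right actions. -/
lemma average₂_j₁_mul_Delta (a b : SUq2 q) :
    average₂ q (j₁ _ _ _ a * Delta q b) = j₁ (zeta q) _ (SUq2 q) a * Delta q (average q b) := by
  let f : SUq2 q →L[ℂ] SU2SU q :=
    (ContinuousLinearMap.mul ℂ (SU2SU q) (j₁ _ _ _ a)).comp (toCLM (Delta q).toStarAlgHom)
  refine (map_spec (rightAction q).toAction (rightAction₂ q).toAction f (fun z x => ?_) 0 b).symm
  change _ * Delta q ((rightAction q).mor z x) = (rightAction₂ q).mor z (_ * _)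
  rw [Delta_rightAction, map_mul]
  simp [rightAction₂]

end Average

/-! ### The coaction on the quotient sphere -/

section Coaction

variable (q : ℂ)

/-- The morphism `id ⊠ ι`. -/
def sphereEmb : TMor (BT (zeta q) (SUq2 q) (CS2 q)) (SU2SU q) :=
  BT.map (zeta q) (TMor.id (SUq2 q)) (sphereIncl q)

lemma sphereEmb_j₁ (a : SUq2 q) : sphereEmb q (j₁ _ _ _ a) = j₁ _ _ _ a :=
  BT.map_j₁ _ _ _ a

lemma sphereEmb_j₂ (x : CS2 q) : sphereEmb q (j₂ _ _ _ x) = j₂ _ _ _ (sphereIncl q x) :=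
  BT.map_j₂ _ _ _ x

lemma rightAction_sphereIncl (w : Circle) (x : CS2 q) :
    (rightAction q).mor w (sphereIncl q x) = sphereIncl q x := (mem_sphere_iff q).1 x.2 w

/-- The average over the right action, as an element of `C(S²_q)`. -/
def sphereAverage (b : SUq2 q) : CS2 q := (⟨average q b, average_mem_sphere q b⟩ : sphere q)

lemma sphereIncl_sphereAverage (b : SUq2 q) : sphereIncl q (sphereAverage q b) = average q b := rfl

lemma sphereIncl_injective : Function.Injective (sphereIncl q) := Subtype.val_injective

lemma sphereEmb_injective : Function.Injective (sphereEmb q) :=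
  BT.map_id_injective (zeta q) _ (sphereIncl_injective q)

lemma isometry_sphereEmb : Isometry (sphereEmb q) :=
  NonUnitalStarAlgHom.isometry (sphereEmb q).toStarAlgHom (sphereEmb_injective q)

/-- Averaging sends j₁(a)j₂(b) to j₁(a)j₂(E(b)), which comes from the sphere. Such products span a
dense subspace, and the range of the isometry id ⊠ ι is closed. -/
lemma average₂_mem_range (y : SU2SU q) : average₂ q y ∈ (sphereEmb q).toStarAlgHom.range := by
  have hy := BT.dense (zeta q) (SUq2 q) (SUq2 q) y
  have hcl : IsClosed (((sphereEmb q).toStarAlgHom.range : StarSubalgebra ℂ (SU2SU q)) :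
      Set (SU2SU q)) := (isometry_sphereEmb q).isClosedEmbedding.isClosed_range
  refine closure_minimal (t := average₂ q ⁻¹' (sphereEmb q).toStarAlgHom.range) ?_
    (hcl.preimage (average₂ q).continuous) hy
  change _ ≤ (Subalgebra.toSubmodule (sphereEmb q).toStarAlgHom.range.toSubalgebra).comap
    (average₂ q : SU2SU q →ₗ[ℂ] SU2SU q)
  rw [Submodule.span_le]
  rintro _ ⟨a, b, rfl⟩
  refine ⟨j₁ _ _ _ a * j₂ _ _ _ (sphereAverage q b), ?_⟩
  change sphereEmb q _ = average₂ q (j₁ _ _ _ a * j₂ _ _ _ b)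
  rw [average₂_j₁_mul_j₂, map_mul, sphereEmb_j₁, sphereEmb_j₂, sphereIncl_sphereAverage]

/-- For x in the sphere Δ(x) is fixed by id ⊠ β, so it equals its own average. This is why Δ
restricts to a coaction on the sphere. -/
lemma Delta_mem_range (x : CS2 q) : Delta q (sphereIncl q x) ∈ (sphereEmb q).toStarAlgHom.range := by
  rw [← average₂_of_fixed q (x := Delta q (sphereIncl q x)) fun w => by
    rw [← Delta_rightAction, rightAction_sphereIncl]]
  exact average₂_mem_range q _

/-- The restriction of the coproduct to the quotient sphere. -/
def coaction : TMor (CS2 q) (BT (zeta q) (SUq2 q) (CS2 q)) :=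
  let e := StarAlgEquiv.ofInjective (sphereEmb q).toStarAlgHom (sphereEmb_injective q)
  let Γ : CS2 q →⋆ₐ[ℂ] BT (zeta q) (SUq2 q) (CS2 q) :=
    (e.symm : (sphereEmb q).toStarAlgHom.range →⋆ₐ[ℂ] BT (zeta q) (SUq2 q) (CS2 q)).comp
      (((Delta q).toStarAlgHom.comp (sphereIncl q).toStarAlgHom).codRestrict _ (Delta_mem_range q))
  have h : ∀ x, sphereEmb q (Γ x) = Delta q (sphereIncl q x) := fun x =>
    congrArg Subtype.val (e.apply_symm_apply ⟨_, Delta_mem_range q x⟩)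
  { toStarAlgHom := Γ
    equivariant := fun z x => sphereEmb_injective q (by
      rw [h, (sphereEmb q).equivariant, h, (sphereIncl q).equivariant, (Delta q).equivariant]) }

lemma sphereEmb_coaction (x : CS2 q) :
    sphereEmb q (coaction q x) = Delta q (sphereIncl q x) :=
  congrArg Subtype.val ((StarAlgEquiv.ofInjective (sphereEmb q).toStarAlgHom
    (sphereEmb_injective q)).apply_symm_apply ⟨_, Delta_mem_range q x⟩)

/-- The coaction is ergodic. -/
theorem coaction_eq_j₂_iff (x : CS2 q) :
    coaction q x = j₂ (zeta q) (SUq2 q) (CS2 q) x ↔ ∃ c : ℂ, x = c • (1 : CS2 q) := by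
  constructor
  · intro h
    have h1 := congrArg (sphereEmb q) h
    rw [sphereEmb_coaction, sphereEmb_j₂] at h1
    -- Apply the character f ↦ π(f)(1) to the second leg. It plays the role of the counit: Δ(x)
    -- becomes j₁(x), whereas j₂(x) becomes the scalar π(x)(1).
    have h2 := map_evalConst_Delta q 1 (sphereIncl q x)
    rw [h1, BT.map_j₂, BT.map_j₂, (rightAction q).mor_one, evalConst_apply, map_smul,
      map_one (j₂ (zeta q) (SUq2 q) C(Circle, ℂ)).toStarAlgHom] at h2
    refine ⟨toCircleAlg q (sphereIncl q x) 1, sphereIncl_injective q ?_⟩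
    refine j₁_injective (zeta q) (B := C(Circle, ℂ)) ?_
    rw [map_smul, map_one (sphereIncl q).toStarAlgHom, map_smul,
      map_one (j₁ (zeta q) (SUq2 q) C(Circle, ℂ)).toStarAlgHom]
    exact h2.symm
  · rintro ⟨c, rfl⟩
    rw [map_smul, map_smul, map_one, map_one]

/-! ### Density -/

/-- The span of the products `j₁(a) Δ(b)`. -/
def deltaSpan : Submodule ℂ (SU2SU q) :=
  Submodule.span ℂ {y | ∃ a b, y = j₁ (zeta q) _ _ a * Delta q b}

/-- Together with `mul_Delta_mem`: the span is a left module over j₁(C(SU_q(2))) and a right module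
over the image of Δ. It is not evidently closed under products, so density cannot be read off from
generators alone. -/
lemma j₁_mul_mem (a : SUq2 q) {y : SU2SU q} (hy : y ∈ deltaSpan q) :
    j₁ (zeta q) _ _ a * y ∈ deltaSpan q := by
  induction hy using Submodule.span_induction with
  | mem y hy =>
    obtain ⟨a', b, rfl⟩ := hy
    rw [← mul_assoc, ← map_mul]
    exact Submodule.subset_span ⟨_, _, rfl⟩
  | zero => rw [mul_zero]; exact Submodule.zero_mem _
  | add x y _ _ hx hy => rw [mul_add]; exact Submodule.add_mem _ hx hy
  | smul c x _ hx => rw [mul_smul_comm]; exact Submodule.smul_mem _ _ hx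

lemma mul_Delta_mem (b : SUq2 q) {y : SU2SU q} (hy : y ∈ deltaSpan q) :
    y * Delta q b ∈ deltaSpan q := by
  induction hy using Submodule.span_induction with
  | mem y hy =>
    obtain ⟨a', b, rfl⟩ := hy
    rw [mul_assoc, ← map_mul]
    exact Submodule.subset_span ⟨_, _, rfl⟩
  | zero => rw [zero_mul]; exact Submodule.zero_mem _
  | add x y _ _ hx hy => rw [add_mul]; exact Submodule.add_mem _ hx hy
  | smul c x _ hx => rw [smul_mul_assoc]; exact Submodule.smul_mem _ _ hx

/-- If `b` is homogeneous and `j₂(b)` belongs to the span of the `j₁(a) Δ(c)`, then multiplication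
by `j₂(b)` preserves the closed span. -/
lemma j₂_mul_mem {n : ℤ} {b : SUq2 q} (hb : IsHomogeneous n b)
    (h : j₂ (zeta q) (SUq2 q) _ b ∈ deltaSpan q) {y : SU2SU q}
    (hy : y ∈ (deltaSpan q).topologicalClosure) :
    j₂ (zeta q) (SUq2 q) _ b * y ∈ (deltaSpan q).topologicalClosure := by
  let N := (deltaSpan q).topologicalClosure
  have hcl : IsClosed (N : Set (SU2SU q)) := Submodule.isClosed_topologicalClosure _
  have key : ∀ a c : SUq2 q,
      j₂ (zeta q) (SUq2 q) _ b * (j₁ (zeta q) _ (SUq2 q) a * Delta q c) ∈ N := by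
    intro a c
    let f : SUq2 q →L[ℂ] SU2SU q :=
      (ContinuousLinearMap.mul ℂ (SU2SU q) (j₂ (zeta q) (SUq2 q) _ b)).comp
        (((ContinuousLinearMap.mul ℂ (SU2SU q)).flip (Delta q c)).comp
          (toCLM (j₁ (zeta q) _ (SUq2 q)).toStarAlgHom))
    have hf : ∀ a, f a = j₂ (zeta q) (SUq2 q) _ b * (j₁ (zeta q) _ (SUq2 q) a * Delta q c) :=
      fun a => by
        simp only [f, ContinuousLinearMap.comp_apply, ContinuousLinearMap.mul_apply',
          ContinuousLinearMap.flip_apply, toCLM_apply]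
    rw [← hf]
    refine mem_of_closure_span f hcl ?_ (dense_homogeneous a)
    rintro a ⟨m, ha⟩
    -- For homogeneous a the factor j₂(b) moves past j₁(a) up to a scalar. It then stands between
    -- j₁(a) and Δ(c), and the two module properties apply.
    rw [hf, ← mul_assoc, j₂_mul_j₁ _ ha hb, smul_mul_assoc, mul_assoc]
    exact Submodule.smul_mem _ _ (Submodule.le_topologicalClosure _
      (j₁_mul_mem q a (mul_Delta_mem q c h)))
  refine mem_of_closure_span (ContinuousLinearMap.mul ℂ (SU2SU q) (j₂ (zeta q) (SUq2 q) _ b))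
    hcl ?_ hy
  rintro _ ⟨a, c, rfl⟩
  rw [ContinuousLinearMap.mul_apply']
  exact key a c

variable {q}

lemma mul_self_conj_eq (q : ℂ) : ((‖q‖ : ℂ) ^ 2) = q * conj q := by
  rw [Complex.mul_conj, Complex.normSq_eq_norm_sq, Complex.ofReal_pow]

/-! ### Inverting the matrices that define the coproduct -/

section Recover

variable {D : Type} [CStarAlgebra D] {a c b d : D}

/-- The column (Δ(α), Δ(γ)) is the matrix with rows (a, -qc⋆), (c, a⋆) applied to the column (b, d).
The coefficients here are the first row (a⋆, c⋆) of its adjoint, which is a left inverse. -/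
lemma SURel.recover_fst (h : SURel q a c) :
    star a * (a * b - q • (star c * d)) + star c * (c * b + star a * d) = b := by
  have : star a * (a * b - q • (star c * d)) + star c * (c * b + star a * d) =
      (star a * a + star c * c) * b + (star c * star a - q • (star a * star c)) * d := by
    simp only [mul_sub, mul_add, add_mul, sub_mul, mul_smul_comm, smul_mul_assoc, mul_assoc]
    abel
  rw [this, h.star_mul_add, h.adj_comm, sub_self, one_mul, zero_mul, add_zero]

/-- The second row (-q̄c, a) of the adjoint matrix. -/
lemma SURel.recover_snd (h : SURel q a c) :
    -(conj q • c) * (a * b - q • (star c * d)) + a * (c * b + star a * d) = d := by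
  have : -(conj q • c) * (a * b - q • (star c * d)) + a * (c * b + star a * d) =
      (a * c - conj q • (c * a)) * b + (a * star a + (q * conj q) • (c * star c)) * d := by
    simp only [mul_sub, mul_add, add_mul, sub_mul, mul_smul_comm, smul_mul_assoc, mul_assoc,
      neg_mul, smul_neg, smul_smul]
    abel
  rw [this, h.mul_comm_smul, sub_self, h.normal, ← mul_self_conj_eq, h.mul_star_add, one_mul,
    zero_mul, zero_add]

/-- For adjoints the matrix has rows (a⋆, -qc), (c⋆, a), with b and d in the role of the adjoints of
the second-leg generators. The adjoint of this matrix does not invert it; the first row of the left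
inverse is (a, |q|²c). -/
lemma SURel.recover_fst_star (h : SURel q a c) :
    a * (star a * b - q • (c * d)) + (q * conj q) • (c * (star c * b + a * d)) = b := by
  have : a * (star a * b - q • (c * d)) + (q * conj q) • (c * (star c * b + a * d)) =
      (a * star a + (q * conj q) • (c * star c)) * b +
        (q • (conj q • (c * a) - a * c)) * d := by
    simp only [mul_sub, mul_add, add_mul, sub_mul, mul_smul_comm, smul_mul_assoc, mul_assoc,
      smul_smul, smul_add, smul_sub]
    abel
  rw [this, h.mul_comm_smul, sub_self, h.normal, ← mul_self_conj_eq, h.mul_star_add, one_mul,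
    smul_zero, zero_mul, add_zero]

/-- The second row of that left inverse is (-q⁻¹c⋆, a⋆). This is where q ≠ 0 enters. -/
lemma SURel.recover_snd_star (hq : q ≠ 0) (h : SURel q a c) :
    -(q⁻¹ • star c) * (star a * b - q • (c * d)) + star a * (star c * b + a * d) = d := by
  have : -(q⁻¹ • star c) * (star a * b - q • (c * d)) + star a * (star c * b + a * d) =
      (star a * star c - q⁻¹ • (star c * star a)) * b +
        (star a * a + (q⁻¹ * q) • (star c * c)) * d := by
    simp only [mul_sub, mul_add, add_mul, sub_mul, mul_smul_comm, smul_mul_assoc, mul_assoc,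
      neg_mul, smul_neg, smul_smul]
    rw [mul_comm q]
    abel
  rw [this, h.adj_comm, smul_smul, inv_mul_cancel₀ hq, one_smul, one_smul, sub_self,
    h.star_mul_add, one_mul, zero_mul, zero_add]

end Recover

variable (q)

/-- Taking adjoints reverses the legs. Moving j₂(γ⋆) back past j₁(γ) produces ζ, and q̄ζ = q, so the
coefficient is again q. -/
lemma Delta_star_alpha : Delta q (star (alpha q)) =
    star (j₁ (zeta q) _ _ (alpha q)) * star (j₂ (zeta q) (SUq2 q) _ (alpha q)) -
      q • (j₁ (zeta q) _ _ (gamma q) * star (j₂ (zeta q) (SUq2 q) _ (gamma q))) := by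
  have ha := alpha_homogeneous q
  have hc := gamma_homogeneous q
  have h1 := j₂_mul_j₁ (zeta q) ha.star ha.star
  have h2 := j₂_mul_j₁ (zeta q) hc hc.star
  simp only [map_star] at h1 h2
  rw [map_star, Delta_alpha, deltaAlpha, star_sub, star_mul, star_smul, star_mul, map_star,
    star_star, h1, h2]
  simp [smul_smul, conj_mul_zeta q]

/-- No power of ζ appears, since in each term one of the two factors has degree zero. -/
lemma Delta_star_gamma : Delta q (star (gamma q)) =
    star (j₁ (zeta q) _ _ (gamma q)) * star (j₂ (zeta q) (SUq2 q) _ (alpha q)) +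
      j₁ (zeta q) _ _ (alpha q) * star (j₂ (zeta q) (SUq2 q) _ (gamma q)) := by
  have ha := alpha_homogeneous q
  have hc := gamma_homogeneous q
  have h1 := j₂_mul_j₁ (zeta q) hc.star ha.star
  have h2 := j₂_mul_j₁ (zeta q) ha hc.star
  simp only [map_star] at h1 h2
  rw [map_star, Delta_gamma, deltaGamma, star_add, star_mul, star_mul, map_star,
    star_star, h1, h2]
  simp

lemma j₁_mul_Delta_mem (a b : SUq2 q) : j₁ (zeta q) _ _ a * Delta q b ∈ deltaSpan q :=
  Submodule.subset_span ⟨a, b, rfl⟩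

lemma j₁_suRel : SURel q (j₁ (zeta q) _ (SUq2 q) (alpha q)) (j₁ (zeta q) _ (SUq2 q) (gamma q)) :=
  (suRel q).map q (j₁ _ _ _).toStarAlgHom

lemma j₂_alpha_mem : j₂ (zeta q) (SUq2 q) _ (alpha q) ∈ deltaSpan q := by
  have h := (j₁_suRel q).recover_fst (b := j₂ (zeta q) (SUq2 q) _ (alpha q))
    (d := j₂ (zeta q) (SUq2 q) _ (gamma q))
  rw [← h]
  have h1 := j₁_mul_Delta_mem q (star (alpha q)) (alpha q)
  have h2 := j₁_mul_Delta_mem q (star (gamma q)) (gamma q)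
  rw [Delta_alpha, deltaAlpha, map_star, map_star] at h1
  rw [Delta_gamma, deltaGamma, map_star, map_star] at h2
  exact Submodule.add_mem _ h1 h2

lemma j₂_gamma_mem : j₂ (zeta q) (SUq2 q) _ (gamma q) ∈ deltaSpan q := by
  have h := (j₁_suRel q).recover_snd (b := j₂ (zeta q) (SUq2 q) _ (alpha q))
    (d := j₂ (zeta q) (SUq2 q) _ (gamma q))
  rw [← h]
  have h1 := j₁_mul_Delta_mem q (-(conj q • gamma q)) (alpha q)
  have h2 := j₁_mul_Delta_mem q (alpha q) (gamma q)
  rw [Delta_alpha, deltaAlpha, map_star, map_neg, map_smul] at h1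
  rw [Delta_gamma, deltaGamma, map_star] at h2
  exact Submodule.add_mem _ h1 h2

lemma j₂_star_alpha_mem : j₂ (zeta q) (SUq2 q) _ (star (alpha q)) ∈ deltaSpan q := by
  have h := (j₁_suRel q).recover_fst_star (b := star (j₂ (zeta q) (SUq2 q) _ (alpha q)))
    (d := star (j₂ (zeta q) (SUq2 q) _ (gamma q)))
  rw [map_star, ← h, ← Delta_star_alpha, ← Delta_star_gamma]
  exact Submodule.add_mem _ (j₁_mul_Delta_mem q _ _)
    (Submodule.smul_mem _ _ (j₁_mul_Delta_mem q _ _))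

variable {q} in
lemma j₂_star_gamma_mem (hq : q ≠ 0) :
    j₂ (zeta q) (SUq2 q) _ (star (gamma q)) ∈ deltaSpan q := by
  have h := (j₁_suRel q).recover_snd_star hq (b := star (j₂ (zeta q) (SUq2 q) _ (alpha q)))
    (d := star (j₂ (zeta q) (SUq2 q) _ (gamma q)))
  rw [map_star, ← h, ← Delta_star_alpha, ← Delta_star_gamma]
  have h1 := j₁_mul_Delta_mem q (-(q⁻¹ • star (gamma q))) (star (alpha q))
  have h2 := j₁_mul_Delta_mem q (star (alpha q)) (star (gamma q))
  rw [map_neg, map_smul, map_star (j₁ (zeta q) (SUq2 q) (SUq2 q)).toStarAlgHom] at h1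
  rw [map_star (j₁ (zeta q) (SUq2 q) (SUq2 q)).toStarAlgHom] at h2
  exact Submodule.add_mem _ h1 h2

variable {q} in
/-- The products `j₁(a) Δ(b)` span a dense subspace. -/
theorem deltaSpan_dense (hq : q ≠ 0) : (deltaSpan q).topologicalClosure = ⊤ := by
  let N := (deltaSpan q).topologicalClosure
  have hcl : IsClosed (N : Set (SU2SU q)) := Submodule.isClosed_topologicalClosure _
  -- The closed span is invariant under left multiplication by j₂ of each generator and its adjoint,
  -- hence of each `*`-polynomial. Applied to 1, this gives j₂(b) for a dense set of b.
  have hpoly : ∀ x : FreeStar (Fin 2), ∀ y ∈ N,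
      j₂ (zeta q) (SUq2 q) _ ((suPres q).family.toEnv x) * y ∈ N := by
    intro x
    induction x using FreeStar.induction with
    | scalar c =>
      intro y hy
      rw [AlgHomClass.commutes, AlgHomClass.commutes, ← Algebra.smul_def]
      exact Submodule.smul_mem _ _ hy
    | letter p =>
      intro y hy
      rcases p with ⟨i, _ | _⟩
      · fin_cases i
        · exact j₂_mul_mem q (alpha_homogeneous q) (j₂_alpha_mem q) hy
        · exact j₂_mul_mem q (gamma_homogeneous q) (j₂_gamma_mem q) hy
      · have : FreeStar.letter (i, true) = star (FreeStar.gen i) := by simp [FreeStar.gen]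
        rw [this, map_star (suPres q).family.toEnv]
        fin_cases i
        · exact j₂_mul_mem q (alpha_homogeneous q).star (j₂_star_alpha_mem q) hy
        · exact j₂_mul_mem q (gamma_homogeneous q).star (j₂_star_gamma_mem hq) hy
    | mul a b ha hb =>
      intro y hy
      rw [map_mul, map_mul, mul_assoc]
      exact ha _ (hb y hy)
    | add a b ha hb =>
      intro y hy
      rw [map_add, map_add, add_mul]
      exact Submodule.add_mem _ (ha y hy) (hb y hy)
  have h1 : ∀ b, j₂ (zeta q) (SUq2 q) _ b ∈ N := by
    intro b
    refine (suPres q).family.denseRange_coe.induction_on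
      (p := fun b => j₂ (zeta q) (SUq2 q) (SUq2 q) b ∈ N) b
      (hcl.preimage (map_continuous (j₂ (zeta q) (SUq2 q) (SUq2 q)).toStarAlgHom)) fun x => ?_
    have h2 : (1 : SU2SU q) ∈ N := Submodule.le_topologicalClosure _ (by
      have := j₁_mul_Delta_mem q 1 1
      rwa [map_one, map_one, one_mul] at this)
    have h3 := hpoly x 1 h2
    rwa [mul_one] at h3
  refine eq_top_iff.2 fun y _ => ?_
  refine closure_minimal (t := (N : Set (SU2SU q))) ?_ hcl (BT.dense (zeta q) (SUq2 q) (SUq2 q) y)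
  rw [SetLike.coe_subset_coe, Submodule.span_le]
  rintro _ ⟨a, b, rfl⟩
  change j₁ (zeta q) _ _ a * j₂ (zeta q) _ _ b ∈ N
  have : Set.MapsTo (fun y => j₁ (zeta q) _ (SUq2 q) a * y) (deltaSpan q : Set (SU2SU q)) (deltaSpan q) :=
    fun y hy => j₁_mul_mem q a hy
  exact map_mem_closure (continuous_const.mul continuous_id) (h1 b) this

/-- On generators: id ⊠ β fixes the first leg by definition and the second because the sphere
consists of fixed points of β. -/
lemma rightAction₂_sphereEmb (w : Circle) (y : BT (zeta q) (SUq2 q) (CS2 q)) :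
    (rightAction₂ q).mor w (sphereEmb q y) = sphereEmb q y := by
  refine DFunLike.congr_fun (BT.hom_ext (zeta q)
    (f := ((rightAction₂ q).mor w).toStarAlgHom.comp (sphereEmb q).toStarAlgHom)
    (g := (sphereEmb q).toStarAlgHom) (fun a => ?_) fun x => ?_) y
  · change (rightAction₂ q).mor w (sphereEmb q (j₁ _ _ _ a)) = sphereEmb q (j₁ _ _ _ a)
    rw [sphereEmb_j₁]
    simp [rightAction₂]
  · change (rightAction₂ q).mor w (sphereEmb q (j₂ _ _ _ x)) = sphereEmb q (j₂ _ _ _ x)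
    rw [sphereEmb_j₂, rightAction₂, EquivAction.braid_mor_j₂, rightAction_sphereIncl]

variable {q} in
/-- The Podleś condition for the coaction. -/
theorem coaction_dense (hq : q ≠ 0) :
    closure (Submodule.span ℂ {y | ∃ (a : SUq2 q) (x : CS2 q),
      y = j₁ (zeta q) (SUq2 q) (CS2 q) a * coaction q x} :
        Set (BT (zeta q) (SUq2 q) (CS2 q))) = Set.univ := by
  refine Set.eq_univ_of_forall fun y => ?_
  -- As id ⊠ ι is isometric, the closure may be computed in the braided square, where the averaging
  -- map is available.
  rw [(isometry_sphereEmb q).isUniformInducing.isInducing.closure_eq_preimage_closure_image]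
  have h1 : sphereEmb q y ∈ closure (deltaSpan q : Set (SU2SU q)) := by
    have : sphereEmb q y ∈ (deltaSpan q).topologicalClosure := by
      rw [deltaSpan_dense hq]; trivial
    exact this
  change sphereEmb q y ∈ closure (sphereEmb q '' _)
  -- The image of y is its own average. It is a limit of sums of j₁(a)Δ(b), whose averages
  -- j₁(a)Δ(E(b)) are the images of j₁(a)Γ(E(b)).
  rw [← average₂_of_fixed q fun w => rightAction₂_sphereEmb q w y]
  refine map_mem_closure (average₂ q).continuous h1 ?_
  change deltaSpan q ≤ ((Submodule.span ℂ _).map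
    ((sphereEmb q).toStarAlgHom : BT (zeta q) (SUq2 q) (CS2 q) →ₗ[ℂ] SU2SU q)).comap
      (average₂ q : SU2SU q →ₗ[ℂ] SU2SU q)
  rw [deltaSpan, Submodule.span_le]
  rintro _ ⟨a, b, rfl⟩
  refine ⟨j₁ _ _ _ a * coaction q (sphereAverage q b),
    Submodule.subset_span ⟨_, _, rfl⟩, ?_⟩
  change sphereEmb q _ = average₂ q (j₁ _ _ _ a * Delta q b)
  rw [average₂_j₁_mul_Delta, map_mul, sphereEmb_j₁, sphereEmb_coaction,
    sphereIncl_sphereAverage]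

end Coaction

/-! ### Coassociativity -/

section Coassociativity

/-- Two `*`-homomorphisms on `A ⊠ B` that agree on the factors are equal. -/
lemma BT.congr_hom {ζ : Circle} {A B D : Type} [CStarAlgebra A] [CircleAction A] [CStarAlgebra B]
    [CircleAction B] [CStarAlgebra D] (f g : BT ζ A B →⋆ₐ[ℂ] D)
    (h₁ : ∀ a, f (j₁ ζ A B a) = g (j₁ ζ A B a)) (h₂ : ∀ b, f (j₂ ζ A B b) = g (j₂ ζ A B b))
    (x : BT ζ A B) : f x = g x :=
  DFunLike.congr_fun (BT.hom_ext ζ h₁ h₂) x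

/-- The associator is natural in the third argument. -/
lemma IsAssociator.natural_right {ζ : Circle} {A B C C' : Type} [CStarAlgebra A] [CircleAction A]
    [CStarAlgebra B] [CircleAction B] [CStarAlgebra C] [CircleAction C] [CStarAlgebra C']
    [CircleAction C'] {e : BT ζ (BT ζ A B) C ≃⋆ₐ[ℂ] BT ζ A (BT ζ B C)}
    {e' : BT ζ (BT ζ A B) C' ≃⋆ₐ[ℂ] BT ζ A (BT ζ B C')} (h : IsAssociator ζ e)
    (h' : IsAssociator ζ e') (g : TMor C C') (x : BT ζ (BT ζ A B) C) :
    BT.map ζ (TMor.id A) (BT.map ζ (TMor.id B) g) (e x) =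
      e' (BT.map ζ (TMor.id (BT ζ A B)) g x) := by
  let E : BT ζ (BT ζ A B) C →⋆ₐ[ℂ] BT ζ A (BT ζ B C) := e
  let E' : BT ζ (BT ζ A B) C' →⋆ₐ[ℂ] BT ζ A (BT ζ B C') := e'
  let F := (BT.map ζ (TMor.id A) (BT.map ζ (TMor.id B) g)).toStarAlgHom.comp E
  let G := E'.comp (BT.map ζ (TMor.id (BT ζ A B)) g).toStarAlgHom
  refine BT.congr_hom F G (fun y => ?_) (fun c => ?_) x
  · refine BT.congr_hom (F.comp (j₁ ζ (BT ζ A B) C).toStarAlgHom)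
      (G.comp (j₁ ζ (BT ζ A B) C).toStarAlgHom) (fun a => ?_) (fun b => ?_) y
    · change BT.map ζ (TMor.id A) (BT.map ζ (TMor.id B) g) (e (j₁ ζ _ C (j₁ ζ A B a))) =
        e' (BT.map ζ (TMor.id (BT ζ A B)) g (j₁ ζ _ C (j₁ ζ A B a)))
      rw [h.fst, BT.map_j₁, BT.map_j₁]
      exact (h'.fst a).symm
    · change BT.map ζ (TMor.id A) (BT.map ζ (TMor.id B) g) (e (j₁ ζ _ C (j₂ ζ A B b))) =
        e' (BT.map ζ (TMor.id (BT ζ A B)) g (j₁ ζ _ C (j₂ ζ A B b)))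
      rw [h.snd, BT.map_j₂, BT.map_j₁, BT.map_j₁]
      exact (h'.snd b).symm
  · change BT.map ζ (TMor.id A) (BT.map ζ (TMor.id B) g) (e (j₂ ζ _ C c)) =
      e' (BT.map ζ (TMor.id (BT ζ A B)) g (j₂ ζ _ C c))
    rw [h.trd, BT.map_j₂, BT.map_j₂, BT.map_j₂]
    exact (h'.trd _).symm

variable (q : ℂ)

/-- The coproduct is coassociative. -/
theorem Delta_coassoc {e : BT (zeta q) (SU2SU q) (SUq2 q) ≃⋆ₐ[ℂ] BT (zeta q) (SUq2 q) (SU2SU q)}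
    (he : IsAssociator (zeta q) e) (x : SUq2 q) :
    e (BT.map (zeta q) (Delta q) (TMor.id _) (Delta q x)) =
      BT.map (zeta q) (TMor.id _) (Delta q) (Delta q x) := by
  let E : BT (zeta q) (SU2SU q) (SUq2 q) →⋆ₐ[ℂ] BT (zeta q) (SUq2 q) (SU2SU q) := e
  have e1 : ∀ a, E (j₁ _ _ _ (j₁ _ _ _ a)) = j₁ _ _ _ a := he.fst
  have e2 : ∀ a, E (j₁ _ _ _ (j₂ _ _ _ a)) = j₂ _ _ _ (j₁ _ _ _ a) := he.snd
  have e3 : ∀ a, E (j₂ _ _ _ a) = j₂ _ _ _ (j₂ _ _ _ a) := he.trd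
  have hid : ∀ a : SUq2 q, TMor.id (SUq2 q) a = a := fun _ => rfl
  refine su_hom_ext
    (f := (E.comp (BT.map (zeta q) (Delta q) (TMor.id _)).toStarAlgHom).comp
      (Delta q).toStarAlgHom)
    (g := (BT.map (zeta q) (TMor.id _) (Delta q)).toStarAlgHom.comp (Delta q).toStarAlgHom)
    ?_ ?_ x
  · simp only [StarAlgHom.comp_apply]
    rw [Delta_alpha]
    -- The term with j₁(γ⋆) brings in Δ(γ⋆). With `Delta_star_gamma` it already has its legs in
    -- order, so both sides expand to sums of products in the order of the three legs and no
    -- braiding scalar is left.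
    simp only [deltaAlpha, deltaGamma, map_sub, map_smul, map_mul, BT.map_j₁, BT.map_j₂,
      Delta_alpha, Delta_gamma, Delta_star_gamma, hid]
    simp only [map_add, map_mul, map_star, e1, e2, e3]
    simp only [mul_add, add_mul, mul_sub, sub_mul, smul_add, mul_assoc, smul_mul_assoc,
      mul_smul_comm]
    abel
  · simp only [StarAlgHom.comp_apply]
    rw [Delta_gamma]
    simp only [deltaGamma, deltaAlpha, map_add, map_mul, BT.map_j₁, BT.map_j₂, Delta_alpha,
      Delta_gamma, Delta_star_alpha, hid]
    simp only [map_sub, map_smul, map_mul, map_star, e1, e2, e3]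
    simp only [mul_add, add_mul, mul_sub, sub_mul, mul_assoc, smul_mul_assoc,
      mul_smul_comm]
    abel

/-- The coaction on the quotient sphere is coassociative. -/
theorem coaction_coassoc {e : BT (zeta q) (SU2SU q) (CS2 q) ≃⋆ₐ[ℂ]
      BT (zeta q) (SUq2 q) (BT (zeta q) (SUq2 q) (CS2 q))}
    (he : IsAssociator (zeta q) e) (x : CS2 q) :
    e (BT.map (zeta q) (Delta q) (TMor.id _) (coaction q x)) =
      BT.map (zeta q) (TMor.id _) (coaction q) (coaction q x) := by
  obtain ⟨e', he'⟩ := exists_isAssociator (zeta q) (SUq2 q) (SUq2 q) (SUq2 q)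
  -- Both sides are compared after the injective map id ⊠ (id ⊠ ι) into the threefold product of
  -- C(SU_q(2)), where coassociativity of Δ is known.
  refine BT.map_id_injective (zeta q) (sphereEmb q) (sphereEmb_injective q) ?_
  have h1 : ∀ y, BT.map (zeta q) (TMor.id (SU2SU q)) (sphereIncl q)
      (BT.map (zeta q) (Delta q) (TMor.id (CS2 q)) y) =
      BT.map (zeta q) (Delta q) (TMor.id (SUq2 q)) (sphereEmb q y) := by
    refine BT.congr_hom
      ((BT.map (zeta q) (TMor.id (SU2SU q)) (sphereIncl q)).toStarAlgHom.comp
        (BT.map (zeta q) (Delta q) (TMor.id (CS2 q))).toStarAlgHom)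
      ((BT.map (zeta q) (Delta q) (TMor.id (SUq2 q))).toStarAlgHom.comp
        (sphereEmb q).toStarAlgHom) (fun a => ?_) fun b => ?_
    · simp only [StarAlgHom.comp_apply, BT.map_j₁, sphereEmb_j₁]; rfl
    · simp only [StarAlgHom.comp_apply, BT.map_j₂, sphereEmb_j₂]; rfl
  have h2 : ∀ y, BT.map (zeta q) (TMor.id (SUq2 q)) (sphereEmb q)
      (BT.map (zeta q) (TMor.id (SUq2 q)) (coaction q) y) =
      BT.map (zeta q) (TMor.id (SUq2 q)) (Delta q) (sphereEmb q y) := by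
    refine BT.congr_hom
      ((BT.map (zeta q) (TMor.id (SUq2 q)) (sphereEmb q)).toStarAlgHom.comp
        (BT.map (zeta q) (TMor.id (SUq2 q)) (coaction q)).toStarAlgHom)
      ((BT.map (zeta q) (TMor.id (SUq2 q)) (Delta q)).toStarAlgHom.comp
        (sphereEmb q).toStarAlgHom) (fun a => ?_) fun b => ?_
    · simp only [StarAlgHom.comp_apply, BT.map_j₁, sphereEmb_j₁]; rfl
    · simp only [StarAlgHom.comp_apply, BT.map_j₂, sphereEmb_j₂, sphereEmb_coaction]
  -- By `h2` the right side becomes (id ⊠ Δ)Δ(x), which is e' of (Δ ⊠ id)Δ(x). By `h1` the last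
  -- embedding can be pulled out of Δ ⊠ id, and naturality of the associator moves it past e.
  rw [h2, sphereEmb_coaction, ← Delta_coassoc q he', ← sphereEmb_coaction, ← h1]
  exact he.natural_right he' (sphereIncl q) _

end Coassociativity

end BraidedSphere

end

/-! ### The main theorem -/

theorem mainTheorem1 (q : ℂ) (hq0 : 0 < ‖q‖) (hq1 : ‖q‖ < 1) :
    Function.Injective (BT.map (zeta q) (TMor.id (SUq2 q)) (sphereIncl q)) ∧
    ∃ Γ : TMor (CS2 q) (BT (zeta q) (SUq2 q) (CS2 q)),
      (∀ x, BT.map (zeta q) (TMor.id (SUq2 q)) (sphereIncl q) (Γ x) = Delta q (sphereIncl q x)) ∧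
      (∃ e : BT (zeta q) (BT (zeta q) (SUq2 q) (SUq2 q)) (CS2 q) ≃⋆ₐ[ℂ]
          BT (zeta q) (SUq2 q) (BT (zeta q) (SUq2 q) (CS2 q)),
        IsAssociator (zeta q) e ∧
        ∀ x, e (BT.map (zeta q) (Delta q) (TMor.id (CS2 q)) (Γ x)) =
          BT.map (zeta q) (TMor.id (SUq2 q)) Γ (Γ x)) ∧
      closure (Submodule.span ℂ {y | ∃ (a : SUq2 q) (x : CS2 q),
          y = j₁ (zeta q) (SUq2 q) (CS2 q) a * Γ x} : Set (BT (zeta q) (SUq2 q) (CS2 q))) =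
        Set.univ ∧
      ∀ x, Γ x = j₂ (zeta q) (SUq2 q) (CS2 q) x ↔ ∃ c : ℂ, x = c • (1 : CS2 q) := by
  obtain ⟨e, he⟩ := exists_isAssociator (zeta q) (SUq2 q) (SUq2 q) (CS2 q)
  exact ⟨sphereEmb_injective q, coaction q, sphereEmb_coaction q,
    ⟨e, he, coaction_coassoc q he⟩, coaction_dense (norm_pos_iff.1 hq0), coaction_eq_j₂_iff q⟩
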